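/- Call a function $f:\mathbb R\to\mathbb R$ a polynomial-exponential function (PEF) if $f(t)=\sum_{k=0}^{K} f_k(t)e^{\lambda_k t}$ for all $t\in\mathbb R$, where the $f_k$ are polynomials whose coefficients are (complex) algebraic numbers and the $\lambda_k$ are (complex) algebraic numbers. A *real root isolation* of $f$ in an interval $T\subseteq\mathbb R$ is a set of pairwise disjoint open intervals $(a_j,b_j)\subseteq T$ with $a_j,b_j\in\mathbb Q$ such that each $(a_j,b_j)$ contains exactly one root of $f$ and every root of $f$ in $T$ lies in some $(a_j,b_j)$. In algorithms, an algebraic number $\alpha$ is represented by $(P,(a,b),\varepsilon)$, where $P\in\mathbb Q[x]$ is a minimal polynomial of $\alpha$, $a,b,\varepsilon\in\mathbb Q$, $|\alpha-(a+bi)|<\varepsilon$, and $\alpha$ is the only root of $P$ in the open ball $B(a+bi,\varepsilon)$; a PEF is represented by the list of its pairs $(f_k,\lambda_k)$, and an interval by its rational endpoints and whether each of them is included. **Theorem.** There is an algorithm (a partial recursive function) for which the following holds, assuming Schanuel's conjecture. Let $f$ be a PEF that is not identically zero. Given any representation of $f$ and any bounded interval $T$ (open, half-open or closed) with rational endpoints,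 the algorithm terminates, and it outputs a finite real root isolation of $f$ in $T$, provided that no endpoint of $T$ that belongs to $T$ is a root of $f$. Moreover, $f$ has only finitely many roots in every bounded interval. -/

import Mathlib

open Polynomial

noncomputable section

namespace PEFIsolation

/-! ### Schanuel's conjecture -/

/-- Schanuel's conjecture: if `z₁, …, zₙ` are complex numbers that are linearly independent
over `ℚ`, then `ℚ(z₁, …, zₙ, exp z₁, …, exp zₙ)` has transcendence degree at least `n`
over `ℚ`. -/
def SchanuelConjecture : Prop :=
  ∀ (n : ℕ) (z : Fin n → ℂ), LinearIndependent ℚ z →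
    (n : Cardinal) ≤ Algebra.trdeg ℚ
      (IntermediateField.adjoin ℚ (Set.range z ∪ Set.range fun i => Complex.exp (z i)))

/-! ### Polynomial-exponential functions and root isolations -/

/-- The field of algebraic numbers, inside `ℂ`. -/
abbrev AlgNum : Type := algebraicClosure ℚ ℂ

/-- A polynomial-exponential expression `∑ₖ fₖ(t) exp(λₖ t)` with `fₖ` a polynomial with
algebraic coefficients and `λₖ` algebraic, given as the list of the pairs `(fₖ, λₖ)`. -/
abbrev PEF : Type := List (AlgNum[X] × AlgNum)

/-- The function `t ↦ ∑ₖ fₖ(t) exp(λₖ t)` of a real variable. -/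
def PEF.eval (f : PEF) (t : ℝ) : ℂ :=
  (f.map fun p => aeval (t : ℂ) p.1 * Complex.exp ((p.2 : ℂ) * (t : ℂ))).sum

/-- `f` takes only real values on the real line. -/
def PEF.IsReal (f : PEF) : Prop := ∀ t : ℝ, (f.eval t).im = 0

/-- A real root isolation of `g` in `T`: a set of mutually disjoint open intervals `(a, b) ⊆ T`
with rational endpoints, each containing exactly one root of `g`, and together containing every
root of `g` in `T`. -/
def IsRootIsolation (g : ℝ → ℂ) (T : Set ℝ) (S : Set (ℚ × ℚ)) : Prop :=
  S.PairwiseDisjoint (fun I => Set.Ioo (I.1 : ℝ) (I.2 : ℝ)) ∧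
  (∀ I ∈ S, Set.Ioo (I.1 : ℝ) (I.2 : ℝ) ⊆ T) ∧
  (∀ I ∈ S, ∃! t : ℝ, t ∈ Set.Ioo (I.1 : ℝ) (I.2 : ℝ) ∧ g t = 0) ∧
  (∀ t ∈ T, g t = 0 → ∃ I ∈ S, t ∈ Set.Ioo (I.1 : ℝ) (I.2 : ℝ))

/-! ### Finite representations, the inputs and outputs of algorithms -/

/-- The polynomial with the given list of coefficients, constant coefficient first. -/
def polyOfCoeffs {R : Type} [Semiring R] (l : List R) : R[X] :=
  l.foldr (fun a p => C a + X * p) 0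

/-- A code `(n, d)` of the rational number `n / (d + 1)`. -/
abbrev RatCode : Type := ℤ × ℕ

/-- The rational number coded by `(n, d)`. -/
def RatCode.value (q : RatCode) : ℚ := (q.1 : ℚ) / ((q.2 : ℚ) + 1)

/-- A code `(P, (a, b), ε)` of an algebraic number: `P` is given by its rational coefficients
and `a`, `b`, `ε` are rational. -/
abbrev AlgCode : Type := List RatCode × (RatCode × RatCode) × RatCode

/-- The polynomial `P` of the code `(P, (a, b), ε)`. -/
def AlgCode.poly (c : AlgCode) : ℚ[X] := polyOfCoeffs (c.1.map RatCode.value)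

/-- The centre `a + b i` of the code `(P, (a, b), ε)`. -/
def AlgCode.center (c : AlgCode) : ℂ := ⟨(c.2.1.1.value : ℝ), (c.2.1.2.value : ℝ)⟩

/-- The radius `ε` of the code `(P, (a, b), ε)`. -/
def AlgCode.radius (c : AlgCode) : ℝ := (c.2.2.value : ℝ)

/-- `(P, (a, b), ε)` represents `α`: `P` is a minimal polynomial of `α` over `ℚ` (a nonzero
rational polynomial of least degree that vanishes at `α`), `|α - (a + b i)| < ε`, and `α` is the
only root of `P` in the open ball of radius `ε` about `a + b i`. -/
def AlgCode.Represents (c : AlgCode) (α : AlgNum) : Prop :=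
  c.poly ≠ 0 ∧ aeval (α : ℂ) c.poly = 0 ∧
  (∀ Q : ℚ[X], Q ≠ 0 → aeval (α : ℂ) Q = 0 → c.poly.natDegree ≤ Q.natDegree) ∧
  ‖(α : ℂ) - c.center‖ < c.radius ∧
  (∀ β : ℂ, aeval β c.poly = 0 → ‖β - c.center‖ < c.radius → β = (α : ℂ))

/-- A code of a polynomial with algebraic coefficients: codes of its coefficients, constant
coefficient first. -/
abbrev PolyCode : Type := List AlgCode

/-- The code represents the polynomial `p`. -/
def PolyCode.Represents (c : PolyCode) (p : AlgNum[X]) : Prop :=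
  ∃ l : List AlgNum, List.Forall₂ AlgCode.Represents c l ∧ p = polyOfCoeffs l

/-- A code of a polynomial-exponential expression: codes of its terms `(fₖ, λₖ)`. -/
abbrev PEFCode : Type := List (PolyCode × AlgCode)

/-- The code represents the polynomial-exponential expression `f`. -/
def PEFCode.Represents (c : PEFCode) (f : PEF) : Prop :=
  List.Forall₂ (fun d p => PolyCode.Represents d.1 p.1 ∧ AlgCode.Represents d.2 p.2) c f

/-- A code `((l, p), (r, q))` of a bounded interval with rational endpoints `l` and `r`; the
booleans tell whether the left and the right endpoint are included. -/
abbrev IntervalCode : Type := (RatCode × Bool) × (RatCode × Bool)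

/-- The left endpoint. -/
def IntervalCode.left (T : IntervalCode) : ℝ := (T.1.1.value : ℝ)

/-- The right endpoint. -/
def IntervalCode.right (T : IntervalCode) : ℝ := (T.2.1.value : ℝ)

/-- The set of reals that makes up the interval. -/
def IntervalCode.toSet (T : IntervalCode) : Set ℝ :=
  {t | (T.left < t ∨ (T.1.2 = true ∧ t = T.left)) ∧ (t < T.right ∨ (T.2.2 = true ∧ t = T.right))}

/-- The set of pairs of rationals coded by a list of pairs of codes. -/
def decodeIntervals (L : List (RatCode × RatCode)) : Set (ℚ × ℚ) :=
  {I | ∃ J ∈ L, I = (J.1.value, J.2.value)}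

end PEFIsolation

end

/-!
The algorithm searches for a *certified result*: a list of intervals together with a certificate
whose correctness is semidecidable. Soundness of the certificates does not use Schanuel's
conjecture; the conjecture is what makes certificates exist, hence the search stop.

**Certificates.** The interval from `l` to `r` is subdivided at rational points. On each piece
`[a, b]` one of the following is checked.
* Some derivative `f⁽ᴹ⁾` has no zero on `[a, b]` while `f⁽ʲ⁾(p) = 0` for all `j < M` at a rational
  `p` in the piece. By Rolle's theorem `f` has no root on the piece except possibly `p`. The piece
  counts as free of roots if `M = 0` or `p` is an endpoint of the whole interval, and as having one
  root if `p` is inside of it (`OrderAt`).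
* There are expressions `u`, `v` with `f u = f' v` identically, `u` has no zero on the piece, and
  `f f'` is negative at `a` and positive at `b`. Then zeros of `f'` are zeros of `f`, so that `f`
  cannot have two roots, while the signs give one root (`DerivCert`).

**Semidecidability.** Absence of zeros on a compact interval and signs at rational points are
confirmed by ball arithmetic with integer data (`Encloses`, `semiDec_ne_zero`, `semiDec_re_pos`).
Equality of algebraic numbers is decided by a Liouville bound, since the norm of a nonzero algebraic
integer is at least `1` (`one_le_norm_mul_zBound`). An expression is identically zero if and only if
finitely many of its derivatives vanish at `0`, because the derivatives satisfy a linear recurrence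
(`eval_eq_zero_of_jet`). A zero at a rational `p ≠ 0` is confirmed by the stronger fact that the
expression vanishes identically once its polynomial coefficients are frozen at `p` (`RatZero`).

**Existence of certificates.** Let `μ₁, …, μₙ` be a basis of the group generated by the exponents.
Up to a factor `exp (κ t)` the function is `P (t, exp (μ₁ t), …, exp (μₙ t))` for a polynomial `P`
over a number field. For `t₀ ≠ 0`, Schanuel's conjecture makes `n` of the `n + 1` coordinates of the
point at `t₀` algebraically independent (`SchanuelConjecture.exists_algebraicIndependent`), and so, by
Gauss's lemma, a prime polynomial that vanishes at this point divides all others that do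
(`prime_dvd_of_aeval_eq_zero`). At rational `t₀ ≠ 0` the independent coordinates are the
exponentials, which gives `ratZero_of_eval_eq_zero`. At other roots, write `P = q ^ m * h` with a
prime `q` vanishing at the point and not dividing `h`, and let `D` be the derivation that corresponds
to `d/dt`. If `q` divided `D q`, then `q` would solve a linear differential equation with initial
value `0`, and `P` would vanish identically. So `u = m * D q * h + q * D h` does not vanish at the
point, and `P * u = D P * (q * h)` (`exists_polynomial_identity`). Hence every point has a
neighbourhood in which small pieces are certified, and a Lebesgue number of this cover gives a
certified subdivision (`exists_certified`).
-/

namespace PEFIsolation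
open Encodable

/-! ### Primitive recursive functions -/

-- Registered so that `fun_prop` composes the closure properties below, all stated for `fun a => _`.
attribute [fun_prop] Primrec

section Primrec

variable {α β γ σ : Type} [Primcodable α] [Primcodable β] [Primcodable γ] [Primcodable σ]

@[fun_prop] theorem primrec_id : Primrec (fun a : α => a) := Primrec.id

@[fun_prop] theorem primrec_const (x : β) : Primrec (fun _ : α => x) := Primrec.const x

@[fun_prop] theorem primrec_comp {f : β → γ} {g : α → β} (hf : Primrec f) (hg : Primrec g) :
    Primrec (fun a => f (g a)) := hf.comp hg

@[fun_prop] theorem primrec_prodMk {f : α → β} {g : α → γ} (hf : Primrec f) (hg : Primrec g) :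
    Primrec (fun a => (f a, g a)) := hf.pair hg

@[fun_prop] theorem primrec_fst {f : α → β × γ} (hf : Primrec f) : Primrec (fun a => (f a).1) :=
  Primrec.fst.comp hf

@[fun_prop] theorem primrec_snd {f : α → β × γ} (hf : Primrec f) : Primrec (fun a => (f a).2) :=
  Primrec.snd.comp hf

@[fun_prop] theorem primrec_nat_add {f g : α → ℕ} (hf : Primrec f) (hg : Primrec g) :
    Primrec (fun a => f a + g a) := Primrec.nat_add.comp hf hg

@[fun_prop] theorem primrec_nat_sub {f g : α → ℕ} (hf : Primrec f) (hg : Primrec g) :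
    Primrec (fun a => f a - g a) := Primrec.nat_sub.comp hf hg

@[fun_prop] theorem primrec_nat_mul {f g : α → ℕ} (hf : Primrec f) (hg : Primrec g) :
    Primrec (fun a => f a * g a) := Primrec.nat_mul.comp hf hg

@[fun_prop] theorem primrec_nat_div {f g : α → ℕ} (hf : Primrec f) (hg : Primrec g) :
    Primrec (fun a => f a / g a) := Primrec.nat_div.comp hf hg

@[fun_prop] theorem primrec_nat_pow {f g : α → ℕ} (hf : Primrec f) (hg : Primrec g) :
    Primrec (fun a => f a ^ g a) :=
  (Primrec₂.unpaired'.1 Nat.Primrec.pow).comp hf hg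

@[fun_prop] theorem primrec_iterate {n : α → ℕ} {g : α → γ} {h : α → γ → γ} (hn : Primrec n)
    (hg : Primrec g) (hh : Primrec (fun p : α × γ => h p.1 p.2)) :
    Primrec (fun a => (h a)^[n a] (g a)) :=
  Primrec.nat_iterate hn hg hh

@[fun_prop] theorem primrec_bif {c : α → Bool} {f g : α → β} (hc : Primrec c) (hf : Primrec f)
    (hg : Primrec g) : Primrec (fun a => bif c a then f a else g a) := Primrec.cond hc hf hg

@[fun_prop] theorem primrec_and {f g : α → Bool} (hf : Primrec f) (hg : Primrec g) :
    Primrec (fun a => f a && g a) := Primrec.and.comp hf hg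

@[fun_prop] theorem primrec_or {f g : α → Bool} (hf : Primrec f) (hg : Primrec g) :
    Primrec (fun a => f a || g a) := Primrec.or.comp hf hg

@[fun_prop] theorem primrec_not {f : α → Bool} (hf : Primrec f) :
    Primrec (fun a => !(f a)) := Primrec.not.comp hf

@[fun_prop] theorem primrec_ble {f g : α → ℕ} (hf : Primrec f) (hg : Primrec g) :
    Primrec (fun a => Nat.ble (f a) (g a)) := by
  have h := Primrec.nat_le.decide.comp hf hg
  refine h.of_eq fun a => ?_
  by_cases h : f a ≤ g a
  · rw [decide_eq_true h, Nat.ble_eq_true_of_le h]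
  · rw [decide_eq_false h, eq_comm, ← Bool.not_eq_true, Nat.ble_eq]
    exact h

@[fun_prop] theorem primrec_beq [DecidableEq β] {f g : α → β} (hf : Primrec f)
    (hg : Primrec g) : Primrec (fun a => f a == g a) := Primrec.beq.comp hf hg

@[fun_prop] theorem primrec_cons {f : α → β} {g : α → List β} (hf : Primrec f)
    (hg : Primrec g) : Primrec (fun a => f a :: g a) := Primrec.list_cons.comp hf hg

@[fun_prop] theorem primrec_append {f g : α → List β} (hf : Primrec f)
    (hg : Primrec g) : Primrec (fun a => f a ++ g a) := Primrec.list_append.comp hf hg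

@[fun_prop] theorem primrec_length {f : α → List β} (hf : Primrec f) :
    Primrec (fun a => (f a).length) := Primrec.list_length.comp hf

@[fun_prop] theorem primrec_range {f : α → ℕ} (hf : Primrec f) :
    Primrec (fun a => List.range (f a)) := Primrec.list_range.comp hf

@[fun_prop] theorem primrec_map {f : α → List β} {g : α → β → γ} (hf : Primrec f)
    (hg : Primrec (fun p : α × β => g p.1 p.2)) : Primrec (fun a => (f a).map (g a)) :=
  Primrec.list_map hf hg

@[fun_prop] theorem primrec_flatMap {f : α → List β} {g : α → β → List γ} (hf : Primrec f)
    (hg : Primrec (fun p : α × β => g p.1 p.2)) : Primrec (fun a => (f a).flatMap (g a)) :=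
  Primrec.list_flatMap hf hg

@[fun_prop] theorem primrec_foldr {f : α → List β} {g : α → γ} {h : α → β → γ → γ}
    (hf : Primrec f) (hg : Primrec g) (hh : Primrec (fun p : α × β × γ => h p.1 p.2.1 p.2.2)) :
    Primrec (fun a => (f a).foldr (h a) (g a)) :=
  Primrec.list_foldr (h := fun a b => h a b.1 b.2) hf hg hh

@[fun_prop] theorem primrec_getD_decode [Inhabited β] {f : α → ℕ} (hf : Primrec f) :
    Primrec (fun a => (decode (α := β) (f a)).getD default) :=
  Primrec.option_getD_default.comp (Primrec.decode.comp hf)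

/-- Bounded search for the greatest number with a given property. -/
theorem primrec_findGreatest {n : α → ℕ} {q : α → ℕ → Bool} (hn : Primrec n)
    (hq : Primrec (fun p : α × ℕ => q p.1 p.2)) :
    Primrec (fun a => Nat.findGreatest (fun k => q a k = true) (n a)) :=
  Primrec.nat_findGreatest (p := fun a k => q a k = true) hn
    (Primrec.primrecPred (p := fun p : α × ℕ => q p.1 p.2 = true) (hq.of_eq fun a => by simp))

/-! ### Integer arithmetic -/

/-- The rounding of `z / D` towards zero. -/
def intDiv (z : ℤ) (D : ℕ) : ℤ := ((z.toNat / D : ℕ) : ℤ) - (((-z).toNat / D : ℕ) : ℤ)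

/-- The truth value of `a < b`. -/
def intLt (a b : ℤ) : Bool := Nat.ble 1 (b - a).toNat

theorem intLt_iff {a b : ℤ} : intLt a b = true ↔ a < b := by
  unfold intLt; rw [Nat.ble_eq]; omega

theorem ble_iff {a b : ℕ} : Nat.ble a b = true ↔ a ≤ b := by rw [Nat.ble_eq]

theorem primrec_intEquivNat : Primrec (fun z : ℤ => Equiv.intEquivNat z) :=
  (Primrec.encode (α := ℤ)).of_eq fun _ => rfl

theorem primrec_intEquivNat_symm : Primrec (fun n : ℕ => Equiv.intEquivNat.symm n) :=
  (Primrec.ofNat ℤ).of_eq fun _ => rfl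

theorem intEquivNat_symm_even (n : ℕ) : Equiv.intEquivNat.symm (2 * n) = (n : ℤ) := by
  rw [Equiv.symm_apply_eq]; rfl

theorem intEquivNat_symm_odd (n : ℕ) : Equiv.intEquivNat.symm (2 * n + 1) = Int.negSucc n := by
  rw [Equiv.symm_apply_eq]; rfl

@[fun_prop] theorem primrec_natCast {f : α → ℕ} (hf : Primrec f) :
    Primrec (fun a => (f a : ℤ)) :=
  ((primrec_intEquivNat_symm.comp Primrec.nat_double).of_eq intEquivNat_symm_even).comp hf

theorem primrec_negSucc : Primrec (fun n : ℕ => Int.negSucc n) :=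
  (primrec_intEquivNat_symm.comp Primrec.nat_double_succ).of_eq intEquivNat_symm_odd

@[fun_prop] theorem primrec_toNat {f : α → ℤ} (hf : Primrec f) :
    Primrec (fun a => (f a).toNat) := by
  have h : Primrec (fun z : ℤ => bif Nat.bodd (Equiv.intEquivNat z) then 0
      else Nat.div2 (Equiv.intEquivNat z)) :=
    Primrec.cond (Primrec.nat_bodd.comp primrec_intEquivNat) (Primrec.const 0)
      (Primrec.nat_div2.comp primrec_intEquivNat)
  refine (h.of_eq fun z => ?_).comp hf
  cases z with
  | ofNat n =>
    have : Equiv.intEquivNat (n : ℤ) = 2 * n := rfl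
    simp [this, Nat.div2_val]
  | negSucc n =>
    have : Equiv.intEquivNat (Int.negSucc n) = 2 * n + 1 := rfl
    simp [this]

theorem primrec_natDiff {f g : α → ℕ} (hf : Primrec f) (hg : Primrec g) :
    Primrec (fun a => (f a : ℤ) - (g a : ℤ)) := by
  have h : Primrec (fun a => bif Nat.ble (g a) (f a) then (((f a - g a : ℕ)) : ℤ)
      else Int.negSucc (g a - f a - 1)) :=
    Primrec.cond (by fun_prop) (by fun_prop) (primrec_negSucc.comp (by fun_prop))
  refine h.of_eq fun a => ?_
  rcases hb : Nat.ble (g a) (f a) with _ | _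
  · have : ¬ g a ≤ f a := fun h => by rw [Nat.ble_eq_true_of_le h] at hb; cases hb
    simp only [cond_false]; omega
  · have : g a ≤ f a := Nat.le_of_ble_eq_true hb
    simp only [cond_true]; omega

@[fun_prop] theorem primrec_int_neg {f : α → ℤ} (hf : Primrec f) : Primrec (fun a => -(f a)) := by
  have h : Primrec (fun z : ℤ => -z) := by
    have h : Primrec (fun z : ℤ => bif Nat.bodd (Equiv.intEquivNat z) then
        ((Nat.div2 (Equiv.intEquivNat z) + 1 : ℕ) : ℤ)
        else ((0 : ℕ) : ℤ) - (Nat.div2 (Equiv.intEquivNat z) : ℤ)) :=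
      Primrec.cond (Primrec.nat_bodd.comp primrec_intEquivNat)
        (primrec_natCast (Primrec.succ.comp (Primrec.nat_div2.comp primrec_intEquivNat)))
        (primrec_natDiff (Primrec.const 0) (Primrec.nat_div2.comp primrec_intEquivNat))
    refine h.of_eq fun z => ?_
    cases z with
    | ofNat n =>
      have : Equiv.intEquivNat (n : ℤ) = 2 * n := rfl
      simp [this, Nat.div2_val]
    | negSucc n =>
      have : Equiv.intEquivNat (Int.negSucc n) = 2 * n + 1 := rfl
      simp [this, Int.neg_negSucc, Nat.div2_val]
  exact h.comp hf

@[fun_prop] theorem primrec_int_sub {f g : α → ℤ} (hf : Primrec f) (hg : Primrec g) :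
    Primrec (fun a => f a - g a) := by
  have h := primrec_natDiff
    (show Primrec fun a => (f a).toNat + (-(g a)).toNat by fun_prop)
    (show Primrec fun a => (-(f a)).toNat + (g a).toNat by fun_prop)
  refine h.of_eq fun a => ?_
  omega

@[fun_prop] theorem primrec_int_add {f g : α → ℤ} (hf : Primrec f) (hg : Primrec g) :
    Primrec (fun a => f a + g a) := by
  have h : Primrec (fun a => f a - -(g a)) := by fun_prop
  exact h.of_eq fun a => by omega

theorem int_eq_toNat_sub (z : ℤ) : z = (z.toNat : ℤ) - ((-z).toNat : ℤ) := by omega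

@[fun_prop] theorem primrec_int_mul {f g : α → ℤ} (hf : Primrec f) (hg : Primrec g) :
    Primrec (fun a => f a * g a) := by
  have h := primrec_natDiff
    (show Primrec fun a => (f a).toNat * (g a).toNat + (-(f a)).toNat * (-(g a)).toNat by fun_prop)
    (show Primrec fun a => (f a).toNat * (-(g a)).toNat + (-(f a)).toNat * (g a).toNat by fun_prop)
  refine h.of_eq fun a => ?_
  conv_rhs => rw [int_eq_toNat_sub (f a), int_eq_toNat_sub (g a)]
  push_cast
  ring

@[fun_prop] theorem primrec_natAbs {f : α → ℤ} (hf : Primrec f) :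
    Primrec (fun a => (f a).natAbs) := by
  have h : Primrec (fun a => (f a).toNat + (-(f a)).toNat) := by fun_prop
  exact h.of_eq fun a => by omega

@[fun_prop] theorem primrec_intDiv {f : α → ℤ} {g : α → ℕ} (hf : Primrec f) (hg : Primrec g) :
    Primrec (fun a => intDiv (f a) (g a)) := by
  unfold intDiv; fun_prop

@[fun_prop] theorem primrec_intLt {f g : α → ℤ} (hf : Primrec f) (hg : Primrec g) :
    Primrec (fun a => intLt (f a) (g a)) := by
  unfold intLt; fun_prop

end Primrec

/-! ### Semidecidable predicates -/

section SemiDec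

variable {α β : Type} [Primcodable α] [Primcodable β]

/-- `p` is semidecidable on the inputs that satisfy the promise `S`: there, `p a` holds if and
only if a primitive recursive test accepts `a` together with some witness. -/
def SemiDec (S p : α → Prop) : Prop :=
  ∃ q : α → ℕ → Bool, Primrec (fun x : α × ℕ => q x.1 x.2) ∧ ∀ a, S a → (p a ↔ ∃ n, q a n = true)

namespace SemiDec

variable {S S' p q : α → Prop}

theorem of_bool {c : α → Bool} (hc : Primrec c) : SemiDec S (fun a => c a = true) :=
  ⟨fun a _ => c a, by fun_prop, fun a _ => by simp⟩

theorem congr (h : SemiDec S p) (hpq : ∀ a, S a → (q a ↔ p a)) : SemiDec S q := by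
  obtain ⟨c, hc, H⟩ := h
  exact ⟨c, hc, fun a ha => (hpq a ha).trans (H a ha)⟩

theorem comp {S : β → Prop} {p : β → Prop} (h : SemiDec S p) {g : α → β} (hg : Primrec g)
    (hS : ∀ a, S' a → S (g a)) : SemiDec S' (fun a => p (g a)) := by
  obtain ⟨c, hc, H⟩ := h
  exact ⟨fun a n => c (g a) n,
    primrec_comp (f := fun x : β × ℕ => c x.1 x.2) (g := fun x : α × ℕ => (g x.1, x.2)) hc
      (by fun_prop),
    fun a ha => H _ (hS a ha)⟩

theorem exists_decode {S : α → Prop} {p : α × β → Prop}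
    (h : SemiDec (fun x : α × β => S x.1) p) : SemiDec S (fun a => ∃ b, p (a, b)) := by
  obtain ⟨c, hc, H⟩ := h
  have hp : Primrec (fun x : (α × ℕ) × (β × ℕ) => c (x.1.1, x.2.1) x.2.2) :=
    primrec_comp (f := fun x : (α × β) × ℕ => c x.1 x.2)
      (g := fun x : (α × ℕ) × (β × ℕ) => ((x.1.1, x.2.1), x.2.2)) hc (by fun_prop)
  have h2 : Primrec (fun x : α × ℕ => ((decode (α := β × ℕ) x.2).map
      fun y => c (x.1, y.1) y.2).getD false) :=
    Primrec.option_getD.comp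
      (Primrec.option_map (Primrec.decode.comp (by fun_prop)) hp) (Primrec.const false)
  refine ⟨fun a n => ((decode (α := β × ℕ) n).map fun y => c (a, y.1) y.2).getD false, h2,
    fun a ha => ⟨?_, ?_⟩⟩
  · rintro ⟨b, hb⟩
    obtain ⟨m, hm⟩ := (H (a, b) ha).1 hb
    exact ⟨encode (b, m), by simp only [encodek, Option.map_some, Option.getD_some]; exact hm⟩
  · rintro ⟨n, hn⟩
    rcases hd : decode (α := β × ℕ) n with _ | ⟨b, m⟩
    · simp [hd] at hn
    · simp only [hd, Option.map_some, Option.getD_some] at hn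
      exact ⟨b, (H (a, b) ha).2 ⟨m, hn⟩⟩

theorem and (hp : SemiDec S p) (hq : SemiDec (fun a => S a ∧ p a) q) :
    SemiDec S (fun a => p a ∧ q a) := by
  obtain ⟨c, hc, H⟩ := hp
  obtain ⟨d, hd, K⟩ := hq
  have : SemiDec S (fun a => ∃ b : ℕ × ℕ, (c a b.1 && d a b.2) = true) := by
    refine exists_decode (of_bool (c := fun x : α × (ℕ × ℕ) => c x.1 x.2.1 && d x.1 x.2.2) ?_)
    exact primrec_and
      (primrec_comp (f := fun x : α × ℕ => c x.1 x.2) (g := fun x : α × (ℕ × ℕ) => (x.1, x.2.1))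
        hc (by fun_prop))
      (primrec_comp (f := fun x : α × ℕ => d x.1 x.2) (g := fun x : α × (ℕ × ℕ) => (x.1, x.2.2))
        hd (by fun_prop))
  refine this.congr fun a ha => ⟨?_, ?_⟩
  · rintro ⟨h1, h2⟩
    obtain ⟨m, hm⟩ := (H a ha).1 h1
    obtain ⟨n, hn⟩ := (K a ⟨ha, h1⟩).1 h2
    exact ⟨(m, n), by simp [hm, hn]⟩
  · rintro ⟨⟨m, n⟩, h⟩
    simp only [Bool.and_eq_true] at h
    have h1 := (H a ha).2 ⟨m, h.1⟩
    exact ⟨h1, (K a ⟨ha, h1⟩).2 ⟨n, h.2⟩⟩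

theorem or (hp : SemiDec S p) (hq : SemiDec S q) : SemiDec S (fun a => p a ∨ q a) := by
  obtain ⟨c, hc, H⟩ := hp
  obtain ⟨d, hd, K⟩ := hq
  refine ⟨fun a n => c a n || d a n, by fun_prop, fun a ha => ?_⟩
  simp only [H a ha, K a ha, Bool.or_eq_true, exists_or]

theorem mono (h : SemiDec S p) (hS : ∀ a, S' a → S a) : SemiDec S' p := by
  obtain ⟨c, hc, H⟩ := h
  exact ⟨c, hc, fun a ha => H a (hS a ha)⟩

/-- Bounded quantification: a common bound for the witnesses of finitely many instances is itself
a witness. -/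
theorem forall_mem {p : α × β → Prop} {l : α → List β} (hl : Primrec l)
    (h : SemiDec (fun x : α × β => S x.1 ∧ x.2 ∈ l x.1) p) :
    SemiDec S (fun a => ∀ b ∈ l a, p (a, b)) := by
  classical
  obtain ⟨c, hc, H⟩ := h
  have h1 : PrimrecRel fun (r : List ℕ) (x : β × α) => ∃ m ∈ r, c (x.2, x.1) m = true := by
    refine PrimrecRel.exists_mem_list (R := fun (m : ℕ) (x : β × α) => c (x.2, x.1) m = true) ?_
    refine Primrec.primrecPred (p := fun x : ℕ × (β × α) => c (x.2.2, x.2.1) x.1 = true) ?_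
    refine (primrec_comp (f := fun x : (α × β) × ℕ => c x.1 x.2)
      (g := fun x : ℕ × (β × α) => ((x.2.2, x.2.1), x.1)) hc (by fun_prop)).of_eq fun a => ?_
    simp
  have h2 : PrimrecRel fun (l : List β) (x : α × ℕ) => ∀ b ∈ l, ∃ m ∈ List.range x.2, c (x.1, b) m = true :=
    PrimrecRel.forall_mem_list (R := fun (b : β) (x : α × ℕ) => ∃ m ∈ List.range x.2, c (x.1, b) m = true)
      (PrimrecRel.comp (f := fun x : β × (α × ℕ) => List.range x.2.2)
        (g := fun x : β × (α × ℕ) => (x.1, x.2.1)) h1 (by fun_prop) (by fun_prop))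
  have h3 : PrimrecPred fun x : α × ℕ => ∀ b ∈ l x.1, ∃ m ∈ List.range x.2, c (x.1, b) m = true :=
    PrimrecRel.comp (f := fun x : α × ℕ => l x.1) (g := fun x : α × ℕ => x) h2
      (by fun_prop) (by fun_prop)
  refine ⟨fun a n => decide (∀ b ∈ l a, ∃ m ∈ List.range n, c (a, b) m = true),
    primrecPred_iff_primrec_decide.1 h3, fun a ha => ?_⟩
  simp only [decide_eq_true_eq]
  constructor
  · intro hp
    have : ∀ b ∈ l a, ∃ m, c (a, b) m = true := fun b hb => (H (a, b) ⟨ha, hb⟩).1 (hp b hb)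
    choose! w hw using this
    refine ⟨((l a).map w).sum + 1, fun b hb => ⟨w b, ?_, hw b hb⟩⟩
    exact List.mem_range.2 <| Nat.lt_succ_of_le (List.le_sum_of_mem (List.mem_map_of_mem hb))
  · rintro ⟨n, hn⟩ b hb
    obtain ⟨m, _, hm⟩ := hn b hb
    exact (H (a, b) ⟨ha, hb⟩).2 ⟨m, hm⟩

/-- Unbounded search turns a semidecidable relation into a partial recursive choice function. -/
theorem exists_partrec {R : α × β → Prop} (h : SemiDec (fun x : α × β => S x.1) R) :
    ∃ f : α →. β, Partrec f ∧ ∀ a, S a → (∃ b, R (a, b)) → ∃ b ∈ f a, R (a, b) := by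
  obtain ⟨c, hc, H⟩ := h
  have hc2 : Primrec (fun x : (α × ℕ) × (β × ℕ) =>
      bif c (x.1.1, x.2.1) x.2.2 then some x.2.1 else none) :=
    Primrec.cond (primrec_comp (f := fun x : (α × β) × ℕ => c x.1 x.2)
      (g := fun x : (α × ℕ) × (β × ℕ) => ((x.1.1, x.2.1), x.2.2)) hc (by fun_prop))
      (Primrec.option_some.comp (by fun_prop)) (Primrec.const none)
  have h2 : Primrec (fun x : α × ℕ => (decode (α := β × ℕ) x.2).bind
      fun y => bif c (x.1, y.1) y.2 then some y.1 else none) :=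
    Primrec.option_bind (Primrec.decode.comp (by fun_prop)) hc2
  refine ⟨fun a => Nat.rfindOpt fun n => (decode (α := β × ℕ) n).bind
      fun y => bif c (a, y.1) y.2 then some y.1 else none,
    Partrec.rfindOpt (Primrec₂.to_comp h2), fun a ha ⟨b, hb⟩ => ?_⟩
  obtain ⟨m, hm⟩ := (H (a, b) ha).1 hb
  have hdom := Nat.rfindOpt_dom.2 (⟨encode (b, m), b, by simp [hm]⟩ : ∃ n b',
    b' ∈ (decode (α := β × ℕ) n).bind fun y => bif c (a, y.1) y.2 then some y.1 else none)
  obtain ⟨b', hb'⟩ := Part.dom_iff_mem.1 hdom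
  refine ⟨b', hb', ?_⟩
  obtain ⟨n, hn⟩ := Nat.rfindOpt_spec hb'
  rcases hd : decode (α := β × ℕ) n with _ | ⟨b'', m'⟩
  · simp [hd] at hn
  · rcases hcc : c (a, b'') m' with _ | _
    · simp [hd, hcc] at hn
    · simp [hd, hcc] at hn
      subst hn
      exact (H (a, b'') ha).2 ⟨m', hcc⟩

end SemiDec

end SemiDec

end PEFIsolation

namespace PEFIsolation
open Encodable

/-! ### Gaussian integers -/

section Gauss

/-- The complex number `x + y i` given by a pair of integers. -/
def toC (w : ℤ × ℤ) : ℂ := (w.1 : ℂ) + (w.2 : ℂ) * Complex.I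

/-- The sum of Gaussian integers. -/
def gAdd (w z : ℤ × ℤ) : ℤ × ℤ := (w.1 + z.1, w.2 + z.2)

/-- The product of Gaussian integers. -/
def gMul (w z : ℤ × ℤ) : ℤ × ℤ := (w.1 * z.1 - w.2 * z.2, w.1 * z.2 + w.2 * z.1)

/-- The powers of a Gaussian integer. -/
def gPow (w : ℤ × ℤ) (n : ℕ) : ℤ × ℤ := (gMul w)^[n] (1, 0)

/-- The quotient of a Gaussian integer by a natural number, rounded towards zero in each
coordinate. -/
def gDiv (w : ℤ × ℤ) (D : ℕ) : ℤ × ℤ := (intDiv w.1 D, intDiv w.2 D)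

/-- The `ℓ¹` norm of a Gaussian integer. -/
def gAbs (w : ℤ × ℤ) : ℕ := w.1.natAbs + w.2.natAbs

theorem toC_re (w : ℤ × ℤ) : (toC w).re = w.1 := by simp [toC]

theorem toC_im (w : ℤ × ℤ) : (toC w).im = w.2 := by simp [toC]

theorem toC_gAdd (w z : ℤ × ℤ) : toC (gAdd w z) = toC w + toC z := by
  simp only [toC, gAdd]; push_cast; ring

theorem toC_gMul (w z : ℤ × ℤ) : toC (gMul w z) = toC w * toC z := by
  simp only [toC, gMul]; push_cast
  linear_combination (-(w.2 : ℂ) * z.2) * Complex.I_mul_I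

theorem toC_int (n : ℤ) : toC (n, 0) = n := by simp [toC]

theorem toC_gPow (w : ℤ × ℤ) (n : ℕ) : toC (gPow w n) = toC w ^ n := by
  induction n with
  | zero => simp [gPow, toC]
  | succ n ih =>
    unfold gPow at *
    rw [Function.iterate_succ_apply', toC_gMul, ih, pow_succ']

theorem norm_toC_le (w : ℤ × ℤ) : ‖toC w‖ ≤ gAbs w := by
  refine (Complex.norm_le_abs_re_add_abs_im _).trans ?_
  rw [toC_re, toC_im, gAbs]
  push_cast [Nat.cast_natAbs]
  exact le_rfl

theorem gAbs_le (w : ℤ × ℤ) : (gAbs w : ℝ) ≤ 2 * ‖toC w‖ := by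
  have h1 := Complex.abs_re_le_norm (toC w)
  have h2 := Complex.abs_im_le_norm (toC w)
  rw [toC_re] at h1
  rw [toC_im] at h2
  rw [gAbs]
  push_cast [Nat.cast_natAbs]
  linarith

theorem normSq_toC (w : ℤ × ℤ) : ‖toC w‖ ^ 2 = ((w.1 * w.1 + w.2 * w.2 : ℤ) : ℝ) := by
  rw [← Complex.normSq_eq_norm_sq, Complex.normSq_apply, toC_re, toC_im]
  push_cast; ring

theorem natDiv_cast (m D : ℕ) (hD : 1 ≤ D) :
    ((m / D : ℕ) : ℝ) ≤ (m : ℝ) / D ∧ (m : ℝ) / D < ((m / D : ℕ) : ℝ) + 1 := by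
  refine ⟨Nat.cast_div_le, ?_⟩
  rw [div_lt_iff₀ (by exact_mod_cast hD)]
  have := Nat.lt_div_mul_add (a := m) (show 0 < D by omega)
  have h2 : (m : ℝ) < ((m / D * D + D : ℕ) : ℝ) := by exact_mod_cast this
  push_cast at h2 ⊢
  linarith

theorem intDiv_cast (z : ℤ) (D : ℕ) (hD : 1 ≤ D) : |(intDiv z D : ℝ) - (z : ℝ) / D| ≤ 1 := by
  have h1 := natDiv_cast z.toNat D hD
  have h2 := natDiv_cast (-z).toNat D hD
  have h3 : (z : ℝ) = (z.toNat : ℝ) - ((-z).toNat : ℝ) := by exact_mod_cast int_eq_toNat_sub z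
  rw [intDiv, h3, sub_div, Int.cast_sub, Int.cast_natCast, Int.cast_natCast, abs_le]
  constructor <;> linarith [h1.1, h1.2, h2.1, h2.2]

theorem norm_gDiv_sub (w : ℤ × ℤ) (D : ℕ) (hD : 1 ≤ D) : ‖toC (gDiv w D) - toC w / D‖ ≤ 2 := by
  refine (Complex.norm_le_abs_re_add_abs_im _).trans ?_
  have h1 := intDiv_cast w.1 D hD
  have h2 := intDiv_cast w.2 D hD
  rw [Complex.sub_re, Complex.sub_im, toC_re, toC_im, Complex.div_natCast_re,
    Complex.div_natCast_im, toC_re, toC_im]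
  exact (add_le_add h1 h2).trans (by norm_num)

section

variable {α : Type} [Primcodable α]

@[fun_prop] theorem primrec_gAdd {f g : α → ℤ × ℤ} (hf : Primrec f) (hg : Primrec g) :
    Primrec (fun a => gAdd (f a) (g a)) := by unfold gAdd; fun_prop

@[fun_prop] theorem primrec_gMul {f g : α → ℤ × ℤ} (hf : Primrec f) (hg : Primrec g) :
    Primrec (fun a => gMul (f a) (g a)) := by unfold gMul; fun_prop

@[fun_prop] theorem primrec_gPow {f : α → ℤ × ℤ} {g : α → ℕ} (hf : Primrec f) (hg : Primrec g) :
    Primrec (fun a => gPow (f a) (g a)) := by unfold gPow; fun_prop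

@[fun_prop] theorem primrec_gDiv {f : α → ℤ × ℤ} {g : α → ℕ} (hf : Primrec f) (hg : Primrec g) :
    Primrec (fun a => gDiv (f a) (g a)) := by unfold gDiv; fun_prop

@[fun_prop] theorem primrec_gAbs {f : α → ℤ × ℤ} (hf : Primrec f) :
    Primrec (fun a => gAbs (f a)) := by unfold gAbs; fun_prop

end

end Gauss

/-! ### Quantitative estimates for the exponential function -/

section Exp

theorem norm_pow_succ_sub_pow_succ_le {a b : ℂ} {K : ℝ} (ha : ‖a‖ ≤ K) (hb : ‖b‖ ≤ K) (n : ℕ) :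
    ‖a ^ (n + 1) - b ^ (n + 1)‖ ≤ (n + 1) * K ^ n * ‖a - b‖ := by
  have hK : 0 ≤ K := (norm_nonneg a).trans ha
  induction n with
  | zero => simp
  | succ n ih =>
    have h : a ^ (n + 1 + 1) - b ^ (n + 1 + 1)
        = a ^ (n + 1) * (a - b) + (a ^ (n + 1) - b ^ (n + 1)) * b := by ring
    rw [h]
    refine (norm_add_le _ _).trans ?_
    rw [norm_mul, norm_mul, norm_pow]
    have h1 : ‖a‖ ^ (n + 1) * ‖a - b‖ ≤ K ^ (n + 1) * ‖a - b‖ := by gcongr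
    have h2 : ‖a ^ (n + 1) - b ^ (n + 1)‖ * ‖b‖ ≤ ((n + 1) * K ^ n * ‖a - b‖) * K := by gcongr
    refine (add_le_add h1 h2).trans (le_of_eq ?_)
    push_cast; ring

theorem norm_exp_sub_exp_le {x y : ℂ} {M : ℝ} (hx : ‖x‖ ≤ M) (hy : ‖y‖ ≤ M) :
    ‖Complex.exp x - Complex.exp y‖ ≤ Real.exp M * ‖x - y‖ := by
  refine (convex_closedBall (0 : ℂ) M).norm_image_sub_le_of_norm_deriv_le
    (f := Complex.exp) (fun z _ => Complex.differentiable_exp z) (fun z hz => ?_)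
    (by simpa using hy) (by simpa using hx)
  rw [Complex.deriv_exp]
  refine (Complex.norm_exp_le_exp_norm z).trans (Real.exp_le_exp.2 ?_)
  simpa using hz

theorem norm_exp_sub_one_add_div_pow_le {y : ℂ} {M : ℝ} (hy : ‖y‖ ≤ M) {n : ℕ} (hn : 1 ≤ n) :
    ‖Complex.exp y - (1 + y / n) ^ n‖ ≤ M ^ 2 * Real.exp M / n := by
  obtain ⟨k, rfl⟩ : ∃ k, n = k + 1 := ⟨n - 1, by omega⟩
  have hM : 0 ≤ M := (norm_nonneg y).trans hy
  set m : ℂ := ((k + 1 : ℕ) : ℂ) with hm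
  have hm0 : m ≠ 0 := by rw [hm]; exact_mod_cast Nat.succ_ne_zero k
  have hmn : ‖m‖ = (k : ℝ) + 1 := by rw [hm, Complex.norm_natCast]; push_cast; rfl
  have hk : (0 : ℝ) < (k : ℝ) + 1 := by positivity
  have hz : ‖y / m‖ ≤ M / (k + 1) := by rw [norm_div, hmn]; gcongr
  have hexp : Complex.exp y = Complex.exp (y / m) ^ (k + 1) := by
    rw [← Complex.exp_nat_mul, ← hm, mul_div_cancel₀ _ hm0]
  have ha : ‖Complex.exp (y / m)‖ ≤ Real.exp (M / (k + 1)) :=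
    (Complex.norm_exp_le_exp_norm _).trans (Real.exp_le_exp.2 hz)
  have hb : ‖1 + y / m‖ ≤ Real.exp (M / (k + 1)) := by
    refine (norm_add_le _ _).trans ?_
    rw [norm_one]
    linarith [Real.add_one_le_exp (M / (k + 1))]
  have hd : ‖Complex.exp (y / m) - (1 + y / m)‖ ≤ (M / (k + 1)) ^ 2 * Real.exp (M / (k + 1)) := by
    have h := Complex.norm_exp_sub_sum_le_norm_mul_exp (y / m) 2
    simp only [Finset.sum_range_succ, Finset.sum_range_zero, pow_zero, Nat.factorial, Nat.cast_one,
      div_one, zero_add, pow_one, mul_one] at h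
    refine h.trans ?_
    gcongr
  rw [hexp]
  refine (norm_pow_succ_sub_pow_succ_le ha hb k).trans ?_
  have hE : Real.exp (M / (k + 1)) ^ k * Real.exp (M / (k + 1)) = Real.exp M := by
    rw [← pow_succ, ← Real.exp_nat_mul]
    congr 1
    push_cast
    field_simp
  calc ((k : ℝ) + 1) * Real.exp (M / (k + 1)) ^ k * ‖Complex.exp (y / m) - (1 + y / m)‖
      ≤ ((k : ℝ) + 1) * Real.exp (M / (k + 1)) ^ k *
        ((M / (k + 1)) ^ 2 * Real.exp (M / (k + 1))) := by gcongr
    _ = (k + 1) * (M / (k + 1)) ^ 2 *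
        (Real.exp (M / (k + 1)) ^ k * Real.exp (M / (k + 1))) := by ring
    _ = M ^ 2 * Real.exp M / ((k + 1 : ℕ) : ℝ) := by
        rw [hE]; push_cast; field_simp

theorem real_exp_le_three_pow (M : ℕ) : Real.exp M ≤ 3 ^ M := by
  rw [← Real.exp_one_pow]
  gcongr
  exact Real.exp_one_lt_three.le

end Exp

/-! ### Ball arithmetic -/

section Ball

/-- A ball of complex numbers at an implicit scale `D`: `(w, e)` stands for the numbers `x` with
`|D x - w| ≤ e`. -/
abbrev Ball : Type := (ℤ × ℤ) × ℕ

/-- `x` lies in the ball `b` at scale `D`. -/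
def Ball.Mem (D : ℕ) (b : Ball) (x : ℂ) : Prop := ‖(D : ℂ) * x - toC b.1‖ ≤ b.2

/-- The ball around an integer. -/
def bInt (D : ℕ) (n : ℤ) : Ball := ((D * n, 0), 0)

/-- The sum of balls. -/
def bAdd (b c : Ball) : Ball := (gAdd b.1 c.1, b.2 + c.2)

/-- The product of balls at scale `D`. The summand `3` of the radius covers the rounding of the centre
and of the quotient. -/
def bMul (D : ℕ) (b c : Ball) : Ball :=
  (gDiv (gMul b.1 c.1) D, (b.2 * gAbs c.1 + c.2 * gAbs b.1 + b.2 * c.2) / D + 3)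

/-- A natural number that bounds the elements of a ball. -/
def bBound (D : ℕ) (b : Ball) : ℕ := (gAbs b.1 + b.2) / D + 1

/-- The exponential of a ball, computed from `(1 + y / D) ^ D`. With `M = bBound D b`, a bound of
the ball, the radius allows for the radius of `b` expanded by `exp M ≤ 3 ^ M`, for the error
`M ^ 2 * exp M / D` of `(1 + y / D) ^ D`, scaled by `D`, and for the rounding of the centre. -/
def bExp (D : ℕ) (b : Ball) : Ball :=
  (gDiv (gMul (D, 0) (gPow (gAdd (D * D, 0) b.1) D)) (D ^ (2 * D)),
    (b.2 + bBound D b * bBound D b) * 3 ^ bBound D b + 2)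

/-- The powers of a ball. -/
def bPow (D : ℕ) (b : Ball) (n : ℕ) : Ball := (bMul D b)^[n] (bInt D 1)

theorem Ball.Mem.norm_toC_le {D : ℕ} {b : Ball} {x : ℂ} (h : b.Mem D x) :
    ‖toC b.1‖ ≤ D * ‖x‖ + b.2 := by
  have := norm_sub_norm_le (toC b.1) ((D : ℂ) * x)
  rw [norm_sub_rev, norm_mul, Complex.norm_natCast] at this
  unfold Ball.Mem at h
  linarith

theorem mem_bInt (D : ℕ) (n : ℤ) : (bInt D n).Mem D n := by
  simp only [Ball.Mem, bInt, toC_int]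
  push_cast
  simp

theorem mem_bAdd {D : ℕ} {b c : Ball} {x y : ℂ} (hb : b.Mem D x) (hc : c.Mem D y) :
    (bAdd b c).Mem D (x + y) := by
  simp only [Ball.Mem, bAdd, toC_gAdd] at *
  rw [show (D : ℂ) * (x + y) - (toC b.1 + toC c.1)
    = (D * x - toC b.1) + (D * y - toC c.1) by ring]
  push_cast
  exact (norm_add_le _ _).trans (add_le_add hb hc)

theorem mem_bMul {D : ℕ} (hD : 1 ≤ D) {b c : Ball} {x y : ℂ} (hb : b.Mem D x) (hc : c.Mem D y) :
    (bMul D b c).Mem D (x * y) := by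
  simp only [Ball.Mem, bMul] at *
  have hD0 : (D : ℂ) ≠ 0 := by exact_mod_cast (by omega : D ≠ 0)
  have hDR : (0 : ℝ) < D := by exact_mod_cast hD
  have h1 := norm_gDiv_sub (gMul b.1 c.1) D hD
  rw [toC_gMul] at h1
  have h2 : (D : ℂ) * (x * y) - toC b.1 * toC c.1 / D
      = ((D * x - toC b.1) * toC c.1 + (D * y - toC c.1) * toC b.1
        + (D * x - toC b.1) * (D * y - toC c.1)) / D := by
    field_simp; ring
  have h3 : ‖(D : ℂ) * (x * y) - toC b.1 * toC c.1 / D‖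
      ≤ ((b.2 * gAbs c.1 + c.2 * gAbs b.1 + b.2 * c.2 : ℕ) : ℝ) / D := by
    rw [h2, norm_div, Complex.norm_natCast]
    gcongr
    push_cast
    refine (norm_add₃_le).trans ?_
    rw [norm_mul, norm_mul, norm_mul]
    have := norm_toC_le b.1
    have := norm_toC_le c.1
    gcongr
  have h4 := (natDiv_cast (b.2 * gAbs c.1 + c.2 * gAbs b.1 + b.2 * c.2) D hD).2
  rw [show (D : ℂ) * (x * y) - toC (gDiv (gMul b.1 c.1) D)
    = ((D : ℂ) * (x * y) - toC b.1 * toC c.1 / D)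
      - (toC (gDiv (gMul b.1 c.1) D) - toC b.1 * toC c.1 / D) by ring]
  refine (norm_sub_le _ _).trans ?_
  push_cast at h3 h4 ⊢
  linarith

theorem le_bBound {D : ℕ} (hD : 1 ≤ D) (b : Ball) : ((gAbs b.1 + b.2 : ℕ) : ℝ) / D ≤ bBound D b := by
  have := (natDiv_cast (gAbs b.1 + b.2) D hD).2
  rw [bBound]
  push_cast at this ⊢
  exact this.le

theorem mem_bExp {D : ℕ} (hD : 1 ≤ D) {b : Ball} {x : ℂ} (hb : b.Mem D x) :
    (bExp D b).Mem D (Complex.exp x) := by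
  have hD0 : (D : ℂ) ≠ 0 := by exact_mod_cast (by omega : D ≠ 0)
  have hDR : (0 : ℝ) < D := by exact_mod_cast hD
  set M := bBound D b with hM
  have hbd := le_bBound hD b
  rw [← hM, div_le_iff₀ hDR] at hbd
  have hw := norm_toC_le b.1
  push_cast at hbd
  set y : ℂ := toC b.1 / D with hy
  have hyM : ‖y‖ ≤ M := by
    rw [hy, norm_div, Complex.norm_natCast, div_le_iff₀ hDR]
    have : (0 : ℝ) ≤ b.2 := by positivity
    linarith
  have hxM : ‖x‖ ≤ M := by
    have h1 : ‖(D : ℂ) * x‖ ≤ ‖(D : ℂ) * x - toC b.1‖ + ‖toC b.1‖ := by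
      simpa using norm_add_le ((D : ℂ) * x - toC b.1) (toC b.1)
    rw [norm_mul, Complex.norm_natCast] at h1
    unfold Ball.Mem at hb
    have : ‖x‖ * D ≤ M * D := by linarith
    exact le_of_mul_le_mul_right this hDR
  have hxy : (D : ℝ) * ‖x - y‖ ≤ b.2 := by
    have : (D : ℂ) * (x - y) = D * x - toC b.1 := by rw [hy]; field_simp
    rw [← Complex.norm_natCast, ← norm_mul, this]
    exact hb
  have hE := real_exp_le_three_pow M
  have e1 : ‖(D : ℂ) * Complex.exp x - D * Complex.exp y‖ ≤ b.2 * 3 ^ M := by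
    rw [← mul_sub, norm_mul, Complex.norm_natCast]
    calc (D : ℝ) * ‖Complex.exp x - Complex.exp y‖ ≤ D * (Real.exp M * ‖x - y‖) := by
          gcongr; exact norm_exp_sub_exp_le hxM hyM
      _ = Real.exp M * (D * ‖x - y‖) := by ring
      _ ≤ 3 ^ M * b.2 := by gcongr
      _ = _ := by ring
  have e2 : ‖(D : ℂ) * Complex.exp y - D * (1 + y / D) ^ D‖ ≤ M * M * 3 ^ M := by
    rw [← mul_sub, norm_mul, Complex.norm_natCast]
    calc (D : ℝ) * ‖Complex.exp y - (1 + y / D) ^ D‖ ≤ D * ((M : ℝ) ^ 2 * Real.exp M / D) := by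
          gcongr; exact norm_exp_sub_one_add_div_pow_le hyM hD
      _ = M * M * Real.exp M := by field_simp
      _ ≤ M * M * 3 ^ M := by gcongr
  have e3 := norm_gDiv_sub (gMul (D, 0) (gPow (gAdd (D * D, 0) b.1) D)) (D ^ (2 * D))
    (Nat.one_le_pow _ _ hD)
  have hpow : toC (gMul (D, 0) (gPow (gAdd (D * D, 0) b.1) D)) / ((D ^ (2 * D) : ℕ) : ℂ)
      = D * (1 + y / D) ^ D := by
    rw [toC_gMul, toC_gPow, toC_gAdd, toC_int]
    have : toC ((D : ℤ) * D, 0) = (D : ℂ) * D := by rw [toC_int]; push_cast; rfl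
    rw [this, hy]
    have h : (1 + toC b.1 / (D : ℂ) / D) = ((D : ℂ) * D + toC b.1) / (D ^ 2) := by
      field_simp
    rw [h, div_pow, ← pow_mul]
    push_cast
    ring
  rw [hpow] at e3
  simp only [Ball.Mem, bExp]
  rw [← hM]
  set w := toC (gDiv (gMul (D, 0) (gPow (gAdd (D * D, 0) b.1) D)) (D ^ (2 * D)))
  rw [show (D : ℂ) * Complex.exp x - w = (D * Complex.exp x - D * Complex.exp y)
    + (D * Complex.exp y - D * (1 + y / D) ^ D) - (w - D * (1 + y / D) ^ D) by ring]
  refine (norm_sub_le _ _).trans ((add_le_add (norm_add_le _ _) le_rfl).trans ?_)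
  push_cast
  linarith

section

variable {α : Type} [Primcodable α]

@[fun_prop] theorem primrec_bInt {D : α → ℕ} {n : α → ℤ} (hD : Primrec D) (hn : Primrec n) :
    Primrec (fun a => bInt (D a) (n a)) := by unfold bInt; fun_prop

@[fun_prop] theorem primrec_bAdd {f g : α → Ball} (hf : Primrec f) (hg : Primrec g) :
    Primrec (fun a => bAdd (f a) (g a)) := by unfold bAdd; fun_prop

@[fun_prop] theorem primrec_bMul {D : α → ℕ} {f g : α → Ball} (hD : Primrec D) (hf : Primrec f)
    (hg : Primrec g) : Primrec (fun a => bMul (D a) (f a) (g a)) := by unfold bMul; fun_prop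

@[fun_prop] theorem primrec_bBound {D : α → ℕ} {f : α → Ball} (hD : Primrec D) (hf : Primrec f) :
    Primrec (fun a => bBound (D a) (f a)) := by unfold bBound; fun_prop

@[fun_prop] theorem primrec_bExp {D : α → ℕ} {f : α → Ball} (hD : Primrec D) (hf : Primrec f) :
    Primrec (fun a => bExp (D a) (f a)) := by unfold bExp; fun_prop

@[fun_prop] theorem primrec_bPow {D : α → ℕ} {f : α → Ball} {n : α → ℕ} (hD : Primrec D)
    (hf : Primrec f) (hn : Primrec n) : Primrec (fun a => bPow (D a) (f a) (n a)) := by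
  unfold bPow; fun_prop

end

end Ball

/-! ### Uniformly convergent ball approximations -/

section Encloses

open Filter

/-- A family of balls `b D n X`, indexed by a scale `D`, an amount `n` of search effort and a
numerator `X`, approximates the function `g` of a real variable: `b D n X` always contains the
values of `g` at the points within `1 / D` of `X / D`; and on bounded sets, once `n` is large enough
in terms of `D`, the radii (in units of `1 / D`) stay bounded as `D` grows. -/
def Encloses (b : ℕ → ℕ → ℤ → Ball) (g : ℝ → ℂ) : Prop :=
  (∀ D : ℕ, 1 ≤ D → ∀ (n : ℕ) (X : ℤ) (t : ℝ), |(D : ℝ) * t - X| ≤ 1 → (b D n X).Mem D (g t)) ∧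
  ∀ R : ℝ, ∃ C : ℝ, ∀ D : ℕ, 1 ≤ D → ∀ᶠ n in atTop, ∀ (X : ℤ) (t : ℝ), |t| ≤ R →
    |(D : ℝ) * t - X| ≤ 1 → ((b D n X).2 : ℝ) ≤ C ∧ ‖g t‖ ≤ C

theorem Encloses.int (k : ℤ) : Encloses (fun D _ _ => bInt D k) (fun _ => (k : ℂ)) := by
  refine ⟨fun D _ _ _ _ _ => mem_bInt D k, fun R => ⟨‖(k : ℂ)‖, fun D _ => ?_⟩⟩
  refine Eventually.of_forall fun n X t _ _ => ⟨?_, le_rfl⟩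
  simp [bInt]

theorem Encloses.var : Encloses (fun _ _ X => ((X, 0), 1)) (fun t => (t : ℂ)) := by
  refine ⟨fun D _ _ X t h => ?_, fun R => ⟨max 1 R, fun D _ => ?_⟩⟩
  · simp only [Ball.Mem, toC_int]
    rw [show (D : ℂ) * (t : ℂ) - (X : ℂ) = (((D : ℝ) * t - X : ℝ) : ℂ) by push_cast; ring,
      Complex.norm_real]
    simpa using h
  · refine Eventually.of_forall fun n X t h _ => ⟨by simp, ?_⟩
    rw [Complex.norm_real]
    exact le_max_of_le_right h

theorem Encloses.add {b c : ℕ → ℕ → ℤ → Ball} {g h : ℝ → ℂ} (hb : Encloses b g)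
    (hc : Encloses c h) :
    Encloses (fun D n X => bAdd (b D n X) (c D n X)) (fun t => g t + h t) := by
  refine ⟨fun D hD n X t ht => mem_bAdd (hb.1 D hD n X t ht) (hc.1 D hD n X t ht), fun R => ?_⟩
  obtain ⟨C, hC⟩ := hb.2 R
  obtain ⟨C', hC'⟩ := hc.2 R
  refine ⟨C + C', fun D hD => ?_⟩
  filter_upwards [hC D hD, hC' D hD] with n h1 h2 X t hR ht
  have := h1 X t hR ht
  have := h2 X t hR ht
  refine ⟨?_, (norm_add_le _ _).trans (by linarith)⟩
  simp only [bAdd]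
  push_cast
  linarith

theorem gAbs_le_of_mem {D : ℕ} (hD : 1 ≤ D) {b : Ball} {x : ℂ} {C : ℝ} (h : b.Mem D x)
    (he : (b.2 : ℝ) ≤ C) (hx : ‖x‖ ≤ C) : (gAbs b.1 : ℝ) ≤ 4 * C * D := by
  have h1 := gAbs_le b.1
  have h2 := h.norm_toC_le
  have hDR : (1 : ℝ) ≤ D := by exact_mod_cast hD
  have hC : 0 ≤ C := (norm_nonneg x).trans hx
  have h3 : (D : ℝ) * ‖x‖ ≤ D * C := by gcongr
  nlinarith

theorem Encloses.mul {b c : ℕ → ℕ → ℤ → Ball} {g h : ℝ → ℂ} (hb : Encloses b g)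
    (hc : Encloses c h) :
    Encloses (fun D n X => bMul D (b D n X) (c D n X)) (fun t => g t * h t) := by
  refine ⟨fun D hD n X t ht => mem_bMul hD (hb.1 D hD n X t ht) (hc.1 D hD n X t ht),
    fun R => ?_⟩
  obtain ⟨C, hC⟩ := hb.2 R
  obtain ⟨C', hC'⟩ := hc.2 R
  refine ⟨9 * C * C' + 3, fun D hD => ?_⟩
  filter_upwards [hC D hD, hC' D hD] with n h1 h2 X t hR ht
  obtain ⟨e1, g1⟩ := h1 X t hR ht
  obtain ⟨e2, g2⟩ := h2 X t hR ht
  have w1 := gAbs_le_of_mem hD (hb.1 D hD n X t ht) e1 g1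
  have w2 := gAbs_le_of_mem hD (hc.1 D hD n X t ht) e2 g2
  have hC0 : 0 ≤ C := (norm_nonneg _).trans g1
  have hC0' : 0 ≤ C' := (norm_nonneg _).trans g2
  have hDR : (1 : ℝ) ≤ D := by exact_mod_cast hD
  refine ⟨?_, ?_⟩
  · simp only [bMul]
    push_cast
    have h3 : ((((b D n X).2 * gAbs (c D n X).1 + (c D n X).2 * gAbs (b D n X).1
        + (b D n X).2 * (c D n X).2) / D : ℕ) : ℝ) ≤ 9 * C * C' := by
      refine Nat.cast_div_le.trans ?_
      rw [div_le_iff₀ (by linarith)]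
      push_cast
      calc ((b D n X).2 : ℝ) * gAbs (c D n X).1 + (c D n X).2 * gAbs (b D n X).1
            + (b D n X).2 * (c D n X).2
          ≤ C * (4 * C' * D) + C' * (4 * C * D) + C * C' := by gcongr
        _ ≤ 9 * C * C' * D := by
            have : 0 ≤ C * C' := by positivity
            nlinarith
    linarith
  · rw [norm_mul]
    have : ‖g t‖ * ‖h t‖ ≤ C * C' := by gcongr
    have : 0 ≤ C * C' := by positivity
    linarith

theorem Encloses.exp {b : ℕ → ℕ → ℤ → Ball} {g : ℝ → ℂ} (hb : Encloses b g) :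
    Encloses (fun D n X => bExp D (b D n X)) (fun t => Complex.exp (g t)) := by
  refine ⟨fun D hD n X t ht => mem_bExp hD (hb.1 D hD n X t ht), fun R => ?_⟩
  obtain ⟨C, hC⟩ := hb.2 R
  set K := ⌈5 * C + 1⌉₊ with hK
  refine ⟨max ((C + K * K) * 3 ^ K + 2) (Real.exp C), fun D hD => ?_⟩
  filter_upwards [hC D hD] with n h1 X t hR ht
  obtain ⟨e1, g1⟩ := h1 X t hR ht
  have w1 := gAbs_le_of_mem hD (hb.1 D hD n X t ht) e1 g1
  have hC0 : 0 ≤ C := (norm_nonneg _).trans g1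
  have hDR : (1 : ℝ) ≤ D := by exact_mod_cast hD
  refine ⟨le_max_of_le_left ?_, le_max_of_le_right
    ((Complex.norm_exp_le_exp_norm _).trans (Real.exp_le_exp.2 g1))⟩
  have hM : bBound D (b D n X) ≤ K := by
    have : ((bBound D (b D n X) : ℕ) : ℝ) ≤ 5 * C + 1 := by
      rw [bBound]
      push_cast
      have : (((gAbs (b D n X).1 + (b D n X).2) / D : ℕ) : ℝ) ≤ 5 * C := by
        refine Nat.cast_div_le.trans ?_
        rw [div_le_iff₀ (by linarith)]
        push_cast
        nlinarith
      linarith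
    exact_mod_cast this.trans (Nat.le_ceil _)
  simp only [bExp]
  push_cast
  have hMR : ((bBound D (b D n X) : ℕ) : ℝ) ≤ K := by exact_mod_cast hM
  have h3 : (3 : ℝ) ^ bBound D (b D n X) ≤ 3 ^ K := pow_le_pow_right₀ (by norm_num) hM
  gcongr

theorem Encloses.pow {b : ℕ → ℕ → ℤ → Ball} {g : ℝ → ℂ} (hb : Encloses b g) (k : ℕ) :
    Encloses (fun D n X => bPow D (b D n X) k) (fun t => g t ^ k) := by
  induction k with
  | zero => simpa [bPow] using Encloses.int 1
  | succ k ih =>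
    simp only [bPow, Function.iterate_succ_apply', pow_succ'] at *
    exact hb.mul ih

theorem Encloses.foldr_add {ι : Type} (l : List ι) {b : ι → ℕ → ℕ → ℤ → Ball} {g : ι → ℝ → ℂ}
    (hb : ∀ i ∈ l, Encloses (b i) (g i)) :
    Encloses (fun D n X => l.foldr (fun i s => bAdd (b i D n X) s) (bInt D 0))
      (fun t => (l.map fun i => g i t).sum) := by
  induction l with
  | nil => simpa using Encloses.int 0
  | cons i l ih =>
    simp only [List.foldr_cons, List.map_cons, List.sum_cons]
    exact (hb i (by simp)).add (ih fun j hj => hb j (by simp [hj]))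

theorem Encloses.foldr_mul {ι : Type} (l : List ι) (k : ℤ) {b : ι → ℕ → ℕ → ℤ → Ball}
    {g : ι → ℝ → ℂ} (hb : ∀ i ∈ l, Encloses (b i) (g i)) :
    Encloses (fun D n X => l.foldr (fun i s => bMul D (b i D n X) s) (bInt D k))
      (fun t => k * (l.map fun i => g i t).prod) := by
  induction l with
  | nil => simpa using Encloses.int k
  | cons i l ih =>
    simp only [List.foldr_cons, List.map_cons, List.prod_cons]
    have := (hb i (by simp)).mul (ih fun j hj => hb j (by simp [hj]))
    refine ⟨fun D hD n X t ht => ?_, fun R => ?_⟩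
    · convert this.1 D hD n X t ht using 1; ring
    · convert this.2 R using 8; ring_nf

end Encloses

end PEFIsolation

namespace PEFIsolation
open Encodable

/-! ### The numbers represented by codes -/

section Codes

/-- The code represents some algebraic number. -/
def AlgCode.Valid (c : AlgCode) : Prop := ∃ α : AlgNum, c.Represents α

open Classical in
/-- The algebraic number represented by a code (and `0` if there is none). -/
noncomputable def AlgCode.val (c : AlgCode) : ℂ :=
  if h : c.Valid then (h.choose : ℂ) else 0

theorem AlgCode.Represents.val_eq {c : AlgCode} {α : AlgNum} (h : c.Represents α) :
    c.val = (α : ℂ) := by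
  have hv : c.Valid := ⟨α, h⟩
  have h' := hv.choose_spec
  rw [AlgCode.val, dif_pos hv]
  exact h.2.2.2.2 _ h'.2.1 h'.2.2.2.1

variable {c : AlgCode}

theorem AlgCode.Valid.poly_ne_zero (h : c.Valid) : c.poly ≠ 0 := by
  obtain ⟨α, h⟩ := h
  exact h.1

theorem AlgCode.Valid.aeval_val (h : c.Valid) : aeval c.val c.poly = 0 := by
  obtain ⟨α, h⟩ := h
  rw [h.val_eq]; exact h.2.1

theorem AlgCode.Valid.norm_lt (h : c.Valid) : ‖c.val - c.center‖ < c.radius := by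
  obtain ⟨α, h⟩ := h
  rw [h.val_eq]; exact h.2.2.2.1

theorem AlgCode.Valid.eq_val (h : c.Valid) {β : ℂ} (h1 : aeval β c.poly = 0)
    (h2 : ‖β - c.center‖ < c.radius) : β = c.val := by
  obtain ⟨α, h⟩ := h
  rw [h.val_eq]; exact h.2.2.2.2 β h1 h2

theorem AlgCode.Valid.isAlgebraic (h : c.Valid) : IsAlgebraic ℚ c.val :=
  ⟨c.poly, h.poly_ne_zero, h.aeval_val⟩

end Codes

/-! ### Rational polynomials given by lists of coefficients -/

section PolyList

theorem polyOfCoeffs_nil {R : Type} [Semiring R] : polyOfCoeffs ([] : List R) = 0 := rfl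

theorem polyOfCoeffs_cons {R : Type} [Semiring R] (a : R) (l : List R) :
    polyOfCoeffs (a :: l) = C a + X * polyOfCoeffs l := rfl

theorem natDegree_polyOfCoeffs_le {R : Type} [Semiring R] (l : List R) :
    (polyOfCoeffs l).natDegree ≤ l.length := by
  induction l with
  | nil => simp [polyOfCoeffs_nil]
  | cons a l ih =>
    rw [polyOfCoeffs_cons, List.length_cons]
    refine natDegree_add_le_of_degree_le (by simp) ?_
    refine natDegree_mul_le.trans ?_
    have := natDegree_X_le (R := R)
    omega

theorem coeff_polyOfCoeffs_mem {R : Type} [Semiring R] (l : List R) (n : ℕ)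
    (h : (polyOfCoeffs l).coeff n ≠ 0) : (polyOfCoeffs l).coeff n ∈ l := by
  induction l generalizing n with
  | nil => simp [polyOfCoeffs_nil] at h
  | cons a l ih =>
    rw [polyOfCoeffs_cons] at *
    cases n with
    | zero => simp
    | succ n =>
      simp only [coeff_add, coeff_C_succ, zero_add, coeff_X_mul] at *
      exact List.mem_cons_of_mem _ (ih n h)

/-- The product of the denominators in a list of rational codes. -/
def denProd (l : List RatCode) : ℕ := (l.map fun q => q.2 + 1).prod

theorem denProd_pos (l : List RatCode) : 1 ≤ denProd l := by
  induction l with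
  | nil => simp [denProd]
  | cons q l ih =>
    have : denProd (q :: l) = (q.2 + 1) * denProd l := by simp [denProd]
    rw [this]
    exact Nat.mul_pos (Nat.succ_pos _) ih

theorem dvd_denProd {l : List RatCode} {q : RatCode} (hq : q ∈ l) : q.2 + 1 ∣ denProd l :=
  List.dvd_prod (List.mem_map_of_mem hq)

theorem one_le_denProd_mul_abs_leadingCoeff (l : List RatCode)
    (h : polyOfCoeffs (l.map RatCode.value) ≠ 0) :
    1 ≤ (denProd l : ℝ) * |((polyOfCoeffs (l.map RatCode.value)).leadingCoeff : ℝ)| := by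
  have h0 := leadingCoeff_ne_zero.2 h
  have h1 := coeff_polyOfCoeffs_mem _ _ h0
  obtain ⟨q, hq, hqe⟩ := List.mem_map.1 h1
  rw [leadingCoeff, ← hqe]
  rw [leadingCoeff, ← hqe] at h0
  have hn : q.1 ≠ 0 := by
    rintro h
    exact h0 (by simp [RatCode.value, h])
  have hn1 : (1 : ℝ) ≤ |(q.1 : ℝ)| := by exact_mod_cast Int.one_le_abs hn
  have hd : (q.2 + 1 : ℕ) ≤ denProd l := Nat.le_of_dvd (denProd_pos l) (dvd_denProd hq)
  have hd' : ((q.2 : ℝ) + 1) ≤ denProd l := by exact_mod_cast hd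
  simp only [RatCode.value]
  push_cast
  have hpos : (0 : ℝ) < (q.2 : ℝ) + 1 := by positivity
  rw [abs_div, abs_of_pos hpos, mul_div_assoc', le_div_iff₀ hpos]
  nlinarith

/-- A rational polynomial that is small at `ζ` has a root near `ζ`: if all of its roots were at distance
at least `1 / m`, its value would be at least the leading coefficient times `m ^ (-deg)`, and the
leading coefficient is at least the inverse of a common denominator. -/
theorem exists_root_near (l : List RatCode) (h : polyOfCoeffs (l.map RatCode.value) ≠ 0) (ζ : ℂ)
    (m : ℕ) (hm : 1 ≤ m)
    (hs : ‖aeval ζ (polyOfCoeffs (l.map RatCode.value))‖ * denProd l * m ^ l.length < 1) :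
    ∃ β : ℂ, aeval β (polyOfCoeffs (l.map RatCode.value)) = 0 ∧ ‖ζ - β‖ < 1 / m := by
  set p := polyOfCoeffs (l.map RatCode.value) with hp
  by_contra hcon
  push Not at hcon
  have hmR : (1 : ℝ) ≤ m := by exact_mod_cast hm
  set P := p.map (algebraMap ℚ ℂ) with hP
  have hP0 : P ≠ 0 := by rwa [hP, Polynomial.map_ne_zero_iff (algebraMap ℚ ℂ).injective]
  have hsplit : P.Splits := IsAlgClosed.splits P
  have hev : aeval ζ p = P.leadingCoeff * (P.roots.map fun β => ζ - β).prod := by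
    rw [← hsplit.eval_eq_prod_roots, hP, eval_map_algebraMap]
  have hprod : ∀ s : Multiset ℂ, (∀ β ∈ s, 1 / (m : ℝ) ≤ ‖ζ - β‖) →
      (1 / (m : ℝ)) ^ s.card ≤ ‖(s.map fun β => ζ - β).prod‖ := by
    intro s
    induction s using Multiset.induction_on with
    | empty => simp
    | cons a s ih =>
      intro hs
      rw [Multiset.card_cons, Multiset.map_cons, Multiset.prod_cons, norm_mul, pow_succ']
      have h1 := hs a (by simp)
      have h2 := ih fun β hβ => hs β (by simp [hβ])
      gcongr
  have hr := hprod P.roots fun β hβ => by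
    refine hcon β ?_
    have := (mem_roots hP0).1 hβ
    rwa [IsRoot.def, hP, eval_map_algebraMap] at this
  have hcard : P.roots.card ≤ l.length := by
    refine (card_roots' P).trans ?_
    rw [hP, natDegree_map]
    exact (natDegree_polyOfCoeffs_le _).trans (by simp)
  have hr2 : (1 / (m : ℝ)) ^ l.length ≤ ‖(P.roots.map fun β => ζ - β).prod‖ :=
    (pow_le_pow_of_le_one (by positivity) (by rw [div_le_one] <;> linarith) hcard).trans hr
  have hlead : ‖P.leadingCoeff‖ = |(p.leadingCoeff : ℝ)| := by
    rw [hP, leadingCoeff_map]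
    simp
  have hl := one_le_denProd_mul_abs_leadingCoeff l h
  rw [hev, norm_mul, hlead] at hs
  have hfin : 1 ≤ ((denProd l : ℝ) * |(p.leadingCoeff : ℝ)|) *
      ((1 / (m : ℝ)) ^ l.length * (m : ℝ) ^ l.length) := by
    rw [← mul_pow, one_div_mul_cancel (by linarith), one_pow, mul_one]
    exact hl
  have : ((denProd l : ℝ) * |(p.leadingCoeff : ℝ)|) * ((1 / (m : ℝ)) ^ l.length * (m : ℝ) ^ l.length)
      ≤ ((denProd l : ℝ) * |(p.leadingCoeff : ℝ)|) *
        (‖(P.roots.map fun β => ζ - β).prod‖ * (m : ℝ) ^ l.length) := by gcongr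
  linarith

/-- The value at `z / E` of the rational polynomial with the given coefficients, as a fraction of
a Gaussian integer and a natural number. -/
def polyFrac (z : ℤ × ℤ) (E : ℕ) (l : List RatCode) : (ℤ × ℤ) × ℕ :=
  l.foldr (fun q s => (gAdd (q.1 * (E * s.2 : ℕ), 0) (gMul ((q.2 + 1 : ℕ), 0) (gMul z s.1)),
    (q.2 + 1) * E * s.2)) ((0, 0), 1)

theorem polyFrac_snd (z : ℤ × ℤ) (E : ℕ) (l : List RatCode) :
    (polyFrac z E l).2 = denProd l * E ^ l.length := by
  induction l with
  | nil => simp [polyFrac, denProd]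
  | cons q l ih =>
    have : (polyFrac z E (q :: l)).2 = (q.2 + 1) * E * (polyFrac z E l).2 := rfl
    rw [this, ih]
    simp only [denProd, List.map_cons, List.prod_cons, List.length_cons]
    ring

theorem polyFrac_eq (z : ℤ × ℤ) {E : ℕ} (hE : 1 ≤ E) (l : List RatCode) :
    toC (polyFrac z E l).1 / (polyFrac z E l).2
      = aeval (toC z / E) (polyOfCoeffs (l.map RatCode.value)) := by
  induction l with
  | nil => simp [polyFrac, polyOfCoeffs, toC]
  | cons q l ih =>
    have h1 : (polyFrac z E (q :: l)).2 = (q.2 + 1) * E * (polyFrac z E l).2 := rfl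
    have h2 : (polyFrac z E (q :: l)).1 = gAdd (q.1 * (E * (polyFrac z E l).2 : ℕ), 0)
      (gMul ((q.2 + 1 : ℕ), 0) (gMul z (polyFrac z E l).1)) := rfl
    rw [List.map_cons, polyOfCoeffs_cons, map_add, map_mul, aeval_X, aeval_C, ← ih, h1, h2, toC_gAdd,
      toC_gMul, toC_gMul, toC_int, toC_int]
    have hs : ((polyFrac z E l).2 : ℂ) ≠ 0 := by
      rw [polyFrac_snd]
      have := denProd_pos l
      have : 0 < denProd l * E ^ l.length := by positivity
      exact_mod_cast this.ne'
    have hq : ((q.2 : ℂ) + 1) ≠ 0 := by exact_mod_cast Nat.succ_ne_zero q.2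
    have hE0 : (E : ℂ) ≠ 0 := by exact_mod_cast (by omega : E ≠ 0)
    simp only [RatCode.value]
    push_cast
    simp only [map_intCast]
    field_simp

end PolyList

/-! ### Approximating the numbers represented by codes -/

section Atom

/-- The test whether `z / E` is certainly within `1 / m ≤ 1 / D` of the number with code `c`: the
polynomial is so small at `z / E` that it has a root within `1 / m`, and the ball of radius `1 / m`
about `z / E` is inside the isolating ball. The argument is `w = (z, (E, m))`, and all inequalities
are between integers, after clearing denominators and squaring. -/
def atomTest (c : AlgCode) (D : ℕ) (w : (ℤ × ℤ) × (ℕ × ℕ)) : Bool :=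
  Nat.ble 1 w.2.1 && Nat.ble 1 w.2.2 && Nat.ble D w.2.2 &&
  Nat.ble (gAbs (polyFrac w.1 w.2.1 c.1).1 * w.2.2 ^ c.1.length + 1) (w.2.1 ^ c.1.length) &&
  intLt 0 ((c.2.2.1 * w.2.2 - (c.2.2.2 + 1 : ℕ)) *
    ((c.2.1.1.2 + 1) * (c.2.1.2.2 + 1) * w.2.1 : ℕ)) &&
  intLt (((w.1.1 * (c.2.1.1.2 + 1 : ℕ) - c.2.1.1.1 * w.2.1) *
        ((c.2.1.2.2 + 1) * (c.2.2.2 + 1) * w.2.2 : ℕ)) *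
      ((w.1.1 * (c.2.1.1.2 + 1 : ℕ) - c.2.1.1.1 * w.2.1) *
        ((c.2.1.2.2 + 1) * (c.2.2.2 + 1) * w.2.2 : ℕ)) +
      ((w.1.2 * (c.2.1.2.2 + 1 : ℕ) - c.2.1.2.1 * w.2.1) *
        ((c.2.1.1.2 + 1) * (c.2.2.2 + 1) * w.2.2 : ℕ)) *
      ((w.1.2 * (c.2.1.2.2 + 1 : ℕ) - c.2.1.2.1 * w.2.1) *
        ((c.2.1.1.2 + 1) * (c.2.2.2 + 1) * w.2.2 : ℕ)))
    (((c.2.2.1 * w.2.2 - (c.2.2.2 + 1 : ℕ)) * ((c.2.1.1.2 + 1) * (c.2.1.2.2 + 1) * w.2.1 : ℕ)) *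
      ((c.2.2.1 * w.2.2 - (c.2.2.2 + 1 : ℕ)) *
        ((c.2.1.1.2 + 1) * (c.2.1.2.2 + 1) * w.2.1 : ℕ)))

/-- The best approximation of the number with code `c` at scale `D` that is found among the first
`n` candidates; without any, the isolating ball itself. The radius `3` consists of `1` for the distance
`1 / m ≤ 1 / D`, at scale `D`, and of `2` for the rounding of the centre. -/
def atomBall (c : AlgCode) (D n : ℕ) : Ball :=
  let w := (decode (α := (ℤ × ℤ) × (ℕ × ℕ)) (Nat.findGreatest
    (fun k => atomTest c D ((decode (α := (ℤ × ℤ) × (ℕ × ℕ)) k).getD default) = true) n)).getD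
    default
  bif atomTest c D w then (gDiv (gMul (D, 0) w.1) w.2.1, 3)
  else ((intDiv (D * c.2.1.1.1) (c.2.1.1.2 + 1), intDiv (D * c.2.1.2.1) (c.2.1.2.2 + 1)),
    D * c.2.2.1.natAbs + 2)

/-- The inequality that puts a disc inside a disc, with denominators cleared and without the square
root of the norm. -/
theorem atomTest_disc {x1 x2 x3 p q : ℤ} {A B F E m : ℕ} (hA : 1 ≤ A) (hB : 1 ≤ B) (hF : 1 ≤ F)
    (hE : 1 ≤ E) (hm : 1 ≤ m) :
    (0 < ((x3 * m - F) * (A * B * E : ℕ)) ∧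
      ((p * A - x1 * E) * (B * F * m : ℕ)) * ((p * A - x1 * E) * (B * F * m : ℕ)) +
      ((q * B - x2 * E) * (A * F * m : ℕ)) * ((q * B - x2 * E) * (A * F * m : ℕ)) <
      ((x3 * m - F) * (A * B * E : ℕ)) * ((x3 * m - F) * (A * B * E : ℕ))) ↔
    ‖toC (p, q) / E - ⟨(x1 : ℝ) / A, (x2 : ℝ) / B⟩‖ < (x3 : ℝ) / F - 1 / m := by
  have hA' : (0 : ℝ) < A := by exact_mod_cast hA
  have hB' : (0 : ℝ) < B := by exact_mod_cast hB
  have hF' : (0 : ℝ) < F := by exact_mod_cast hF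
  have hE' : (0 : ℝ) < E := by exact_mod_cast hE
  have hm' : (0 : ℝ) < m := by exact_mod_cast hm
  set Q : ℝ := A * B * F * E * m with hQ
  have hQ0 : 0 < Q := by positivity
  have hn : ‖toC (p, q) / E - ⟨(x1 : ℝ) / A, (x2 : ℝ) / B⟩‖ ^ 2
      = ((p : ℝ) / E - x1 / A) ^ 2 + ((q : ℝ) / E - x2 / B) ^ 2 := by
    rw [← Complex.normSq_eq_norm_sq, Complex.normSq_apply, Complex.sub_re, Complex.sub_im,
      Complex.div_natCast_re, Complex.div_natCast_im, toC_re, toC_im]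
    ring
  have hr : ((((x3 * m - F) * (A * B * E : ℕ) : ℤ)) : ℝ) = ((x3 : ℝ) / F - 1 / m) * Q := by
    push_cast; rw [hQ]; field_simp
  have hx : ((((p * A - x1 * E) * (B * F * m : ℕ) : ℤ)) : ℝ) = ((p : ℝ) / E - x1 / A) * Q := by
    push_cast; rw [hQ]; field_simp
  have hy : ((((q * B - x2 * E) * (A * F * m : ℕ) : ℤ)) : ℝ) = ((q : ℝ) / E - x2 / B) * Q := by
    push_cast; rw [hQ]; field_simp
  rw [← @Int.cast_lt ℝ, ← @Int.cast_lt ℝ, Int.cast_add, Int.cast_mul _ ((p * A - x1 * E) * _),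
    Int.cast_mul _ ((q * B - x2 * E) * _), Int.cast_mul _ ((x3 * m - F) * _), hr, hx, hy]
  set r := (x3 : ℝ) / F - 1 / m
  set N := ‖toC (p, q) / E - ⟨(x1 : ℝ) / A, (x2 : ℝ) / B⟩‖
  have hN : 0 ≤ N := norm_nonneg _
  rw [Int.cast_zero, mul_pos_iff_of_pos_right hQ0]
  have h2 : (((p : ℝ) / E - x1 / A) * Q * (((p : ℝ) / E - x1 / A) * Q) +
      ((q : ℝ) / E - x2 / B) * Q * (((q : ℝ) / E - x2 / B) * Q) < r * Q * (r * Q)) ↔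
      N ^ 2 < r ^ 2 := by
    rw [hn, show ((p : ℝ) / E - x1 / A) * Q * (((p : ℝ) / E - x1 / A) * Q) +
      ((q : ℝ) / E - x2 / B) * Q * (((q : ℝ) / E - x2 / B) * Q)
      = (((p : ℝ) / E - x1 / A) ^ 2 + ((q : ℝ) / E - x2 / B) ^ 2) * Q ^ 2 by ring,
      show r * Q * (r * Q) = r ^ 2 * Q ^ 2 by ring]
    exact mul_lt_mul_iff_left₀ (by positivity)
  rw [h2]
  constructor
  · rintro ⟨h, h'⟩
    exact lt_of_pow_lt_pow_left₀ 2 h.le h'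
  · intro h
    exact ⟨hN.trans_lt h, pow_lt_pow_left₀ h hN two_ne_zero⟩

theorem atomTest_iff {c : AlgCode} {D : ℕ} {w : (ℤ × ℤ) × (ℕ × ℕ)} :
    atomTest c D w = true ↔ 1 ≤ w.2.1 ∧ 1 ≤ w.2.2 ∧ D ≤ w.2.2 ∧
      gAbs (polyFrac w.1 w.2.1 c.1).1 * w.2.2 ^ c.1.length < w.2.1 ^ c.1.length ∧
      ‖toC w.1 / w.2.1 - c.center‖ < c.radius - 1 / w.2.2 := by
  obtain ⟨⟨p, q⟩, E, m⟩ := w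
  simp only [atomTest, Bool.and_eq_true, ble_iff, intLt_iff, and_assoc, Nat.succ_le_iff]
  refine and_congr_right fun hE => and_congr_right fun hm => and_congr_right fun hD =>
    and_congr_right fun _ => ?_
  have h := @atomTest_disc c.2.1.1.1 c.2.1.2.1 c.2.2.1 p q (c.2.1.1.2 + 1) (c.2.1.2.2 + 1)
    (c.2.2.2 + 1) E m (by omega) (by omega) (by omega) hE hm
  have hc : c.center = ⟨(c.2.1.1.1 : ℝ) / ((c.2.1.1.2 + 1 : ℕ) : ℝ),
      (c.2.1.2.1 : ℝ) / ((c.2.1.2.2 + 1 : ℕ) : ℝ)⟩ := by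
    simp only [AlgCode.center, RatCode.value]; push_cast; rfl
  have hr : c.radius = (c.2.2.1 : ℝ) / ((c.2.2.2 + 1 : ℕ) : ℝ) := by
    simp only [AlgCode.radius, RatCode.value]; push_cast; rfl
  rw [hc, hr]
  exact h

theorem norm_sub_val_of_atomTest {c : AlgCode} (hc : c.Valid) {D : ℕ}
    {w : (ℤ × ℤ) × (ℕ × ℕ)} (h : atomTest c D w = true) :
    ‖toC w.1 / w.2.1 - c.val‖ < 1 / w.2.2 := by
  obtain ⟨hE, hm, hD, hs, hb⟩ := atomTest_iff.1 h
  have hER : (0 : ℝ) < w.2.1 := by exact_mod_cast hE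
  have hd := denProd_pos c.1
  have hdR : (0 : ℝ) < denProd c.1 := by exact_mod_cast hd
  obtain ⟨β, hβ, hβ2⟩ := exists_root_near c.1 hc.poly_ne_zero (toC w.1 / w.2.1) w.2.2 hm (by
    rw [← polyFrac_eq _ hE, norm_div, Complex.norm_natCast, polyFrac_snd]
    push_cast
    have h1 := norm_toC_le (polyFrac w.1 w.2.1 c.1).1
    have h2 : (gAbs (polyFrac w.1 w.2.1 c.1).1 : ℝ) * (w.2.2 : ℝ) ^ c.1.length
      < (w.2.1 : ℝ) ^ c.1.length := by exact_mod_cast hs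
    have h3 : ‖toC (polyFrac w.1 w.2.1 c.1).1‖ * (w.2.2 : ℝ) ^ c.1.length
      < (w.2.1 : ℝ) ^ c.1.length := lt_of_le_of_lt (by gcongr) h2
    have hp : (0 : ℝ) < (w.2.1 : ℝ) ^ c.1.length := by positivity
    rw [show ‖toC (polyFrac w.1 w.2.1 c.1).1‖ / ((denProd c.1 : ℝ) * (w.2.1 : ℝ) ^ c.1.length) *
      (denProd c.1 : ℝ) * (w.2.2 : ℝ) ^ c.1.length =
      (‖toC (polyFrac w.1 w.2.1 c.1).1‖ * (w.2.2 : ℝ) ^ c.1.length) / (w.2.1 : ℝ) ^ c.1.length by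
        field_simp]
    rwa [div_lt_one hp])
  have hβc : ‖β - c.center‖ < c.radius := by
    have : β - c.center = (toC w.1 / w.2.1 - c.center) - (toC w.1 / w.2.1 - β) := by ring
    rw [this]
    exact (norm_sub_le _ _).trans_lt (by linarith)
  rwa [← hc.eq_val hβ hβc]

theorem exists_atomTest {c : AlgCode} (hc : c.Valid) (D : ℕ) : ∃ w, atomTest c D w = true := by
  have hlt := hc.norm_lt
  obtain ⟨m0, hm0⟩ := exists_nat_one_div_lt (sub_pos.2 hlt)
  set m := max D (m0 + 1) with hm
  have hm1 : 1 ≤ m := le_max_of_le_right (by omega)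
  have hmr : 1 / (m : ℝ) < c.radius - ‖c.val - c.center‖ := by
    refine lt_of_le_of_lt ?_ hm0
    have : ((m0 : ℝ) + 1) ≤ m := by exact_mod_cast le_max_right D (m0 + 1)
    gcongr
  set ζ : ℕ → ℂ := fun E => toC (⌊(E : ℝ) * c.val.re⌋, ⌊(E : ℝ) * c.val.im⌋) / E with hζ
  have hζlim : Filter.Tendsto ζ Filter.atTop (nhds c.val) := by
    rw [tendsto_iff_norm_sub_tendsto_zero]
    have h2 : Filter.Tendsto (fun E : ℕ => (2 : ℝ) / E) Filter.atTop (nhds 0) :=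
      tendsto_const_div_atTop_nhds_zero_nat 2
    refine squeeze_zero' (Filter.Eventually.of_forall fun _ => norm_nonneg _) ?_ h2
    filter_upwards [Filter.eventually_ge_atTop 1] with E hE
    have hER : (0 : ℝ) < E := by exact_mod_cast hE
    refine (Complex.norm_le_abs_re_add_abs_im _).trans ?_
    rw [Complex.sub_re, Complex.sub_im, hζ]
    simp only [Complex.div_natCast_re, Complex.div_natCast_im, toC_re, toC_im]
    have key : ∀ x : ℝ, |(⌊(E : ℝ) * x⌋ : ℝ) / E - x| ≤ 1 / E := by
      intro x
      have h1 := Int.floor_le ((E : ℝ) * x)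
      have h2 := Int.lt_floor_add_one ((E : ℝ) * x)
      rw [show (⌊(E : ℝ) * x⌋ : ℝ) / E - x = ((⌊(E : ℝ) * x⌋ : ℝ) - E * x) / E by field_simp,
        abs_div, abs_of_pos hER]
      gcongr
      rw [abs_le]
      constructor <;> linarith
    refine (add_le_add (key _) (key _)).trans (le_of_eq (by ring))
  have hd := denProd_pos c.1
  have hdR : (0 : ℝ) < denProd c.1 := by exact_mod_cast hd
  have e1 : ∀ᶠ E in Filter.atTop, ‖ζ E - c.center‖ < c.radius - 1 / m := by
    have : Filter.Tendsto (fun E => ‖ζ E - c.center‖) Filter.atTop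
      (nhds ‖c.val - c.center‖) := (hζlim.sub_const _).norm
    exact this.eventually_lt_const (by linarith)
  have e2 : ∀ᶠ E in Filter.atTop,
      2 * (‖aeval (ζ E) c.poly‖ * denProd c.1 * (m : ℝ) ^ c.1.length) < 1 := by
    have h1 : Filter.Tendsto (fun E => ‖aeval (ζ E) c.poly‖) Filter.atTop (nhds 0) := by
      have h2 : Filter.Tendsto (fun E => aeval (ζ E) c.poly) Filter.atTop
        (nhds (aeval c.val c.poly)) :=
        ((Polynomial.continuous_aeval c.poly).tendsto c.val).comp hζlim
      rw [hc.aeval_val] at h2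
      simpa using h2.norm
    have h3 := ((h1.mul_const (denProd c.1 : ℝ)).mul_const ((m : ℝ) ^ c.1.length)).const_mul 2
    rw [zero_mul, zero_mul, mul_zero] at h3
    exact h3.eventually_lt_const one_pos
  obtain ⟨E, h1, h2, hE⟩ := (e1.and (e2.and (Filter.eventually_ge_atTop 1))).exists
  refine ⟨((⌊(E : ℝ) * c.val.re⌋, ⌊(E : ℝ) * c.val.im⌋), E, m), atomTest_iff.2
    ⟨hE, hm1, le_max_left _ _, ?_, h1⟩⟩
  set w : ℤ × ℤ := (⌊(E : ℝ) * c.val.re⌋, ⌊(E : ℝ) * c.val.im⌋) with hw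
  have hER : (0 : ℝ) < E := by exact_mod_cast hE
  have hp : (0 : ℝ) < (E : ℝ) ^ c.1.length := by positivity
  have hval : aeval (ζ E) c.poly = toC (polyFrac w E c.1).1 / (polyFrac w E c.1).2 :=
    (polyFrac_eq w hE c.1).symm
  rw [hval, norm_div, Complex.norm_natCast, polyFrac_snd] at h2
  push_cast at h2
  rw [show 2 * (‖toC (polyFrac w E c.1).1‖ / ((denProd c.1 : ℝ) * (E : ℝ) ^ c.1.length) *
      (denProd c.1 : ℝ) * (m : ℝ) ^ c.1.length) =
      ((2 * ‖toC (polyFrac w E c.1).1‖) * (m : ℝ) ^ c.1.length) / (E : ℝ) ^ c.1.length by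
        field_simp, div_lt_one hp] at h2
  have h3 : (gAbs (polyFrac w E c.1).1 : ℝ) * (m : ℝ) ^ c.1.length < (E : ℝ) ^ c.1.length := by
    refine lt_of_le_of_lt ?_ h2
    have := gAbs_le (polyFrac w E c.1).1
    gcongr
  exact_mod_cast h3

theorem mem_atomBall_of_atomTest {c : AlgCode} (hc : c.Valid) {D : ℕ}
    {w : (ℤ × ℤ) × (ℕ × ℕ)} (h : atomTest c D w = true) :
    Ball.Mem D (gDiv (gMul (D, 0) w.1) w.2.1, 3) c.val := by
  have h1 := norm_sub_val_of_atomTest hc h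
  obtain ⟨hE, hm, hmD, -, -⟩ := atomTest_iff.1 h
  have h2 := norm_gDiv_sub (gMul (D, 0) w.1) w.2.1 hE
  rw [toC_gMul, toC_int] at h2
  simp only [Ball.Mem]
  have h3 : ‖(D : ℂ) * (toC w.1 / w.2.1 - c.val)‖ ≤ 1 := by
    rw [norm_mul, Complex.norm_natCast]
    have hmR : (0 : ℝ) < w.2.2 := by exact_mod_cast hm
    have hmD' : (D : ℝ) ≤ w.2.2 := by exact_mod_cast hmD
    calc (D : ℝ) * ‖toC w.1 / w.2.1 - c.val‖ ≤ w.2.2 * (1 / w.2.2) := by gcongr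
      _ = 1 := by field_simp
  rw [show (D : ℂ) * c.val - toC (gDiv (gMul (D, 0) w.1) w.2.1)
    = -((D : ℂ) * (toC w.1 / w.2.1 - c.val))
      - (toC (gDiv (gMul (D, 0) w.1) w.2.1) - ((D : ℤ) : ℂ) * toC w.1 / w.2.1) by push_cast; ring]
  refine (norm_sub_le _ _).trans ?_
  rw [norm_neg]
  push_cast at h2 ⊢
  linarith

theorem mem_isolatingBall {c : AlgCode} (hc : c.Valid) (D : ℕ) :
    Ball.Mem D ((intDiv (D * c.2.1.1.1) (c.2.1.1.2 + 1), intDiv (D * c.2.1.2.1) (c.2.1.2.2 + 1)),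
      D * c.2.2.1.natAbs + 2) c.val := by
  have h := hc.norm_lt
  simp only [Ball.Mem]
  have h1 := intDiv_cast (D * c.2.1.1.1) (c.2.1.1.2 + 1) (by omega)
  have h2 := intDiv_cast (D * c.2.1.2.1) (c.2.1.2.2 + 1) (by omega)
  set w := (intDiv (D * c.2.1.1.1) (c.2.1.1.2 + 1), intDiv (D * c.2.1.2.1) (c.2.1.2.2 + 1)) with hw
  have h3 : ‖(D : ℂ) * c.center - toC w‖ ≤ 2 := by
    refine (Complex.norm_le_abs_re_add_abs_im _).trans ?_
    rw [Complex.sub_re, Complex.sub_im, toC_re, toC_im, ← Complex.ofReal_natCast,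
      Complex.re_ofReal_mul, Complex.im_ofReal_mul, abs_sub_comm, abs_sub_comm (_ * _)]
    simp only [AlgCode.center, RatCode.value, hw]
    push_cast at h1 h2 ⊢
    rw [mul_div_assoc] at h1 h2
    linarith
  have h4 : c.radius ≤ c.2.2.1.natAbs := by
    simp only [AlgCode.radius, RatCode.value]
    push_cast [Nat.cast_natAbs]
    rw [div_le_iff₀ (by positivity)]
    have h5 := le_abs_self (c.2.2.1 : ℝ)
    have h6 : (0 : ℝ) ≤ |(c.2.2.1 : ℝ)| * c.2.2.2 := by positivity
    nlinarith
  rw [show (D : ℂ) * c.val - toC w = D * (c.val - c.center) + (D * c.center - toC w) by ring]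
  refine (norm_add_le _ _).trans ?_
  rw [norm_mul, Complex.norm_natCast]
  have h5 : (D : ℝ) * ‖c.val - c.center‖ ≤ D * c.2.2.1.natAbs := by
    gcongr; exact h.le.trans h4
  push_cast at h5 ⊢
  linarith

theorem Encloses.atom {c : AlgCode} (hc : c.Valid) :
    Encloses (fun D n _ => atomBall c D n) (fun _ => c.val) := by
  refine ⟨fun D _ n _ _ _ => ?_, fun R => ⟨max 3 ‖c.val‖, fun D _ => ?_⟩⟩
  · simp only [atomBall]
    set w := (decode (α := (ℤ × ℤ) × (ℕ × ℕ)) (Nat.findGreatest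
      (fun k => atomTest c D ((decode (α := (ℤ × ℤ) × (ℕ × ℕ)) k).getD default) = true) n)).getD
      default
    rcases hw : atomTest c D w with _ | _
    · exact mem_isolatingBall hc D
    · exact mem_atomBall_of_atomTest hc hw
  · obtain ⟨w, hw⟩ := exists_atomTest hc D
    filter_upwards [Filter.eventually_ge_atTop (encode w)] with n hn X t _ _
    refine ⟨le_max_of_le_left ?_, le_max_right _ _⟩
    have := Nat.findGreatest_spec
      (P := fun k => atomTest c D ((decode (α := (ℤ × ℤ) × (ℕ × ℕ)) k).getD default) = true) hn
      (by rw [encodek, Option.getD_some]; exact hw)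
    simp only [atomBall, this, cond_true]
    norm_num

section

variable {α : Type} [Primcodable α]

@[fun_prop] theorem primrec_polyFrac {z : α → ℤ × ℤ} {E : α → ℕ} {l : α → List RatCode}
    (hz : Primrec z) (hE : Primrec E) (hl : Primrec l) :
    Primrec (fun a => polyFrac (z a) (E a) (l a)) := by unfold polyFrac; fun_prop

@[fun_prop] theorem primrec_atomTest {c : α → AlgCode} {D : α → ℕ}
    {w : α → (ℤ × ℤ) × (ℕ × ℕ)} (hc : Primrec c) (hD : Primrec D) (hw : Primrec w) :
    Primrec (fun a => atomTest (c a) (D a) (w a)) := by unfold atomTest; fun_prop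

@[fun_prop] theorem primrec_atomBall {c : α → AlgCode} {D n : α → ℕ}
    (hc : Primrec c) (hD : Primrec D) (hn : Primrec n) :
    Primrec (fun a => atomBall (c a) (D a) (n a)) := by
  have h := primrec_findGreatest (n := n) (q := fun a k =>
    atomTest (c a) (D a) ((decode (α := (ℤ × ℤ) × (ℕ × ℕ)) k).getD default)) hn (by fun_prop)
  unfold atomBall
  fun_prop

end

end Atom

end PEFIsolation

namespace PEFIsolation
open Encodable

/-! ### Integer polynomials in algebraic numbers -/

section ZPoly

/-- An integer polynomial in the numbers represented by codes: a list of monomials, each an integer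
coefficient with a list of factors. -/
abbrev ZPoly : Type := List (ℤ × List AlgCode)

/-- The value of a monomial. -/
noncomputable def monoVal (m : ℤ × List AlgCode) : ℂ := (m.1 : ℂ) * (m.2.map AlgCode.val).prod

/-- The complex number expressed by an integer polynomial in codes. -/
noncomputable def ZPoly.val (E : ZPoly) : ℂ := (E.map monoVal).sum

/-- The codes that occur. -/
def ZPoly.atoms (E : ZPoly) : List AlgCode := E.flatMap fun m => m.2

/-- The expression of an integer. -/
def zInt (n : ℤ) : ZPoly := [(n, [])]

/-- The expression of a product. -/
def zMul (E F : ZPoly) : ZPoly := E.flatMap fun m => F.map fun n => (m.1 * n.1, m.2 ++ n.2)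

theorem ZPoly.val_nil : ZPoly.val [] = 0 := by simp [ZPoly.val]

theorem ZPoly.val_cons (m : ℤ × List AlgCode) (E : ZPoly) :
    ZPoly.val (m :: E) = monoVal m + ZPoly.val E := by simp [ZPoly.val]

theorem ZPoly.val_append (E F : ZPoly) : ZPoly.val (E ++ F) = E.val + F.val := by
  simp [ZPoly.val]

theorem val_zInt (n : ℤ) : (zInt n).val = n := by simp [zInt, ZPoly.val, monoVal]

theorem val_zMul (E F : ZPoly) : (zMul E F).val = E.val * F.val := by
  induction E with
  | nil => simp [zMul, ZPoly.val_nil]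
  | cons m E ih =>
    have h : zMul (m :: E) F = F.map (fun n => (m.1 * n.1, m.2 ++ n.2)) ++ zMul E F := by
      simp [zMul]
    have h2 : ZPoly.val (F.map fun n => (m.1 * n.1, m.2 ++ n.2)) = monoVal m * F.val := by
      clear h ih
      induction F with
      | nil => simp [ZPoly.val_nil]
      | cons n F ih =>
        rw [List.map_cons, ZPoly.val_cons, ih, ZPoly.val_cons, mul_add]
        congr 1
        simp only [monoVal, List.map_append, List.prod_append]
        push_cast; ring
    rw [h, ZPoly.val_append, ih, h2, ZPoly.val_cons, add_mul]

theorem mem_atoms_zMul {E F : ZPoly} {c : AlgCode} (h : c ∈ (zMul E F).atoms) :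
    c ∈ E.atoms ∨ c ∈ F.atoms := by
  simp only [ZPoly.atoms, zMul, List.mem_flatMap, List.mem_map] at *
  obtain ⟨_, ⟨m, hm, n, hn, rfl⟩, hc⟩ := h
  rcases List.mem_append.1 hc with hc | hc
  · exact Or.inl ⟨m, hm, hc⟩
  · exact Or.inr ⟨n, hn, hc⟩

theorem ZPoly.atoms_append (E F : ZPoly) : ZPoly.atoms (E ++ F) = E.atoms ++ F.atoms := by
  simp [ZPoly.atoms]

theorem atoms_zInt (n : ℤ) : (zInt n).atoms = [] := by simp [zInt, ZPoly.atoms]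

/-- The ball arithmetic evaluation of an integer polynomial in codes. -/
def zBall (E : ZPoly) (D n : ℕ) : Ball :=
  E.foldr (fun m s => bAdd (m.2.foldr (fun c r => bMul D (atomBall c D n) r) (bInt D m.1)) s)
    (bInt D 0)

theorem Encloses.zpoly {E : ZPoly} (hE : ∀ c ∈ E.atoms, c.Valid) :
    Encloses (fun D n _ => zBall E D n) (fun _ => E.val) := by
  refine Encloses.foldr_add E (b := fun m D n _ =>
      m.2.foldr (fun c r => bMul D (atomBall c D n) r) (bInt D m.1)) (g := fun m _ => monoVal m)
    fun m hm => ?_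
  exact Encloses.foldr_mul m.2 m.1 (b := fun c D n _ => atomBall c D n) (g := fun c _ => c.val)
    fun c hc => Encloses.atom (hE c (List.mem_flatMap.2 ⟨m, hm, hc⟩))

end ZPoly

/-! ### Polynomial-exponential expressions over algebraic numbers -/

section Terms

/-- A polynomial-exponential expression: the list of the monomials `c t ^ a exp (l t)`, each as
`(c, a, l)`. -/
abbrev Terms : Type := List (ZPoly × ℕ × ZPoly)

/-- The value of a monomial at separate arguments of the power and of the exponential. -/
noncomputable def termVal (s t : ℂ) (m : ZPoly × ℕ × ZPoly) : ℂ :=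
  m.1.val * s ^ m.2.1 * Complex.exp (m.2.2.val * t)

/-- The value of an expression, with `s` for the variable in the polynomial coefficients and `t`
for the variable in the exponents. -/
noncomputable def Terms.eval₂ (g : Terms) (s t : ℂ) : ℂ := (g.map (termVal s t)).sum

/-- The entire function given by an expression. -/
noncomputable def Terms.eval (g : Terms) (t : ℂ) : ℂ := g.eval₂ t t

/-- The codes that occur. -/
def Terms.atoms (g : Terms) : List AlgCode := g.flatMap fun m => m.1.atoms ++ m.2.2.atoms

/-- All codes that occur are valid. -/
def Terms.Valid (g : Terms) : Prop := ∀ c ∈ g.atoms, c.Valid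

/-- The product with an integer. -/
def tScale (n : ℤ) (g : Terms) : Terms := g.map fun m => (zMul (zInt n) m.1, m.2.1, m.2.2)

/-- The product. -/
def tMul (g h : Terms) : Terms :=
  g.flatMap fun m => h.map fun n => (zMul m.1 n.1, m.2.1 + n.2.1, m.2.2 ++ n.2.2)

/-- The derivative. -/
def tDeriv (g : Terms) : Terms := g.flatMap fun m =>
  [(zMul (zInt m.2.1) m.1, m.2.1 - 1, m.2.2), (zMul m.1 m.2.2, m.2.1, m.2.2)]

/-- The value at `0`. -/
def tZero (g : Terms) : ZPoly := g.flatMap fun m => bif m.2.1 == 0 then m.1 else []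

/-- The sum of the exponents. -/
def tDegSum (g : Terms) : ℕ := g.foldr (fun m s => m.2.1 + s) 0

/-- A positive multiple of the expression in which the variable of the polynomial coefficients is
replaced by a rational number. The multiplier is the denominator to the power `tDegSum g`, which
clears the denominators of all powers that occur. -/
def tFreeze (g : Terms) (p : RatCode) : Terms :=
  g.map fun m => (zMul (zInt ((fun z => p.1 * z)^[m.2.1] 1 * ((p.2 + 1) ^ (tDegSum g - m.2.1) : ℕ)))
    m.1, 0, m.2.2)

theorem Terms.eval₂_cons (m : ZPoly × ℕ × ZPoly) (g : Terms) (s t : ℂ) :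
    Terms.eval₂ (m :: g) s t = termVal s t m + Terms.eval₂ g s t := by simp [Terms.eval₂]

theorem Terms.eval₂_append (g h : Terms) (s t : ℂ) :
    Terms.eval₂ (g ++ h) s t = g.eval₂ s t + h.eval₂ s t := by simp [Terms.eval₂]

theorem Terms.eval_append (g h : Terms) (t : ℂ) : Terms.eval (g ++ h) t = g.eval t + h.eval t :=
  Terms.eval₂_append g h t t

theorem Terms.atoms_append (g h : Terms) : Terms.atoms (g ++ h) = g.atoms ++ h.atoms := by
  simp [Terms.atoms]

theorem Terms.atoms_cons (m : ZPoly × ℕ × ZPoly) (g : Terms) :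
    Terms.atoms (m :: g) = m.1.atoms ++ m.2.2.atoms ++ g.atoms := by
  simp [Terms.atoms]

theorem eval₂_tScale (n : ℤ) (g : Terms) (s t : ℂ) :
    (tScale n g).eval₂ s t = n * g.eval₂ s t := by
  induction g with
  | nil => simp [tScale, Terms.eval₂]
  | cons m g ih =>
    have h : tScale n (m :: g) = (zMul (zInt n) m.1, m.2.1, m.2.2) :: tScale n g := rfl
    rw [h, Terms.eval₂_cons, ih, Terms.eval₂_cons]
    simp only [termVal, val_zMul, val_zInt]
    ring

theorem eval_tScale (n : ℤ) (g : Terms) (t : ℂ) : (tScale n g).eval t = n * g.eval t :=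
  eval₂_tScale n g t t

theorem eval₂_tMul (g h : Terms) (s t : ℂ) :
    (tMul g h).eval₂ s t = g.eval₂ s t * h.eval₂ s t := by
  induction g with
  | nil => simp [tMul, Terms.eval₂]
  | cons m g ih =>
    have h1 : tMul (m :: g) h
      = h.map (fun n => (zMul m.1 n.1, m.2.1 + n.2.1, m.2.2 ++ n.2.2)) ++ tMul g h := by
      simp [tMul]
    have h2 : Terms.eval₂ (h.map fun n => (zMul m.1 n.1, m.2.1 + n.2.1, m.2.2 ++ n.2.2)) s t
        = termVal s t m * h.eval₂ s t := by
      clear h1 ih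
      induction h with
      | nil => simp [Terms.eval₂]
      | cons n h ih =>
        rw [List.map_cons, Terms.eval₂_cons, ih, Terms.eval₂_cons, mul_add]
        congr 1
        simp only [termVal, val_zMul, ZPoly.val_append, add_mul, Complex.exp_add, pow_add]
        ring
    rw [h1, Terms.eval₂_append, ih, h2, Terms.eval₂_cons, add_mul]

theorem eval_tMul (g h : Terms) (t : ℂ) : (tMul g h).eval t = g.eval t * h.eval t :=
  eval₂_tMul g h t t

theorem hasDerivAt_eval (g : Terms) (t : ℂ) : HasDerivAt g.eval ((tDeriv g).eval t) t := by
  induction g with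
  | nil =>
    have h : Terms.eval [] = fun _ => (0 : ℂ) := by ext; simp [Terms.eval, Terms.eval₂]
    rw [h]
    simpa [tDeriv, Terms.eval, Terms.eval₂] using hasDerivAt_const t (0 : ℂ)
  | cons m g ih =>
    have h : Terms.eval (m :: g) = fun t => termVal t t m + Terms.eval g t := by
      ext t; exact Terms.eval₂_cons m g t t
    have h2 : tDeriv (m :: g) = [(zMul (zInt m.2.1) m.1, m.2.1 - 1, m.2.2),
      (zMul m.1 m.2.2, m.2.1, m.2.2)] ++ tDeriv g := by simp [tDeriv]
    rw [h, h2, Terms.eval_append]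
    refine HasDerivAt.add ?_ ih
    have h3 := ((hasDerivAt_pow m.2.1 t).const_mul m.1.val).mul
      (((hasDerivAt_id t).const_mul m.2.2.val).cexp)
    refine (show HasDerivAt (fun t => termVal t t m) _ t from h3).congr_deriv ?_
    simp only [Terms.eval, Terms.eval₂, List.map_cons, List.map_nil, List.sum_cons, List.sum_nil,
      termVal, val_zMul, val_zInt, id]
    push_cast
    ring

theorem differentiable_eval (g : Terms) : Differentiable ℂ g.eval :=
  fun t => (hasDerivAt_eval g t).differentiableAt

theorem continuous_eval (g : Terms) : Continuous g.eval := (differentiable_eval g).continuous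

theorem deriv_eval (g : Terms) : deriv g.eval = (tDeriv g).eval :=
  funext fun t => (hasDerivAt_eval g t).deriv

theorem iteratedDeriv_eval (g : Terms) (j : ℕ) :
    iteratedDeriv j g.eval = (tDeriv^[j] g).eval := by
  induction j generalizing g with
  | zero => simp
  | succ j ih => rw [iteratedDeriv_succ', deriv_eval, ih, Function.iterate_succ_apply]

theorem val_tZero (g : Terms) : (tZero g).val = g.eval 0 := by
  induction g with
  | nil => simp [tZero, Terms.eval, Terms.eval₂, ZPoly.val]
  | cons m g ih =>
    have h : tZero (m :: g) = (bif m.2.1 == 0 then m.1 else []) ++ tZero g := by simp [tZero]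
    rw [h, ZPoly.val_append, ih, Terms.eval, Terms.eval, Terms.eval₂_cons]
    congr 1
    rcases Nat.eq_zero_or_pos m.2.1 with h0 | h0
    · simp [termVal, h0]
    · have : (m.2.1 == 0) = false := by simpa using h0.ne'
      simp [termVal, this, ZPoly.val_nil, h0.ne']

theorem le_tDegSum {g : Terms} {m : ZPoly × ℕ × ZPoly} (hm : m ∈ g) : m.2.1 ≤ tDegSum g := by
  induction g with
  | nil => simp at hm
  | cons n g ih =>
    have h : tDegSum (n :: g) = n.2.1 + tDegSum g := rfl
    rcases List.mem_cons.1 hm with rfl | hm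
    · omega
    · have := ih hm; omega

theorem iterate_mul_one (n : ℤ) (a : ℕ) : (fun z => n * z)^[a] 1 = n ^ a := by
  induction a with
  | zero => simp
  | succ a ih => rw [Function.iterate_succ_apply', ih, pow_succ']

theorem eval_tFreeze (g : Terms) (p : RatCode) (t : ℂ) :
    (tFreeze g p).eval t = ((p.2 : ℂ) + 1) ^ tDegSum g * g.eval₂ (p.value : ℂ) t := by
  have hp : ((p.2 : ℂ) + 1) ≠ 0 := by exact_mod_cast Nat.succ_ne_zero p.2
  have key : ∀ (A : ℕ) (h : Terms), (∀ m ∈ h, m.2.1 ≤ A) →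
      Terms.eval₂ (h.map fun m => (zMul (zInt ((fun z => p.1 * z)^[m.2.1] 1 *
        ((p.2 + 1) ^ (A - m.2.1) : ℕ))) m.1, 0, m.2.2)) t t
      = ((p.2 : ℂ) + 1) ^ A * h.eval₂ (p.value : ℂ) t := by
    intro A h
    induction h with
    | nil => intro _; simp [Terms.eval₂]
    | cons m h ih =>
      intro hA
      rw [List.map_cons, Terms.eval₂_cons, Terms.eval₂_cons, ih fun n hn => hA n (by simp [hn]),
        mul_add]
      congr 1
      have hm := hA m (by simp)
      simp only [termVal, val_zMul, val_zInt, pow_zero, mul_one, iterate_mul_one, RatCode.value]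
      push_cast
      rw [← Nat.sub_add_cancel hm, pow_add ((p.2 : ℂ) + 1), Nat.add_sub_cancel, div_pow]
      field_simp
  exact key _ g fun m hm => le_tDegSum hm

theorem atoms_tScale {n : ℤ} {g : Terms} {c : AlgCode} (h : c ∈ (tScale n g).atoms) :
    c ∈ g.atoms := by
  simp only [Terms.atoms, tScale, List.mem_flatMap, List.mem_map, List.mem_append] at *
  obtain ⟨_, ⟨m, hm, rfl⟩, hc | hc⟩ := h
  · rcases mem_atoms_zMul hc with hc | hc
    · simp [atoms_zInt] at hc
    · exact ⟨m, hm, Or.inl hc⟩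
  · exact ⟨m, hm, Or.inr hc⟩

theorem atoms_tMul {g h : Terms} {c : AlgCode} (hc : c ∈ (tMul g h).atoms) :
    c ∈ g.atoms ∨ c ∈ h.atoms := by
  simp only [Terms.atoms, tMul, List.mem_flatMap, List.mem_map, List.mem_append] at *
  obtain ⟨_, ⟨m, hm, n, hn, rfl⟩, hc | hc⟩ := hc
  · rcases mem_atoms_zMul hc with hc | hc
    · exact Or.inl ⟨m, hm, Or.inl hc⟩
    · exact Or.inr ⟨n, hn, Or.inl hc⟩
  · rw [ZPoly.atoms_append, List.mem_append] at hc
    rcases hc with hc | hc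
    · exact Or.inl ⟨m, hm, Or.inr hc⟩
    · exact Or.inr ⟨n, hn, Or.inr hc⟩

theorem atoms_tDeriv {g : Terms} {c : AlgCode} (hc : c ∈ (tDeriv g).atoms) : c ∈ g.atoms := by
  simp only [Terms.atoms, tDeriv, List.mem_flatMap, List.mem_append] at *
  obtain ⟨x, ⟨m, hm, hx⟩, hc⟩ := hc
  refine ⟨m, hm, ?_⟩
  simp only [List.mem_cons, List.not_mem_nil, or_false] at hx
  rcases hx with rfl | rfl
  · rcases hc with hc | hc
    · rcases mem_atoms_zMul hc with hc | hc
      · simp [atoms_zInt] at hc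
      · exact Or.inl hc
    · exact Or.inr hc
  · rcases hc with hc | hc
    · exact mem_atoms_zMul hc
    · exact Or.inr hc

theorem atoms_tFreeze {g : Terms} {p : RatCode} {c : AlgCode} (h : c ∈ (tFreeze g p).atoms) :
    c ∈ g.atoms := by
  simp only [Terms.atoms, tFreeze, List.mem_flatMap, List.mem_map, List.mem_append] at *
  obtain ⟨_, ⟨m, hm, rfl⟩, hc | hc⟩ := h
  · rcases mem_atoms_zMul hc with hc | hc
    · simp [atoms_zInt] at hc
    · exact ⟨m, hm, Or.inl hc⟩
  · exact ⟨m, hm, Or.inr hc⟩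

theorem atoms_tZero {g : Terms} {c : AlgCode} (h : c ∈ (tZero g).atoms) : c ∈ g.atoms := by
  simp only [ZPoly.atoms, tZero, List.mem_flatMap] at h
  obtain ⟨x, ⟨m, hm, hx⟩, hc⟩ := h
  simp only [Terms.atoms, List.mem_flatMap, List.mem_append]
  refine ⟨m, hm, Or.inl ?_⟩
  rcases h0 : m.2.1 == 0 with _ | _
  · simp [h0] at hx
  · rw [h0, cond_true] at hx
    exact List.mem_flatMap.2 ⟨x, hx, hc⟩

theorem Terms.Valid.tScale {g : Terms} (h : g.Valid) (n : ℤ) : (tScale n g).Valid :=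
  fun c hc => h c (atoms_tScale hc)

theorem Terms.Valid.tMul {g g' : Terms} (h : g.Valid) (h' : g'.Valid) : (tMul g g').Valid :=
  fun c hc => (atoms_tMul hc).elim (h c) (h' c)

theorem Terms.Valid.append {g g' : Terms} (h : g.Valid) (h' : g'.Valid) :
    Terms.Valid (g ++ g') := by
  intro c hc
  rw [Terms.atoms_append, List.mem_append] at hc
  exact hc.elim (h c) (h' c)

theorem Terms.Valid.tDeriv {g : Terms} (h : g.Valid) : (tDeriv g).Valid :=
  fun c hc => h c (atoms_tDeriv hc)

theorem Terms.Valid.iterate_tDeriv {g : Terms} (h : g.Valid) (j : ℕ) :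
    (PEFIsolation.tDeriv^[j] g).Valid := by
  induction j with
  | zero => exact h
  | succ j ih => rw [Function.iterate_succ_apply']; exact ih.tDeriv

theorem Terms.Valid.tFreeze {g : Terms} (h : g.Valid) (p : RatCode) : (tFreeze g p).Valid :=
  fun c hc => h c (atoms_tFreeze hc)

/-- The ball arithmetic evaluation of an expression at the points near `X / D`. -/
def tBall (g : Terms) (D n : ℕ) (X : ℤ) : Ball :=
  g.foldr (fun m s => bAdd (bMul D (bMul D (zBall m.1 D n) (bPow D ((X, 0), 1) m.2.1))
    (bExp D (bMul D (zBall m.2.2 D n) ((X, 0), 1)))) s) (bInt D 0)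

theorem Encloses.terms {g : Terms} (hg : g.Valid) :
    Encloses (fun D n X => tBall g D n X) (fun t => g.eval (t : ℂ)) := by
  refine Encloses.foldr_add g (b := fun m D n X =>
      bMul D (bMul D (zBall m.1 D n) (bPow D ((X, 0), 1) m.2.1))
        (bExp D (bMul D (zBall m.2.2 D n) ((X, 0), 1)))) (g := fun m t => termVal t t m)
    fun m hm => ?_
  have h1 : Encloses (fun D n _ => zBall m.1 D n) (fun _ => m.1.val) := Encloses.zpoly fun c hc =>
    hg c (List.mem_flatMap.2 ⟨m, hm, List.mem_append_left _ hc⟩)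
  have h2 : Encloses (fun D n _ => zBall m.2.2 D n) (fun _ => m.2.2.val) :=
    Encloses.zpoly fun c hc => hg c (List.mem_flatMap.2 ⟨m, hm, List.mem_append_right _ hc⟩)
  exact (h1.mul (Encloses.var.pow m.2.1)).mul (h2.mul Encloses.var).exp

section

variable {α : Type} [Primcodable α]

@[fun_prop] theorem primrec_zMul {f g : α → ZPoly} (hf : Primrec f) (hg : Primrec g) :
    Primrec (fun a => zMul (f a) (g a)) := by unfold zMul; fun_prop

@[fun_prop] theorem primrec_zInt {f : α → ℤ} (hf : Primrec f) :
    Primrec (fun a => zInt (f a)) := by unfold zInt; fun_prop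

@[fun_prop] theorem primrec_zBall {f : α → ZPoly} {D n : α → ℕ} (hf : Primrec f) (hD : Primrec D)
    (hn : Primrec n) : Primrec (fun a => zBall (f a) (D a) (n a)) := by unfold zBall; fun_prop

@[fun_prop] theorem primrec_atoms {f : α → Terms} (hf : Primrec f) :
    Primrec (fun a => (f a).atoms) := by unfold Terms.atoms ZPoly.atoms; fun_prop

@[fun_prop] theorem primrec_tScale {n : α → ℤ} {f : α → Terms} (hn : Primrec n)
    (hf : Primrec f) : Primrec (fun a => tScale (n a) (f a)) := by unfold tScale; fun_prop

@[fun_prop] theorem primrec_tMul {f g : α → Terms} (hf : Primrec f)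
    (hg : Primrec g) : Primrec (fun a => tMul (f a) (g a)) := by unfold tMul; fun_prop

@[fun_prop] theorem primrec_tDeriv {f : α → Terms} (hf : Primrec f) :
    Primrec (fun a => tDeriv (f a)) := by unfold tDeriv; fun_prop

@[fun_prop] theorem primrec_tZero {f : α → Terms} (hf : Primrec f) :
    Primrec (fun a => tZero (f a)) := by unfold tZero; fun_prop

@[fun_prop] theorem primrec_tDegSum {f : α → Terms} (hf : Primrec f) :
    Primrec (fun a => tDegSum (f a)) := by unfold tDegSum; fun_prop

@[fun_prop] theorem primrec_tFreeze {f : α → Terms} {p : α → RatCode} (hf : Primrec f)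
    (hp : Primrec p) : Primrec (fun a => tFreeze (f a) (p a)) := by unfold tFreeze; fun_prop

@[fun_prop] theorem primrec_tBall {f : α → Terms} {D n : α → ℕ} {X : α → ℤ} (hf : Primrec f)
    (hD : Primrec D) (hn : Primrec n) (hX : Primrec X) :
    Primrec (fun a => tBall (f a) (D a) (n a) (X a)) := by unfold tBall; fun_prop

end

end Terms

/-! ### Numerical tests -/

section Tests

open Filter

theorem foldr_and_iff {ι : Type} (l : List ι) (c : ι → Bool) :
    l.foldr (fun i s => c i && s) true = true ↔ ∀ i ∈ l, c i = true := by
  induction l with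
  | nil => simp
  | cons i l ih => simp [ih]

/-- The test whether `0` is outside of a ball. -/
def bNonzero (b : Ball) : Bool := intLt (b.2 * b.2 : ℕ) (b.1.1 * b.1.1 + b.1.2 * b.1.2)

theorem bNonzero_iff (b : Ball) : bNonzero b = true ↔ (b.2 : ℝ) < ‖toC b.1‖ := by
  rw [bNonzero, intLt_iff, ← @Int.cast_lt ℝ, ← normSq_toC]
  push_cast
  rw [← pow_two]
  exact ⟨fun h => lt_of_pow_lt_pow_left₀ 2 (norm_nonneg _) h,
    fun h => pow_lt_pow_left₀ h (by positivity) two_ne_zero⟩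

/-- Having no zero on a compact interval is semidecidable: the interval is covered by balls on whose
images `0` is excluded. -/
theorem semiDec_ne_zero :
    SemiDec (fun x : Terms × RatCode × RatCode => x.1.Valid ∧ x.2.1.value ≤ x.2.2.value)
      (fun x => ∀ t : ℝ, (x.2.1.value : ℝ) ≤ t → t ≤ (x.2.2.value : ℝ) → x.1.eval t ≠ 0) := by
  have h := SemiDec.exists_decode (β := ℕ × ℕ × ℤ × ℕ)
    (S := fun x : Terms × RatCode × RatCode => x.1.Valid ∧ x.2.1.value ≤ x.2.2.value)
    (SemiDec.of_bool (c := fun y : (Terms × RatCode × RatCode) × (ℕ × ℕ × ℤ × ℕ) =>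
      Nat.ble 1 y.2.1 && !(intLt (y.2.1 * y.1.2.1.1) (y.2.2.2.1 * (y.1.2.1.2 + 1 : ℕ))) &&
      !(intLt ((y.2.2.2.1 + y.2.2.2.2) * (y.1.2.2.2 + 1 : ℕ)) (y.2.1 * y.1.2.2.1)) &&
      (List.range (y.2.2.2.2 + 1)).foldr
        (fun (i : ℕ) s => bNonzero (tBall y.1.1 y.2.1 y.2.2.1 (y.2.2.2.1 + i)) && s) true)
      (by unfold bNonzero; fun_prop))
  refine h.congr ?_
  rintro ⟨g, a, b⟩ ⟨hg, hab⟩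
  have henc := Encloses.terms hg
  have hvala : (a.value : ℝ) = (a.1 : ℝ) / ((a.2 : ℝ) + 1) := by simp [RatCode.value]
  have hvalb : (b.value : ℝ) = (b.1 : ℝ) / ((b.2 : ℝ) + 1) := by simp [RatCode.value]
  have ha0 : (0 : ℝ) < (a.2 : ℝ) + 1 := by positivity
  have hb0 : (0 : ℝ) < (b.2 : ℝ) + 1 := by positivity
  have key : ∀ (D n : ℕ) (lo : ℤ) (k : ℕ), ((Nat.ble 1 D && !(intLt (D * a.1) (lo * (a.2 + 1 : ℕ))) &&
      !(intLt ((lo + k) * (b.2 + 1 : ℕ)) (D * b.1)) && (List.range (k + 1)).foldr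
        (fun (i : ℕ) s => bNonzero (tBall g D n (lo + i)) && s) true) = true) ↔
      1 ≤ D ∧ (lo : ℝ) ≤ D * a.value ∧ D * b.value ≤ (lo : ℝ) + k ∧
        ∀ i : ℕ, i ≤ k → ((tBall g D n (lo + i)).2 : ℝ) < ‖toC (tBall g D n (lo + i)).1‖ := by
    intro D n lo k
    simp only [Bool.and_eq_true, Bool.not_eq_true', ← Bool.not_eq_true, ble_iff, intLt_iff, not_lt,
      and_assoc, foldr_and_iff, List.mem_range, Nat.lt_succ_iff, bNonzero_iff]
    refine and_congr_right fun _ => ?_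
    rw [hvala, hvalb, mul_div_assoc', mul_div_assoc', le_div_iff₀ ha0, div_le_iff₀ hb0,
      ← @Int.cast_le ℝ, ← @Int.cast_le ℝ]
    push_cast
    rfl
  constructor
  · intro hne
    have hcont : ContinuousOn (fun t : ℝ => ‖g.eval t‖) (Set.Icc (a.value : ℝ) b.value) :=
      ((continuous_eval g).comp Complex.continuous_ofReal).norm.continuousOn
    have hab' : (a.value : ℝ) ≤ b.value := by exact_mod_cast hab
    obtain ⟨t0, ht0, hmin⟩ := isCompact_Icc.exists_isMinOn (Set.nonempty_Icc.2 hab') hcont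
    set μ := ‖g.eval t0‖ with hμ
    have hμ0 : 0 < μ := norm_pos_iff.2 (hne t0 ht0.1 ht0.2)
    obtain ⟨C, hC⟩ := henc.2 (max |(a.value : ℝ)| |(b.value : ℝ)|)
    obtain ⟨D0, hD0⟩ := exists_nat_gt (2 * C / μ)
    set D := D0 + 1 with hD
    have hDpos : 1 ≤ D := by omega
    have hDR : (0 : ℝ) < D := by exact_mod_cast hDpos
    have hDμ : 2 * C < D * μ := by
      rw [div_lt_iff₀ hμ0] at hD0
      refine hD0.trans_le ?_
      have : (D0 : ℝ) ≤ D := by exact_mod_cast Nat.le_succ D0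
      gcongr
    obtain ⟨n, hn⟩ := (hC D hDpos).exists
    refine ⟨(D, n, ⌊(D : ℝ) * a.value⌋, (⌈(D : ℝ) * b.value⌉ - ⌊(D : ℝ) * a.value⌋).toNat),
      (key _ _ _ _).2 ⟨hDpos, Int.floor_le _, ?_, ?_⟩⟩
    · have h1 := Int.le_ceil ((D : ℝ) * b.value)
      have h2 : (⌈(D : ℝ) * b.value⌉ : ℝ) ≤ (⌊(D : ℝ) * a.value⌋ : ℝ) +
          ((⌈(D : ℝ) * b.value⌉ - ⌊(D : ℝ) * a.value⌋).toNat : ℝ) := by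
        exact_mod_cast (by omega : ⌈(D : ℝ) * b.value⌉ ≤ ⌊(D : ℝ) * a.value⌋ +
          ((⌈(D : ℝ) * b.value⌉ - ⌊(D : ℝ) * a.value⌋).toNat : ℤ))
      exact h1.trans h2
    · intro i hi
      replace hi : i ≤ (⌈(D : ℝ) * b.value⌉ - ⌊(D : ℝ) * a.value⌋).toNat := hi
      set X : ℤ := ⌊(D : ℝ) * a.value⌋ + i with hX
      have hle : ⌊(D : ℝ) * a.value⌋ ≤ ⌈(D : ℝ) * b.value⌉ := by
        have h1 := Int.floor_le ((D : ℝ) * a.value)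
        have h2 := Int.le_ceil ((D : ℝ) * b.value)
        have h3 : (D : ℝ) * a.value ≤ D * b.value := by gcongr
        exact_mod_cast (h1.trans h3).trans h2
      have hX1 : ((⌊(D : ℝ) * a.value⌋ : ℤ) : ℝ) ≤ X := by
        exact_mod_cast (by omega : ⌊(D : ℝ) * a.value⌋ ≤ X)
      have hX2 : (X : ℝ) ≤ ((⌈(D : ℝ) * b.value⌉ : ℤ) : ℝ) := by
        exact_mod_cast (by omega : X ≤ ⌈(D : ℝ) * b.value⌉)
      have hf := Int.lt_floor_add_one ((D : ℝ) * a.value)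
      have hc := Int.ceil_lt_add_one ((D : ℝ) * b.value)
      have hmono : (D : ℝ) * a.value ≤ D * b.value := by gcongr
      obtain ⟨t, ht1, ht2, ht⟩ : ∃ t : ℝ, (a.value : ℝ) ≤ t ∧ t ≤ b.value ∧ |(D : ℝ) * t - X| ≤ 1 := by
        rcases le_total (X : ℝ) (D * a.value) with h | h
        · refine ⟨a.value, le_rfl, hab', ?_⟩
          rw [abs_le]; constructor <;> linarith
        · rcases le_total (D * b.value : ℝ) X with h' | h'
          · refine ⟨b.value, hab', le_rfl, ?_⟩
            rw [abs_le]; constructor <;> linarith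
          · refine ⟨X / D, ?_, ?_, ?_⟩
            · rw [le_div_iff₀ hDR]; linarith
            · rw [div_le_iff₀ hDR]; linarith
            · rw [mul_div_cancel₀ _ hDR.ne']; simp
      have htR : |t| ≤ max |(a.value : ℝ)| |(b.value : ℝ)| := abs_le_max_abs_abs ht1 ht2
      obtain ⟨he, -⟩ := hn X t htR ht
      have hmem := henc.1 D hDpos n X t ht
      have hge : μ ≤ ‖g.eval t‖ := hmin ⟨ht1, ht2⟩
      have h1 : ‖(D : ℂ) * g.eval t‖ ≤ ‖(D : ℂ) * g.eval t - toC (tBall g D n X).1‖ +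
          ‖toC (tBall g D n X).1‖ := by
        simpa using norm_add_le ((D : ℂ) * g.eval t - toC (tBall g D n X).1)
          (toC (tBall g D n X).1)
      rw [norm_mul, Complex.norm_natCast] at h1
      unfold Ball.Mem at hmem
      have h2 : (D : ℝ) * μ ≤ D * ‖g.eval t‖ := by gcongr
      linarith
  · rintro ⟨⟨D, n, lo, k⟩, hq⟩ t ht1 ht2 h0
    obtain ⟨hD, hlo, hk, hall⟩ := (key D n lo k).1 hq
    have hDR : (0 : ℝ) < D := by exact_mod_cast hD
    have h1 : (lo : ℝ) ≤ D * t := hlo.trans (by gcongr)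
    have h2 : (D : ℝ) * t ≤ lo + k := le_trans (by gcongr) hk
    have h3 : lo ≤ ⌊(D : ℝ) * t⌋ := Int.le_floor.2 h1
    have h4 : ⌊(D : ℝ) * t⌋ ≤ lo + k := by
      have := (Int.floor_le ((D : ℝ) * t)).trans h2
      exact_mod_cast this
    obtain ⟨i, hi⟩ : ∃ i : ℕ, ⌊(D : ℝ) * t⌋ = lo + i := ⟨(⌊(D : ℝ) * t⌋ - lo).toNat, by omega⟩
    have h5 := hall i (by omega)
    have hmem := henc.1 D hD n (lo + i) t (by
      rw [← hi, abs_le]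
      have := Int.floor_le ((D : ℝ) * t)
      have := Int.lt_floor_add_one ((D : ℝ) * t)
      constructor <;> linarith)
    have h0' : g.eval (t : ℂ) = 0 := h0
    simp only [Ball.Mem, h0', mul_zero, zero_sub, norm_neg] at hmem
    linarith

/-- Positivity of the real part at a rational point is semidecidable. -/
theorem semiDec_re_pos :
    SemiDec (fun x : Terms × RatCode => x.1.Valid)
      (fun x => 0 < (x.1.eval ((x.2.value : ℝ) : ℂ)).re) := by
  have h := SemiDec.exists_decode (β := ℕ × ℕ) (S := fun x : Terms × RatCode => x.1.Valid)
    (SemiDec.of_bool (c := fun y : (Terms × RatCode) × (ℕ × ℕ) =>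
      Nat.ble 1 y.2.1 &&
      intLt ((tBall y.1.1 y.2.1 y.2.2 (intDiv (y.2.1 * y.1.2.1) (y.1.2.2 + 1))).2 : ℕ)
        (tBall y.1.1 y.2.1 y.2.2 (intDiv (y.2.1 * y.1.2.1) (y.1.2.2 + 1))).1.1)
      (by fun_prop))
  refine h.congr ?_
  rintro ⟨g, p⟩ hg
  have henc := Encloses.terms hg
  have hX : ∀ D : ℕ, |(D : ℝ) * p.value - (intDiv (D * p.1) (p.2 + 1) : ℤ)| ≤ 1 := by
    intro D
    have := intDiv_cast (D * p.1) (p.2 + 1) (by omega)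
    rw [abs_sub_comm]
    convert this using 2
    simp only [RatCode.value]
    push_cast
    ring_nf
  simp only [Bool.and_eq_true, ble_iff, intLt_iff]
  constructor
  · intro hpos
    set μ := (g.eval ((p.value : ℝ) : ℂ)).re with hμ
    obtain ⟨C, hC⟩ := henc.2 |(p.value : ℝ)|
    obtain ⟨D0, hD0⟩ := exists_nat_gt (2 * C / μ)
    set D := D0 + 1 with hD
    have hDpos : 1 ≤ D := by omega
    have hμ0 : 0 < μ := hpos
    have hDμ : 2 * C < D * μ := by
      rw [div_lt_iff₀ hμ0] at hD0
      refine hD0.trans_le ?_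
      have : (D0 : ℝ) ≤ D := by exact_mod_cast Nat.le_succ D0
      gcongr
    obtain ⟨n, hn⟩ := (hC D hDpos).exists
    refine ⟨(D, n), hDpos, ?_⟩
    obtain ⟨he, -⟩ := hn _ _ le_rfl (hX D)
    have hmem := henc.1 D hDpos n _ _ (hX D)
    unfold Ball.Mem at hmem
    have h1 := (Complex.abs_re_le_norm _).trans hmem
    rw [Complex.sub_re, toC_re, ← Complex.ofReal_natCast, Complex.re_ofReal_mul, abs_le] at h1
    rw [← @Int.cast_lt ℝ]
    push_cast
    have := h1.2
    linarith
  · rintro ⟨⟨D, n⟩, hD, hlt⟩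
    have hmem := henc.1 D hD n _ _ (hX D)
    unfold Ball.Mem at hmem
    have h1 := (Complex.abs_re_le_norm _).trans hmem
    rw [Complex.sub_re, toC_re, ← Complex.ofReal_natCast, Complex.re_ofReal_mul, abs_le] at h1
    rw [← @Int.cast_lt ℝ] at hlt
    push_cast at hlt
    have hDR : (0 : ℝ) < D := by exact_mod_cast hD
    have h2 : 0 < (D : ℝ) * (g.eval ((p.value : ℝ) : ℂ)).re := by linarith [h1.1]
    exact (mul_pos_iff_of_pos_left hDR).1 h2

end Tests

end PEFIsolation

namespace PEFIsolation
open Encodable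

/-! ### A Liouville bound, and the zero test for algebraic numbers -/

section Liouville

/-- The product of the nonzero numerators in a list of rational codes, up to sign; a numerator `0`
contributes a factor `1`. -/
def numProd (l : List RatCode) : ℕ := (l.map fun q => q.1.natAbs + (1 - q.1.natAbs)).prod

/-- The sum of the absolute values of the numerators in a list of rational codes. -/
def numSum (l : List RatCode) : ℕ := (l.map fun q => q.1.natAbs).sum

/-- A natural number that bounds the conjugates of the number with the given code and is a
denominator of it. The first two factors give a multiple of the leading coefficient of an integral
multiple of the polynomial, hence a denominator; the last factor is Cauchy's bound of the roots. -/
def codeHeight (c : AlgCode) : ℕ :=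
  denProd c.1 * numProd c.1 * (denProd c.1 * (numSum c.1 + 1))

theorem numProd_pos (l : List RatCode) : 1 ≤ numProd l := by
  induction l with
  | nil => simp [numProd]
  | cons q l ih =>
    have : numProd (q :: l) = (q.1.natAbs + (1 - q.1.natAbs)) * numProd l := by simp [numProd]
    rw [this]
    exact Nat.mul_pos (by omega) ih

theorem codeHeight_pos (c : AlgCode) : 1 ≤ codeHeight c :=
  Nat.mul_pos (Nat.mul_pos (denProd_pos _) (numProd_pos _))
    (Nat.mul_pos (denProd_pos _) (Nat.succ_pos _))

theorem map_polyOfCoeffs {R S : Type} [CommSemiring R] [CommSemiring S] (f : R →+* S)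
    (l : List R) : (polyOfCoeffs l).map f = polyOfCoeffs (l.map f) := by
  induction l with
  | nil => simp [polyOfCoeffs_nil]
  | cons a l ih =>
    rw [List.map_cons, polyOfCoeffs_cons, polyOfCoeffs_cons, Polynomial.map_add,
      Polynomial.map_mul, map_C, map_X, ih]

theorem polyOfCoeffs_smul {R : Type} [CommSemiring R] (a : R) (l : List R) :
    polyOfCoeffs (l.map fun x => a * x) = C a * polyOfCoeffs l := by
  induction l with
  | nil => simp [polyOfCoeffs_nil]
  | cons b l ih =>
    rw [List.map_cons, polyOfCoeffs_cons, polyOfCoeffs_cons, ih, C_mul]; ring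

theorem isIntegral_codeHeight_mul {c : AlgCode} (hc : c.Valid) :
    IsIntegral ℤ ((codeHeight c : ℂ) * c.val) := by
  set d := denProd c.1 with hd
  set L : List ℤ := c.1.map fun q => q.1 * ((d / (q.2 + 1) : ℕ) : ℤ) with hL
  have hmap : (polyOfCoeffs L).map (Int.castRingHom ℚ) = C (d : ℚ) * c.poly := by
    rw [map_polyOfCoeffs, AlgCode.poly, ← polyOfCoeffs_smul, hL, List.map_map, List.map_map]
    congr 1
    refine List.map_congr_left fun q hq => ?_
    have h1 : q.2 + 1 ∣ d := dvd_denProd hq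
    simp only [Function.comp, RatCode.value, eq_intCast, Int.cast_mul, Int.cast_natCast]
    rw [Nat.cast_div h1 (by exact_mod_cast Nat.succ_ne_zero q.2)]
    push_cast
    field_simp
  have hd0 : (d : ℚ) ≠ 0 := by
    have := denProd_pos c.1
    exact_mod_cast (by omega : d ≠ 0)
  have hne : polyOfCoeffs L ≠ 0 := by
    intro h
    rw [h, Polynomial.map_zero] at hmap
    exact mul_ne_zero (C_ne_zero.2 hd0) hc.poly_ne_zero hmap.symm
  have hroot : aeval c.val (polyOfCoeffs L) = 0 := by
    have h1 : aeval c.val ((polyOfCoeffs L).map (Int.castRingHom ℚ))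
        = aeval c.val (polyOfCoeffs L) := aeval_map_algebraMap ℚ c.val (polyOfCoeffs L)
    rw [← h1, hmap, map_mul, hc.aeval_val, mul_zero]
  have hint := isIntegral_leadingCoeff_smul (polyOfCoeffs L) c.val hroot
  have hmem := coeff_polyOfCoeffs_mem L _ (leadingCoeff_ne_zero.2 hne)
  have hlead := leadingCoeff_ne_zero.2 hne
  rw [leadingCoeff] at hint hlead
  set a := (polyOfCoeffs L).coeff (polyOfCoeffs L).natDegree
  obtain ⟨q, hq, hqa⟩ := List.mem_map.1 hmem
  have hq0 : q.1 ≠ 0 := by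
    rintro h
    rw [h, zero_mul] at hqa
    exact hlead hqa.symm
  have hdvd : a ∣ (codeHeight c : ℤ) := by
    rw [← hqa]
    have h1 : ((d / (q.2 + 1) : ℕ) : ℤ) ∣ d := by
      exact_mod_cast Nat.div_dvd_of_dvd (dvd_denProd hq)
    have h2 : q.1 ∣ (numProd c.1 : ℤ) := by
      have h3 : q.1.natAbs + (1 - q.1.natAbs) ∣ numProd c.1 :=
        List.dvd_prod (List.mem_map_of_mem (f := fun q : RatCode => q.1.natAbs + (1 - q.1.natAbs)) hq)
      have h4 : q.1.natAbs + (1 - q.1.natAbs) = q.1.natAbs := by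
        have := Int.natAbs_pos.2 hq0
        omega
      rw [h4] at h3
      exact Int.natAbs_dvd.1 (by exact_mod_cast h3)
    have h3 : q.1 * ((d / (q.2 + 1) : ℕ) : ℤ) ∣ (numProd c.1 : ℤ) * d := mul_dvd_mul h2 h1
    refine h3.trans ⟨(d * (numSum c.1 + 1) : ℕ), ?_⟩
    rw [codeHeight]
    push_cast
    ring
  obtain ⟨k, hk⟩ := hdvd
  have h5 : ((codeHeight c : ℂ) * c.val) = (k : ℤ) • (a • c.val) := by
    rw [zsmul_eq_mul, zsmul_eq_mul, ← mul_assoc]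
    congr 1
    have : ((codeHeight c : ℤ) : ℂ) = ((a * k : ℤ) : ℂ) := by rw [hk]
    push_cast at this
    rw [this, mul_comm]
  rw [h5]
  exact hint.smul k

theorem norm_le_codeHeight {c : AlgCode} (hc : c.Valid) {β : ℂ} (hβ : aeval β c.poly = 0) :
    ‖β‖ ≤ codeHeight c := by
  set P := c.poly.map (algebraMap ℚ ℂ) with hP
  have hP0 : P ≠ 0 := by
    rw [hP, Polynomial.map_ne_zero_iff (algebraMap ℚ ℂ).injective]; exact hc.poly_ne_zero
  have hroot : P.IsRoot β := by rwa [IsRoot.def, hP, eval_map_algebraMap]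
  have h1 : ‖β‖ < P.cauchyBound := by exact_mod_cast hroot.norm_lt_cauchyBound hP0
  have hl := one_le_denProd_mul_abs_leadingCoeff c.1 hc.poly_ne_zero
  have hlead : ‖P.leadingCoeff‖ = |(c.poly.leadingCoeff : ℝ)| := by
    rw [hP, leadingCoeff_map]; simp
  have hd := denProd_pos c.1
  have hdR : (0 : ℝ) < denProd c.1 := by exact_mod_cast hd
  have hsup : (((Finset.range P.natDegree).sup fun x => ‖P.coeff x‖₊ : NNReal) : ℝ)
      ≤ numSum c.1 := by
    have : ((Finset.range P.natDegree).sup fun x => ‖P.coeff x‖₊) ≤ (numSum c.1 : NNReal) := by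
      refine Finset.sup_le fun i _ => ?_
      rw [← NNReal.coe_le_coe, coe_nnnorm, NNReal.coe_natCast, hP, coeff_map]
      by_cases h0 : c.poly.coeff i = 0
      · rw [h0, map_zero, norm_zero]; positivity
      obtain ⟨q, hq, hqa⟩ := List.mem_map.1 (coeff_polyOfCoeffs_mem _ _ h0)
      have : c.poly.coeff i = q.value := hqa.symm
      rw [this]
      have h2 : ((q.1.natAbs : ℕ) : ℝ) ≤ numSum c.1 := by
        exact_mod_cast List.le_sum_of_mem
          (List.mem_map_of_mem (f := fun q : RatCode => q.1.natAbs) hq)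
      refine le_trans ?_ h2
      simp only [RatCode.value, eq_ratCast]
      push_cast [Nat.cast_natAbs]
      rw [norm_div, Complex.norm_intCast]
      refine div_le_self (abs_nonneg _) ?_
      rw [show ((q.2 : ℂ) + 1) = ((q.2 + 1 : ℕ) : ℂ) by push_cast; rfl, Complex.norm_natCast]
      exact_mod_cast Nat.succ_le_succ (Nat.zero_le _)
    exact_mod_cast this
  have h2 : (P.cauchyBound : ℝ) ≤ denProd c.1 * (numSum c.1 + 1) := by
    rw [cauchyBound]
    push_cast
    rw [hlead]
    have hlp : 0 < |(c.poly.leadingCoeff : ℝ)| := by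
      rw [abs_pos]; exact_mod_cast leadingCoeff_ne_zero.2 hc.poly_ne_zero
    have h3 : (((Finset.range P.natDegree).sup fun x => ‖P.coeff x‖₊ : NNReal) : ℝ) /
        |(c.poly.leadingCoeff : ℝ)| ≤ numSum c.1 * denProd c.1 := by
      rw [div_le_iff₀ hlp]
      calc (((Finset.range P.natDegree).sup fun x => ‖P.coeff x‖₊ : NNReal) : ℝ)
          ≤ numSum c.1 * 1 := by rw [mul_one]; exact hsup
        _ ≤ numSum c.1 * (denProd c.1 * |(c.poly.leadingCoeff : ℝ)|) := by
            gcongr; exact hl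
        _ = _ := by ring
    have h4 : (1 : ℝ) ≤ denProd c.1 := by exact_mod_cast hd
    linarith
  have h3 : (denProd c.1 * (numSum c.1 + 1) : ℝ) ≤ codeHeight c := by
    have : denProd c.1 * (numSum c.1 + 1) ≤ codeHeight c :=
      Nat.le_mul_of_pos_left _ (Nat.mul_pos (denProd_pos _) (numProd_pos _))
    exact_mod_cast this
  exact (h1.le.trans h2).trans h3

theorem finrank_adjoin_le {cs : List AlgCode} (h : ∀ c ∈ cs, c.Valid) :
    Module.finrank ℚ (IntermediateField.adjoin ℚ {x | ∃ c ∈ cs, AlgCode.val c = x})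
      ≤ (cs.map fun c => c.1.length).prod := by
  induction cs with
  | nil =>
    have : {x | ∃ c ∈ ([] : List AlgCode), AlgCode.val c = x} = ∅ := by ext; simp
    rw [this, IntermediateField.adjoin_empty, IntermediateField.finrank_bot]
    simp
  | cons c cs ih =>
    have : {x | ∃ d ∈ c :: cs, AlgCode.val d = x}
        = {c.val} ∪ {x | ∃ d ∈ cs, AlgCode.val d = x} := by
      ext x
      simp [eq_comm]
    rw [this, IntermediateField.adjoin_union]
    refine (IntermediateField.finrank_sup_le _ _).trans ?_
    rw [List.map_cons, List.prod_cons]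
    have hc := h c (by simp)
    refine Nat.mul_le_mul ?_ (ih fun d hd => h d (by simp [hd]))
    rw [IntermediateField.adjoin.finrank hc.isAlgebraic.isIntegral]
    refine (natDegree_le_of_dvd (minpoly.dvd ℚ _ hc.aeval_val) hc.poly_ne_zero).trans ?_
    exact (natDegree_polyOfCoeffs_le _).trans (by simp)

/-- The value of an integer polynomial in codes under an arbitrary assignment. -/
def ZPoly.valIn {F : Type} [CommRing F] (f : AlgCode → F) (E : ZPoly) : F :=
  (E.map fun m => (m.1 : F) * (m.2.map f).prod).sum

theorem ZPoly.val_eq_valIn (E : ZPoly) : E.val = E.valIn AlgCode.val := rfl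

theorem ZPoly.map_valIn {F F' : Type} [CommRing F] [CommRing F'] (f : AlgCode → F)
    (φ : F →+* F') (E : ZPoly) : φ (E.valIn f) = E.valIn fun c => φ (f c) := by
  simp only [ZPoly.valIn, map_list_sum, List.map_map]
  congr 1
  refine List.map_congr_left fun m _ => ?_
  simp only [Function.comp, map_mul, map_intCast, map_list_prod, List.map_map]
  rfl

theorem ZPoly.valIn_congr {F : Type} [CommRing F] {f g : AlgCode → F} {E : ZPoly}
    (h : ∀ c ∈ E.atoms, f c = g c) : E.valIn f = E.valIn g := by
  simp only [ZPoly.valIn]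
  congr 1
  refine List.map_congr_left fun m hm => ?_
  congr 2
  exact List.map_congr_left fun c hc => h c (List.mem_flatMap.2 ⟨m, hm, hc⟩)

/-- The product of the heights of the codes in an integer polynomial. -/
def zHeight (E : ZPoly) : ℕ := (E.atoms.map codeHeight).prod

/-- The sum of the absolute values of the coefficients. -/
def zLength (E : ZPoly) : ℕ := (E.map fun m => m.1.natAbs).sum

/-- A natural number whose inverse bounds the nonzero value of an integer polynomial in codes from
below. -/
def zBound (E : ZPoly) : ℕ :=
  (zHeight E * zHeight E * (zLength E + 1)) ^ (E.atoms.map fun c => c.1.length).prod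

theorem prod_pos_of_forall_pos (l : List ℕ) (h : ∀ n ∈ l, 1 ≤ n) : 1 ≤ l.prod :=
  Nat.one_le_iff_ne_zero.2 (List.prod_ne_zero fun h0 => by simpa using h 0 h0)

theorem zHeight_pos (E : ZPoly) : 1 ≤ zHeight E :=
  prod_pos_of_forall_pos _ fun n hn => by
    obtain ⟨c, _, rfl⟩ := List.mem_map.1 hn
    exact codeHeight_pos c

theorem norm_valIn_le (f : AlgCode → ℂ) (E : ZPoly) (h : ∀ c ∈ E.atoms, ‖f c‖ ≤ codeHeight c) :
    ‖E.valIn f‖ ≤ zLength E * zHeight E := by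
  induction E with
  | nil => simp [ZPoly.valIn, zLength]
  | cons m E ih =>
    have e1 : ZPoly.valIn f (m :: E) = (m.1 : ℂ) * (m.2.map f).prod + ZPoly.valIn f E := by
      simp [ZPoly.valIn]
    have e2 : zLength (m :: E) = m.1.natAbs + zLength E := by simp [zLength]
    have e3 : ZPoly.atoms (m :: E) = m.2 ++ ZPoly.atoms E := by simp [ZPoly.atoms]
    have e4 : zHeight (m :: E) = (m.2.map codeHeight).prod * zHeight E := by
      simp [zHeight, e3]
    have h1 : ∀ l : List AlgCode, (∀ c ∈ l, ‖f c‖ ≤ codeHeight c) →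
        ‖(l.map f).prod‖ ≤ ((l.map codeHeight).prod : ℕ) := by
      intro l
      induction l with
      | nil => simp
      | cons c l ih =>
        intro hl
        rw [List.map_cons, List.map_cons, List.prod_cons, List.prod_cons, norm_mul]
        push_cast
        have h2 := hl c (by simp)
        have h3 := ih fun d hd => hl d (by simp [hd])
        gcongr
        exact_mod_cast h3
    have h2 := h1 m.2 fun c hc => h c (by rw [e3]; exact List.mem_append_left _ hc)
    have h3 := ih fun c hc => h c (by rw [e3]; exact List.mem_append_right _ hc)
    have h4 : (1 : ℝ) ≤ (((m.2.map codeHeight).prod : ℕ) : ℝ) := by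
      exact_mod_cast prod_pos_of_forall_pos _ fun n hn => by
        obtain ⟨c, _, rfl⟩ := List.mem_map.1 hn
        exact codeHeight_pos c
    have h5 : (1 : ℝ) ≤ zHeight E := by exact_mod_cast zHeight_pos E
    rw [e1, e2, e4]
    refine (norm_add_le _ _).trans ?_
    rw [norm_mul, Complex.norm_intCast]
    set A : ℝ := (((m.2.map codeHeight).prod : ℕ) : ℝ) with hA
    have e5 : ((m.1.natAbs : ℕ) : ℝ) = |(m.1 : ℝ)| := by push_cast [Nat.cast_natAbs]; rfl
    rw [Nat.cast_add, Nat.cast_mul, e5, ← hA, add_mul]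
    have h6 : |(m.1 : ℝ)| * ‖(m.2.map f).prod‖ ≤ |(m.1 : ℝ)| * (A * zHeight E) := by
      gcongr
      exact h2.trans (le_mul_of_one_le_right (by linarith) h5)
    have h7 : (zLength E : ℝ) * zHeight E ≤ zLength E * (A * zHeight E) := by
      gcongr
      exact le_mul_of_one_le_left (by linarith) h4
    exact add_le_add h6 (h3.trans h7)

theorem isIntegral_zHeight_mul (f : AlgCode → ℂ) (E : ZPoly)
    (h : ∀ c ∈ E.atoms, IsIntegral ℤ ((codeHeight c : ℂ) * f c)) :
    IsIntegral ℤ ((zHeight E : ℂ) * E.valIn f) := by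
  induction E with
  | nil => simpa [ZPoly.valIn] using isIntegral_zero
  | cons m E ih =>
    have e1 : ZPoly.valIn f (m :: E) = (m.1 : ℂ) * (m.2.map f).prod + ZPoly.valIn f E := by
      simp [ZPoly.valIn]
    have e3 : ZPoly.atoms (m :: E) = m.2 ++ ZPoly.atoms E := by simp [ZPoly.atoms]
    have e4 : zHeight (m :: E) = (m.2.map codeHeight).prod * zHeight E := by
      simp [zHeight, e3]
    have h1 : ∀ l : List AlgCode, (∀ c ∈ l, IsIntegral ℤ ((codeHeight c : ℂ) * f c)) →
        IsIntegral ℤ (((l.map codeHeight).prod : ℕ) * (l.map f).prod) := by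
      intro l
      induction l with
      | nil => intro _; simpa using isIntegral_one
      | cons c l ih =>
        intro hl
        rw [List.map_cons, List.map_cons, List.prod_cons, List.prod_cons]
        have h2 := hl c (by simp)
        have h3 := ih fun d hd => hl d (by simp [hd])
        rw [Nat.cast_mul, mul_mul_mul_comm]
        exact h2.mul h3
    have h2 := h1 m.2 fun c hc => h c (by rw [e3]; exact List.mem_append_left _ hc)
    have h3 := ih fun c hc => h c (by rw [e3]; exact List.mem_append_right _ hc)
    have hnat : ∀ n : ℕ, IsIntegral ℤ (n : ℂ) := fun n => by
      simpa using isIntegral_algebraMap (R := ℤ) (A := ℂ) (x := (n : ℤ))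
    have hint : ∀ n : ℤ, IsIntegral ℤ (n : ℂ) := fun n => by
      simpa using isIntegral_algebraMap (R := ℤ) (A := ℂ) (x := n)
    have h4 := ((hnat (zHeight E)).mul ((hint m.1).mul h2)).add
      ((hnat (m.2.map codeHeight).prod).mul h3)
    rw [e1, e4, Nat.cast_mul]
    generalize ((m.2.map codeHeight).prod : ℂ) = A at h4 ⊢
    have h5 : A * (zHeight E : ℂ) * ((m.1 : ℂ) * (m.2.map f).prod + ZPoly.valIn f E)
        = (zHeight E : ℂ) * ((m.1 : ℂ) * (A * (m.2.map f).prod))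
          + A * ((zHeight E : ℂ) * ZPoly.valIn f E) := by ring
    rw [h5]
    exact h4

/-- The norm of a nonzero algebraic integer is a nonzero integer, so a bound of all conjugates
bounds each of them from below. -/
theorem one_le_norm_embedding_mul_pow {K : Type} [Field K] [Algebra ℚ K] [FiniteDimensional ℚ K]
    (τ : K →ₐ[ℚ] ℂ) {y : K} (hy : IsIntegral ℤ y) (hy0 : y ≠ 0) {W : ℝ}
    (hbound : ∀ σ : K →+* ℂ, ‖σ y‖ ≤ W) :
    1 ≤ ‖τ y‖ * W ^ (Module.finrank ℚ K - 1) := by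
  classical
  obtain ⟨N, hN⟩ := IsIntegrallyClosed.isIntegral_iff.1 (Algebra.isIntegral_norm ℚ hy)
  have hN0 : N ≠ 0 := by
    rintro rfl
    rw [map_zero] at hN
    exact hy0 (Algebra.norm_eq_zero_iff.1 hN.symm)
  have hprod := Algebra.norm_eq_prod_embeddings ℚ ℂ y
  rw [← hN] at hprod
  have h1 : (1 : ℝ) ≤ ∏ σ : K →ₐ[ℚ] ℂ, ‖σ y‖ := by
    rw [← norm_prod, ← hprod]
    simp only [eq_intCast, map_intCast, Complex.norm_intCast]
    exact_mod_cast Int.one_le_abs hN0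
  rw [← Finset.mul_prod_erase Finset.univ (fun σ : K →ₐ[ℚ] ℂ => ‖σ y‖) (Finset.mem_univ τ)] at h1
  refine h1.trans (mul_le_mul_of_nonneg_left ?_ (norm_nonneg _))
  refine (Finset.prod_le_prod (fun _ _ => norm_nonneg _) fun σ _ => hbound σ.toRingHom).trans ?_
  rw [Finset.prod_const, Finset.card_erase_of_mem (Finset.mem_univ _), Finset.card_univ,
    AlgHom.card ℚ K ℂ]

/-- The Liouville bound: the norm of a nonzero algebraic integer is a nonzero integer, and all of
its conjugates are bounded. -/
theorem one_le_norm_mul_zBound {E : ZPoly} (hE : ∀ c ∈ E.atoms, c.Valid) (h0 : E.val ≠ 0) :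
    1 ≤ ‖E.val‖ * zBound E := by
  classical
  set K := IntermediateField.adjoin ℚ {x | ∃ c ∈ E.atoms, AlgCode.val c = x} with hK
  have hfin : Finite {x | ∃ c ∈ E.atoms, AlgCode.val c = x} := by
    have : {x | ∃ c ∈ E.atoms, AlgCode.val c = x} = AlgCode.val '' {c | c ∈ E.atoms} := by
      ext; simp
    rw [this]
    exact Set.Finite.image _ (List.finite_toSet _)
  have hfd : FiniteDimensional ℚ K := IntermediateField.finiteDimensional_adjoin (by
    rintro x ⟨c, hc, rfl⟩
    exact (hE c hc).isAlgebraic.isIntegral)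
  let f : AlgCode → K := fun c => if h : c.val ∈ K then ⟨c.val, h⟩ else 0
  have hf : ∀ c ∈ E.atoms, ((f c : K) : ℂ) = c.val := by
    intro c hc
    have : c.val ∈ K := IntermediateField.subset_adjoin ℚ _ ⟨c, hc, rfl⟩
    simp only [f, dif_pos this]
  have hσ : ∀ σ : K →+* ℂ, ∀ c ∈ E.atoms, ‖σ (f c)‖ ≤ codeHeight c := by
    intro σ c hc
    refine norm_le_codeHeight (hE c hc) ?_
    have h1 : aeval (f c) c.poly = 0 := by
      have h2 : ((aeval (f c) c.poly : K) : ℂ) = aeval ((f c : K) : ℂ) c.poly :=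
        (aeval_algHom_apply K.val (f c) c.poly).symm
      rw [hf c hc, (hE c hc).aeval_val] at h2
      exact Subtype.ext h2
    have h2 : aeval (σ.toRatAlgHom (f c)) c.poly = σ.toRatAlgHom (aeval (f c) c.poly) :=
      aeval_algHom_apply _ _ _
    exact h2.trans (by rw [h1, map_zero])
  set x : K := E.valIn f with hx
  have hxE : (x : ℂ) = E.val := by
    have h1 : K.val.toRingHom x = E.valIn fun c => K.val.toRingHom (f c) :=
      ZPoly.map_valIn f K.val.toRingHom E
    exact h1.trans (ZPoly.valIn_congr fun c hc => hf c hc)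
  set y : K := (zHeight E : K) * x with hy
  have hyint : IsIntegral ℤ y := by
    have h1 : IsIntegral ℤ ((y : K) : ℂ) := by
      have := isIntegral_zHeight_mul AlgCode.val E fun c hc => isIntegral_codeHeight_mul (hE c hc)
      rw [← ZPoly.val_eq_valIn, ← hxE] at this
      simpa [hy] using this
    exact (isIntegral_algHom_iff (K.val.restrictScalars ℤ) K.val.injective).1 h1
  have hG := zHeight_pos E
  have hGR : (1 : ℝ) ≤ zHeight E := by exact_mod_cast hG
  have hy0 : y ≠ 0 := by
    refine mul_ne_zero ?_ ?_
    · have : zHeight E ≠ 0 := by omega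
      exact_mod_cast this
    · intro h
      apply h0
      rw [← hxE, h]
      rfl
  set W : ℝ := zHeight E * zHeight E * (zLength E + 1) with hW
  have hW1 : 1 ≤ W := by
    have : (0 : ℝ) ≤ zLength E := by positivity
    nlinarith
  have hbound : ∀ σ : K →+* ℂ, ‖σ y‖ ≤ W := by
    intro σ
    rw [hy, map_mul, map_natCast, norm_mul, Complex.norm_natCast]
    have h3 : ‖σ x‖ ≤ zLength E * zHeight E := by
      have := norm_valIn_le (fun c => σ (f c)) E (hσ σ)
      rwa [← ZPoly.map_valIn f σ E] at this
    calc (zHeight E : ℝ) * ‖σ x‖ ≤ zHeight E * (zLength E * zHeight E) := by gcongr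
      _ ≤ W := by rw [hW]; nlinarith
  have h1 := one_le_norm_embedding_mul_pow K.val hyint hy0 hbound
  have hcard : Module.finrank ℚ K ≤ (E.atoms.map fun c => c.1.length).prod :=
    finrank_adjoin_le hE
  have hpos : 0 < Module.finrank ℚ K := Module.finrank_pos
  have hval : ‖K.val y‖ = zHeight E * ‖E.val‖ := by
    rw [← hxE, hy]; simp
  have hGW : (zHeight E : ℝ) ≤ W := by
    have : (0 : ℝ) ≤ zLength E := by positivity
    rw [hW]
    nlinarith
  rw [hval] at h1
  calc (1 : ℝ) ≤ zHeight E * ‖E.val‖ * W ^ (Module.finrank ℚ K - 1) := h1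
    _ ≤ W * ‖E.val‖ * W ^ (Module.finrank ℚ K - 1) := by gcongr
    _ = ‖E.val‖ * W ^ (Module.finrank ℚ K - 1 + 1) := by ring
    _ ≤ ‖E.val‖ * W ^ (E.atoms.map fun c => c.1.length).prod := by
        gcongr
        omega
    _ = ‖E.val‖ * zBound E := by rw [zBound]; push_cast; rfl

section

variable {α : Type} [Primcodable α]

@[fun_prop] theorem primrec_list_prod {f : α → List ℕ} (hf : Primrec f) :
    Primrec (fun a => (f a).prod) := by
  have : Primrec (fun a => (f a).foldr (fun x y => x * y) 1) := by fun_prop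
  exact this.of_eq fun a => by rw [List.prod_eq_foldr]

@[fun_prop] theorem primrec_list_sum {f : α → List ℕ} (hf : Primrec f) :
    Primrec (fun a => (f a).sum) := by
  have : Primrec (fun a => (f a).foldr (fun x y => x + y) 0) := by fun_prop
  exact this.of_eq fun a => by rw [List.sum_eq_foldr]

@[fun_prop] theorem primrec_codeHeight {f : α → AlgCode} (hf : Primrec f) :
    Primrec (fun a => codeHeight (f a)) := by
  unfold codeHeight denProd numProd numSum; fun_prop

@[fun_prop] theorem primrec_zBound {f : α → ZPoly} (hf : Primrec f) :
    Primrec (fun a => zBound (f a)) := by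
  unfold zBound zHeight zLength ZPoly.atoms; fun_prop

end

/-- Equality with zero is semidecidable for algebraic numbers: a number below the Liouville bound
is zero. -/
theorem semiDec_zpoly_zero :
    SemiDec (fun E : ZPoly => ∀ c ∈ E.atoms, c.Valid) (fun E => E.val = 0) := by
  have h := SemiDec.exists_decode (β := ℕ × ℕ) (S := fun E : ZPoly => ∀ c ∈ E.atoms, c.Valid)
    (SemiDec.of_bool (c := fun y : ZPoly × (ℕ × ℕ) => Nat.ble 1 y.2.1 &&
      Nat.ble ((gAbs (zBall y.1 y.2.1 y.2.2).1 + (zBall y.1 y.2.1 y.2.2).2) * zBound y.1 + 1) y.2.1)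
      (by fun_prop))
  refine h.congr fun E hE => ?_
  have henc := Encloses.zpoly hE
  simp only [Bool.and_eq_true, ble_iff, Nat.succ_le_iff]
  constructor
  · intro h0
    obtain ⟨C, hC⟩ := henc.2 0
    obtain ⟨D0, hD0⟩ := exists_nat_gt (3 * C * zBound E)
    set D := D0 + 1 with hD
    have hDpos : 0 < D := by omega
    obtain ⟨n, hn⟩ := (hC D hDpos).exists
    have h1 := hn 0 0 (by simp) (by simp)
    have hmem := henc.1 D hDpos n 0 0 (by simp)
    refine ⟨(D, n), hDpos, ?_⟩
    simp only [Ball.Mem, h0, mul_zero, zero_sub, norm_neg] at hmem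
    have h2 := gAbs_le (zBall E D n).1
    have h3 : ((gAbs (zBall E D n).1 + (zBall E D n).2 : ℕ) : ℝ) ≤ 3 * C := by
      push_cast; linarith [h1.1]
    have h4 : (((gAbs (zBall E D n).1 + (zBall E D n).2) * zBound E : ℕ) : ℝ) < D := by
      rw [Nat.cast_mul]
      calc ((gAbs (zBall E D n).1 + (zBall E D n).2 : ℕ) : ℝ) * zBound E
          ≤ 3 * C * zBound E := by gcongr
        _ < D0 := hD0
        _ ≤ D := by exact_mod_cast Nat.le_succ D0
    exact_mod_cast h4
  · rintro ⟨⟨D, n⟩, hD, hlt⟩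
    by_contra h0
    have h1 := one_le_norm_mul_zBound hE h0
    have hmem := henc.1 D hD n 0 0 (by simp)
    have hDR : (0 : ℝ) < D := by exact_mod_cast hD
    have h2 : (D : ℝ) * ‖E.val‖ ≤ (gAbs (zBall E D n).1 + (zBall E D n).2 : ℕ) := by
      have h3 : ‖(D : ℂ) * E.val‖ ≤ ‖(D : ℂ) * E.val - toC (zBall E D n).1‖ +
          ‖toC (zBall E D n).1‖ := by
        simpa using norm_add_le ((D : ℂ) * E.val - toC (zBall E D n).1) (toC (zBall E D n).1)
      rw [norm_mul, Complex.norm_natCast] at h3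
      unfold Ball.Mem at hmem
      have h4 := norm_toC_le (zBall E D n).1
      push_cast
      linarith
    have h3 : (((gAbs (zBall E D n).1 + (zBall E D n).2) * zBound E : ℕ) : ℝ) < D := by
      exact_mod_cast hlt
    rw [Nat.cast_mul] at h3
    have h4 : (D : ℝ) * 1 ≤ D * (‖E.val‖ * zBound E) := by gcongr
    have h5 : (D : ℝ) * ‖E.val‖ * zBound E ≤
        ((gAbs (zBall E D n).1 + (zBall E D n).2 : ℕ) : ℝ) * zBound E := by gcongr
    linarith

end Liouville

/-! ### The zero test for polynomial-exponential expressions -/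

section Identity

/-- The shift operator on sequences. -/
def shift : Module.End ℂ (ℕ → ℂ) := LinearMap.funLeft ℂ ℂ Nat.succ

theorem shift_apply (s : ℕ → ℂ) (j : ℕ) : shift s j = s (j + 1) := rfl

/-- A solution of a linear recurrence with vanishing initial terms vanishes. -/
theorem eq_zero_of_recurrence (ls : List ℂ) (s : ℕ → ℂ)
    (h : aeval shift ((ls.map fun a => X - C a).prod) s = 0) (h0 : ∀ j < ls.length, s j = 0) :
    s = 0 := by
  induction ls generalizing s with
  | nil => simpa using h
  | cons a ls ih =>
    have h1 : aeval shift (X - C a) s = 0 := by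
      refine ih _ ?_ ?_
      · rw [List.map_cons, List.prod_cons, mul_comm, map_mul] at h
        exact h
      · intro j hj
        have e1 := h0 (j + 1) (by simpa using hj)
        have e2 := h0 j (by simp; omega)
        simp [shift_apply, e1, e2]
    have h2 : ∀ j, s (j + 1) = a * s j := by
      intro j
      have := congrFun h1 j
      simp [shift_apply] at this
      exact sub_eq_zero.1 this
    funext j
    induction j with
    | zero => exact h0 0 (by simp)
    | succ j ihj => rw [h2, ihj]; simp

/-- The sequence of the derivatives at `0`. -/
noncomputable def jet (h : ℂ → ℂ) : ℕ → ℂ := fun j => iteratedDeriv j h 0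

theorem shift_jet (h : ℂ → ℂ) : shift (jet h) = jet (deriv h) := by
  funext j
  simp only [shift_apply, jet, iteratedDeriv_succ']

theorem jet_add {g h : ℂ → ℂ} (hg : ContDiff ℂ ⊤ g) (hh : ContDiff ℂ ⊤ h) :
    jet (fun z => g z + h z) = jet g + jet h := by
  funext j
  exact iteratedDeriv_fun_add (hg.of_le le_top).contDiffAt (hh.of_le le_top).contDiffAt

theorem jet_const_mul (c : ℂ) (h : ℂ → ℂ) : jet (fun z => c * h z) = c • jet h := by
  funext j
  exact iteratedDeriv_const_mul_field c h

theorem contDiff_pow_mul_exp (a : ℕ) (l : ℂ) :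
    ContDiff ℂ ⊤ fun z : ℂ => z ^ a * Complex.exp (l * z) := by fun_prop

theorem deriv_pow_mul_exp (a : ℕ) (l : ℂ) :
    deriv (fun z : ℂ => z ^ a * Complex.exp (l * z)) =
      fun z => a * (z ^ (a - 1) * Complex.exp (l * z)) + l * (z ^ a * Complex.exp (l * z)) := by
  funext z
  have h := (hasDerivAt_pow a z).mul (((hasDerivAt_id z).const_mul l).cexp)
  refine (show HasDerivAt (fun z : ℂ => z ^ a * Complex.exp (l * z)) _ z from h).deriv.trans ?_
  simp only [id]
  ring

/-- The differential operator `(d/dz - l) ^ (a + 1)` annihilates `z ^ a * exp (l * z)`. -/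
theorem aeval_shift_jet_pow_mul_exp (a : ℕ) (l : ℂ) :
    aeval shift ((X - C l) ^ (a + 1)) (jet fun z => z ^ a * Complex.exp (l * z)) = 0 := by
  have hstep : ∀ a : ℕ, aeval shift (X - C l) (jet fun z => z ^ a * Complex.exp (l * z))
      = (a : ℂ) • jet fun z => z ^ (a - 1) * Complex.exp (l * z) := by
    intro a
    have h1 : shift (jet fun z => z ^ a * Complex.exp (l * z))
        = (a : ℂ) • jet (fun z => z ^ (a - 1) * Complex.exp (l * z))
          + l • jet (fun z => z ^ a * Complex.exp (l * z)) := by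
      rw [shift_jet, deriv_pow_mul_exp, jet_add, jet_const_mul, jet_const_mul]
      · exact contDiff_const.mul (contDiff_pow_mul_exp _ _)
      · exact contDiff_const.mul (contDiff_pow_mul_exp _ _)
    rw [map_sub, aeval_X, aeval_C, LinearMap.sub_apply, h1, Module.algebraMap_end_apply,
      add_sub_cancel_right]
  induction a with
  | zero =>
    rw [zero_add, pow_one, hstep]
    simp
  | succ a ih =>
    rw [pow_succ, map_mul, Module.End.mul_apply, hstep, map_smul, Nat.add_sub_cancel, ih, smul_zero]

/-- The order of a linear differential equation that a polynomial-exponential expression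
satisfies. -/
def tOrder (g : Terms) : ℕ := g.foldr (fun m s => (m.2.1 + 1) + s) 0

theorem contDiff_eval (g : Terms) : ContDiff ℂ ⊤ g.eval := (differentiable_eval g).contDiff

theorem eval_eq_zero_of_jet (g : Terms)
    (h : ∀ j < tOrder g, (tDeriv^[j] g).eval 0 = 0) (t : ℂ) : g.eval t = 0 := by
  have key : ∀ g : Terms, ∃ ls : List ℂ, ls.length = tOrder g ∧
      aeval shift ((ls.map fun a => X - C a).prod) (jet g.eval) = 0 := by
    intro g
    induction g with
    | nil =>
      refine ⟨[], rfl, ?_⟩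
      have h1 : Terms.eval [] = fun _ => (0 : ℂ) := by ext; simp [Terms.eval, Terms.eval₂]
      have h2 : jet (Terms.eval []) = 0 := by
        funext j
        rw [h1]
        simp [jet]
      rw [h2, map_zero]
    | cons m g ih =>
      obtain ⟨ls, hlen, hls⟩ := ih
      refine ⟨List.replicate (m.2.1 + 1) m.2.2.val ++ ls, ?_, ?_⟩
      · rw [List.length_append, List.length_replicate, hlen]; rfl
      · have h1 : Terms.eval (m :: g) = fun t => m.1.val * (t ^ m.2.1 * Complex.exp (m.2.2.val * t))
            + Terms.eval g t := by
          ext t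
          rw [Terms.eval, Terms.eval₂_cons, termVal, mul_assoc]
          rfl
        rw [h1, jet_add (contDiff_const.mul (contDiff_pow_mul_exp _ _)) (contDiff_eval g),
          jet_const_mul, List.map_append, List.prod_append, List.map_replicate,
          List.prod_replicate, map_add, map_mul, Module.End.mul_apply, Module.End.mul_apply, hls,
          map_zero, add_zero, ← Module.End.mul_apply, ← map_mul, mul_comm, map_mul,
          Module.End.mul_apply, map_smul, aeval_shift_jet_pow_mul_exp, smul_zero, map_zero]
  obtain ⟨ls, hlen, hls⟩ := key g
  have h0 := eq_zero_of_recurrence ls (jet g.eval) hls fun j hj => by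
    rw [jet, iteratedDeriv_eval]
    exact h j (hlen ▸ hj)
  have h1 := Complex.taylorSeries_eq_of_entire' 0 t (differentiable_eval g)
  rw [← h1]
  have h2 : ∀ n, iteratedDeriv n g.eval 0 = 0 := fun n => congrFun h0 n
  simp [h2]

section

variable {α : Type} [Primcodable α]

@[fun_prop] theorem primrec_tOrder {f : α → Terms} (hf : Primrec f) :
    Primrec (fun a => tOrder (f a)) := by unfold tOrder; fun_prop

end

/-- Being identically zero is semidecidable: it amounts to finitely many equations between
algebraic numbers. -/
theorem semiDec_terms_zero : SemiDec Terms.Valid (fun g => ∀ t, g.eval t = 0) := by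
  have h := SemiDec.forall_mem (S := Terms.Valid) (β := ℕ) (l := fun g => List.range (tOrder g))
    (p := fun x => (tZero (tDeriv^[x.2] x.1)).val = 0) (by fun_prop)
    (semiDec_zpoly_zero.comp (g := fun x : Terms × ℕ => tZero (tDeriv^[x.2] x.1)) (by fun_prop)
      (fun x hx c hc => hx.1.iterate_tDeriv x.2 c (atoms_tZero hc)))
  refine h.congr fun g _ => ?_
  simp only [List.mem_range, val_tZero]
  constructor
  · intro h0 j _
    rw [← iteratedDeriv_eval]
    have : g.eval = fun _ => 0 := funext h0
    rw [this]
    simp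
  · exact fun h0 t => eval_eq_zero_of_jet g h0 t

end Identity

end PEFIsolation

namespace PEFIsolation
open Encodable

/-! ### The search for certificates -/

section Search

set_option synthInstance.maxSize 2000
set_option synthInstance.maxHeartbeats 200000

/-- The equality test of a type with decidable equality. -/
def eqTest {β : Type} [DecidableEq β] (x y : β) : Bool := decide (x = y)

theorem eqTest_iff {β : Type} [DecidableEq β] {x y : β} : eqTest x y = true ↔ x = y := by
  simp [eqTest]

@[fun_prop] theorem primrec_eqTest {α β : Type} [Primcodable α] [Primcodable β] [DecidableEq β]
    {f g : α → β} (hf : Primrec f) (hg : Primrec g) : Primrec (fun a => eqTest (f a) (g a)) :=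
  (Primrec.beq.comp hf hg).of_eq fun a => by by_cases h : f a = g a <;> simp [eqTest, h]

/-- The order of the rational numbers, on codes. -/
def ratLt (p q : RatCode) : Bool := intLt (p.1 * (q.2 + 1 : ℕ)) (q.1 * (p.2 + 1 : ℕ))

theorem ratLt_iff {p q : RatCode} : ratLt p q = true ↔ p.value < q.value := by
  have hp : (0 : ℚ) < (p.2 : ℚ) + 1 := by positivity
  have hq : (0 : ℚ) < (q.2 : ℚ) + 1 := by positivity
  rw [ratLt, intLt_iff, RatCode.value, RatCode.value, div_lt_div_iff₀ hp hq, ← @Int.cast_lt ℚ]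
  push_cast
  rfl

/-- The expression has no zero on the interval from `a` to `b`. -/
def NonzeroOn (g : Terms) (a b : RatCode) : Prop :=
  ∀ t : ℝ, (a.value : ℝ) ≤ t → t ≤ (b.value : ℝ) → g.eval t ≠ 0

/-- A condition for a zero at a rational number that can be confirmed by the algorithm. It requires
at a nonzero number that the expression with frozen polynomial coefficients vanishes identically. -/
def RatZero (g : Terms) (p : RatCode) : Prop :=
  (p.1 = 0 ∧ (tZero g).val = 0) ∨ ∀ t, (tFreeze g p).eval t = 0

/-- The function vanishes to order `w.1` at the rational number `w.2`, and its derivative of that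
order has no zero between `a` and `b`. -/
def OrderAt (f : Terms) (a b : RatCode) (w : ℕ × RatCode) : Prop :=
  ((a.value ≤ w.2.value ∧ w.2.value ≤ b.value) ∧ NonzeroOn (tDeriv^[w.1] f) a b) ∧
    ∀ j ∈ List.range w.1, RatZero (tDeriv^[j] f) w.2

/-- A certificate that there is no root between `a` and `b` except possibly at `l` and `r`. -/
def NoRoot (x : Terms × RatCode × RatCode) (a b : RatCode) : Prop :=
  ∃ w : ℕ × RatCode, (w.1 = 0 ∨ w.2 = x.2.1 ∨ w.2 = x.2.2) ∧ OrderAt x.1 a b w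

/-- An identity `f u = f' v` in which `u` has no zero makes all zeros of `f'` zeros of `f`, and so
excludes a second root. The signs of `f f'` at the endpoints give the existence of a root. -/
def DerivCert (f : Terms) (a b : RatCode) (w : Terms × Terms) : Prop :=
  (∀ c ∈ w.1.atoms ++ w.2.atoms, c ∈ f.atoms) ∧
    ((∀ t, Terms.eval (tMul f w.1 ++ tScale (-1) (tMul (tDeriv f) w.2)) t = 0) ∧
      NonzeroOn w.1 a b) ∧
    0 < ((tScale (-1) (tMul f (tDeriv f))).eval ((a.value : ℝ) : ℂ)).re ∧
    0 < ((tMul f (tDeriv f)).eval ((b.value : ℝ) : ℂ)).re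

/-- A certificate that there is exactly one root between `a` and `b`, and that it is neither `a` nor
`b`. -/
def OneRoot (f : Terms) (a b : RatCode) : Prop :=
  (∃ w : ℕ × RatCode, (0 < w.1 ∧ a.value < w.2.value ∧ w.2.value < b.value) ∧ OrderAt f a b w) ∨
    ∃ w : Terms × Terms, DerivCert f a b w

/-- A subdivision of an interval into pieces; each piece is marked by whether it is certified to
contain one root or none. -/
abbrev Subdivision : Type := List ((RatCode × RatCode) × Bool)

/-- The pieces that contain a root. -/
def Subdivision.output (M : Subdivision) : List (RatCode × RatCode) :=
  M.flatMap fun m => bif m.2 then [m.1] else []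

/-- The pieces of the subdivision are consecutive and certified. -/
def Subdivision.Certified (x : Terms × RatCode × RatCode) (M : Subdivision) : Prop :=
  M.map (fun m => m.1.1) ++ [x.2.2] = x.2.1 :: M.map (fun m => m.1.2) ∧
    ∀ m ∈ M, m.1.1.value < m.1.2.value ∧
      ((m.2 = true ∧ OneRoot x.1 m.1.1 m.1.2) ∨ (m.2 = false ∧ NoRoot x m.1.1 m.1.2))

/-- The list `L` is a certified result for the expression `x.1` and the interval from `x.2.1` to
`x.2.2`. -/
def CertifiedResult (x : Terms × RatCode × RatCode) (L : List (RatCode × RatCode)) : Prop :=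
  (x.2.2.value ≤ x.2.1.value ∧ L = []) ∨ ∃ M : Subdivision, M.output = L ∧ M.Certified x

section

variable {α : Type} [Primcodable α]

@[fun_prop] theorem primrec_ratLt {f g : α → RatCode} (hf : Primrec f) (hg : Primrec g) :
    Primrec (fun a => ratLt (f a) (g a)) := by unfold ratLt; fun_prop

@[fun_prop] theorem primrec_output {f : α → Subdivision} (hf : Primrec f) :
    Primrec (fun a => (f a).output) := by unfold Subdivision.output; fun_prop

end

theorem semiDec_nonzeroOn :
    SemiDec (fun x : Terms × RatCode × RatCode => x.1.Valid ∧ x.2.1.value ≤ x.2.2.value)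
      (fun x => NonzeroOn x.1 x.2.1 x.2.2) := semiDec_ne_zero

theorem semiDec_ratZero :
    SemiDec (fun x : Terms × RatCode => x.1.Valid) (fun x => RatZero x.1 x.2) := by
  refine SemiDec.or (SemiDec.and ?_ ?_) ?_
  · refine (SemiDec.of_bool (c := fun x : Terms × RatCode => x.2.1 == 0) (by fun_prop)).congr ?_
    intro x _
    simp
  · exact semiDec_zpoly_zero.comp (g := fun x : Terms × RatCode => tZero x.1) (by fun_prop)
      fun x hx c hc => hx.1 c (atoms_tZero hc)
  · exact semiDec_terms_zero.comp (g := fun x : Terms × RatCode => tFreeze x.1 x.2) (by fun_prop)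
      fun x hx => hx.tFreeze x.2

theorem semiDec_orderAt :
    SemiDec (fun y : (Terms × RatCode × RatCode) × (ℕ × RatCode) => y.1.1.Valid)
      (fun y => OrderAt y.1.1 y.1.2.1 y.1.2.2 y.2) := by
  refine SemiDec.and (SemiDec.and ?_ ?_) ?_
  · refine (SemiDec.of_bool (c := fun y : (Terms × RatCode × RatCode) × (ℕ × RatCode) =>
      !(ratLt y.2.2 y.1.2.1) && !(ratLt y.1.2.2 y.2.2)) (by fun_prop)).congr ?_
    intro y _
    simp only [Bool.and_eq_true, Bool.not_eq_true', ← Bool.not_eq_true, ratLt_iff, not_lt]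
  · exact semiDec_nonzeroOn.comp
      (g := fun y : (Terms × RatCode × RatCode) × (ℕ × RatCode) =>
        (tDeriv^[y.2.1] y.1.1, y.1.2.1, y.1.2.2)) (by fun_prop)
      fun y hy => ⟨hy.1.iterate_tDeriv _, hy.2.1.trans hy.2.2⟩
  · refine SemiDec.forall_mem (β := ℕ)
      (l := fun y : (Terms × RatCode × RatCode) × (ℕ × RatCode) => List.range y.2.1)
      (p := fun z => RatZero (tDeriv^[z.2] z.1.1.1) z.1.2.2) (by fun_prop) ?_
    exact semiDec_ratZero.comp
      (g := fun z : ((Terms × RatCode × RatCode) × (ℕ × RatCode)) × ℕ =>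
        (tDeriv^[z.2] z.1.1.1, z.1.2.2)) (by fun_prop)
      fun z hz => hz.1.1.iterate_tDeriv _

theorem semiDec_noRoot :
    SemiDec (fun y : (Terms × RatCode × RatCode) × (RatCode × RatCode) => y.1.1.Valid)
      (fun y => NoRoot y.1 y.2.1 y.2.2) := by
  refine SemiDec.exists_decode (p := fun z : ((Terms × RatCode × RatCode) × (RatCode × RatCode)) ×
    (ℕ × RatCode) => (z.2.1 = 0 ∨ z.2.2 = z.1.1.2.1 ∨ z.2.2 = z.1.1.2.2) ∧
      OrderAt z.1.1.1 z.1.2.1 z.1.2.2 z.2) (SemiDec.and ?_ ?_)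
  · refine (SemiDec.of_bool
      (c := fun z : ((Terms × RatCode × RatCode) × (RatCode × RatCode)) × (ℕ × RatCode) =>
        eqTest z.2.1 0 || (eqTest z.2.2 z.1.1.2.1 || eqTest z.2.2 z.1.1.2.2)) (by fun_prop)).congr ?_
    intro z _
    simp [eqTest_iff]
  · exact semiDec_orderAt.comp
      (g := fun z : ((Terms × RatCode × RatCode) × (RatCode × RatCode)) × (ℕ × RatCode) =>
        ((z.1.1.1, z.1.2), z.2)) (by fun_prop) fun z hz => hz.1

theorem semiDec_derivCert :
    SemiDec (fun y : (Terms × RatCode × RatCode) × (Terms × Terms) => y.1.1.Valid ∧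
      y.1.2.1.value ≤ y.1.2.2.value)
      (fun y => DerivCert y.1.1 y.1.2.1 y.1.2.2 y.2) := by
  refine SemiDec.and ?_ (SemiDec.and (SemiDec.and ?_ ?_) (SemiDec.and ?_ ?_))
  · refine (SemiDec.of_bool (c := fun y : (Terms × RatCode × RatCode) × (Terms × Terms) =>
      (y.2.1.atoms ++ y.2.2.atoms).foldr (fun c s => (y.1.1.atoms.foldr
        (fun d r => eqTest c d || r) false) && s) true) (by fun_prop)).congr ?_
    intro y _
    have h : ∀ (c : AlgCode) (l : List AlgCode),
        l.foldr (fun d r => eqTest c d || r) false = true ↔ c ∈ l := by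
      intro c l
      induction l with
      | nil => simp
      | cons d l ih => simp [ih, eqTest_iff]
    rw [foldr_and_iff]
    simp only [h]
  · refine semiDec_terms_zero.comp (g := fun y : (Terms × RatCode × RatCode) × (Terms × Terms) =>
      tMul y.1.1 y.2.1 ++ tScale (-1) (tMul (tDeriv y.1.1) y.2.2)) (by fun_prop) ?_
    rintro y ⟨⟨hy, -⟩, hc⟩
    exact (hy.tMul fun c h => hy c (hc c (List.mem_append_left _ h))).append
      ((hy.tDeriv.tMul fun c h => hy c (hc c (List.mem_append_right _ h))).tScale _)
  · refine semiDec_nonzeroOn.comp (g := fun y : (Terms × RatCode × RatCode) × (Terms × Terms) =>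
      (y.2.1, y.1.2)) (by fun_prop) ?_
    rintro y ⟨⟨⟨hy, hle⟩, hc⟩, -⟩
    exact ⟨fun c h => hy c (hc c (List.mem_append_left _ h)), hle⟩
  · exact semiDec_re_pos.comp (g := fun y : (Terms × RatCode × RatCode) × (Terms × Terms) =>
      (tScale (-1) (tMul y.1.1 (tDeriv y.1.1)), y.1.2.1)) (by fun_prop)
      fun y hy => (hy.1.1.1.tMul hy.1.1.1.tDeriv).tScale _
  · exact semiDec_re_pos.comp (g := fun y : (Terms × RatCode × RatCode) × (Terms × Terms) =>
      (tMul y.1.1 (tDeriv y.1.1), y.1.2.2)) (by fun_prop)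
      fun y hy => hy.1.1.1.1.tMul hy.1.1.1.1.tDeriv

theorem semiDec_oneRoot :
    SemiDec (fun y : Terms × RatCode × RatCode => y.1.Valid ∧ y.2.1.value ≤ y.2.2.value)
      (fun y => OneRoot y.1 y.2.1 y.2.2) := by
  refine SemiDec.or ?_ ?_
  · refine SemiDec.exists_decode (p := fun z : (Terms × RatCode × RatCode) × (ℕ × RatCode) =>
      (0 < z.2.1 ∧ z.1.2.1.value < z.2.2.value ∧ z.2.2.value < z.1.2.2.value) ∧
        OrderAt z.1.1 z.1.2.1 z.1.2.2 z.2) (SemiDec.and ?_ ?_)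
    · refine (SemiDec.of_bool (c := fun z : (Terms × RatCode × RatCode) × (ℕ × RatCode) =>
        Nat.ble 1 z.2.1 && (ratLt z.1.2.1 z.2.2 && ratLt z.2.2 z.1.2.2)) (by fun_prop)).congr ?_
      intro z _
      simp only [Bool.and_eq_true, ble_iff, ratLt_iff]
      rfl
    · exact semiDec_orderAt.mono fun z hz => hz.1.1
  · exact SemiDec.exists_decode (S := fun y : Terms × RatCode × RatCode => y.1.Valid ∧
      y.2.1.value ≤ y.2.2.value) (p := fun y : (Terms × RatCode × RatCode) × (Terms × Terms) =>
      DerivCert y.1.1 y.1.2.1 y.1.2.2 y.2) semiDec_derivCert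

theorem semiDec_certified :
    SemiDec (fun y : (Terms × RatCode × RatCode) × Subdivision => y.1.1.Valid)
      (fun y => y.2.Certified y.1) := by
  refine SemiDec.and ?_ ?_
  · refine (SemiDec.of_bool (c := fun y : (Terms × RatCode × RatCode) × Subdivision =>
      eqTest (y.2.map (fun m => m.1.1) ++ [y.1.2.2]) (y.1.2.1 :: y.2.map (fun m => m.1.2)))
      (by fun_prop)).congr ?_
    intro y _
    simp [eqTest_iff]
  · refine SemiDec.forall_mem (β := (RatCode × RatCode) × Bool)
      (l := fun y : (Terms × RatCode × RatCode) × Subdivision => y.2)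
      (p := fun z => z.2.1.1.value < z.2.1.2.value ∧
      ((z.2.2 = true ∧ OneRoot z.1.1.1 z.2.1.1 z.2.1.2) ∨
        (z.2.2 = false ∧ NoRoot z.1.1 z.2.1.1 z.2.1.2))) (by fun_prop) ?_
    refine SemiDec.and ?_ (SemiDec.or (SemiDec.and ?_ ?_) (SemiDec.and ?_ ?_))
    · exact (SemiDec.of_bool
        (c := fun z : ((Terms × RatCode × RatCode) × Subdivision) × ((RatCode × RatCode) × Bool) =>
          ratLt z.2.1.1 z.2.1.2) (by fun_prop)).congr fun z _ => ratLt_iff.symm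
    · exact SemiDec.of_bool
        (c := fun z : ((Terms × RatCode × RatCode) × Subdivision) × ((RatCode × RatCode) × Bool) =>
          z.2.2) (by fun_prop)
    · exact semiDec_oneRoot.comp
        (g := fun z : ((Terms × RatCode × RatCode) × Subdivision) × ((RatCode × RatCode) × Bool) =>
          (z.1.1.1, z.2.1)) (by fun_prop) fun z hz => ⟨hz.1.1.1.1, hz.1.2.le⟩
    · refine (SemiDec.of_bool
        (c := fun z : ((Terms × RatCode × RatCode) × Subdivision) × ((RatCode × RatCode) × Bool) =>
          !z.2.2) (by fun_prop)).congr fun z _ => ?_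
      simp
    · exact semiDec_noRoot.comp
        (g := fun z : ((Terms × RatCode × RatCode) × Subdivision) × ((RatCode × RatCode) × Bool) =>
          (z.1.1, z.2.1)) (by fun_prop) fun z hz => hz.1.1.1.1

theorem semiDec_certifiedResult :
    SemiDec (fun y : (Terms × RatCode × RatCode) × List (RatCode × RatCode) => y.1.1.Valid)
      (fun y => CertifiedResult y.1 y.2) := by
  refine SemiDec.or ?_ ?_
  · refine (SemiDec.of_bool
      (c := fun y : (Terms × RatCode × RatCode) × List (RatCode × RatCode) =>
        !(ratLt y.1.2.1 y.1.2.2) && eqTest y.2 []) (by fun_prop)).congr fun y _ => ?_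
    simp only [Bool.and_eq_true, Bool.not_eq_true', ← Bool.not_eq_true, ratLt_iff, not_lt,
      eqTest_iff]
  · refine SemiDec.exists_decode
      (p := fun z : ((Terms × RatCode × RatCode) × List (RatCode × RatCode)) × Subdivision =>
        z.2.output = z.1.2 ∧ z.2.Certified z.1.1) (SemiDec.and ?_ ?_)
    · refine (SemiDec.of_bool
        (c := fun z : ((Terms × RatCode × RatCode) × List (RatCode × RatCode)) × Subdivision =>
          eqTest z.2.output z.1.2) (by fun_prop)).congr fun z _ => ?_
      simp [eqTest_iff]
    · exact semiDec_certified.comp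
        (g := fun z : ((Terms × RatCode × RatCode) × List (RatCode × RatCode)) × Subdivision =>
          (z.1.1, z.2)) (by fun_prop) fun z hz => hz.1

end Search

/-! ### Expressions from codes -/

section Input

/-- The terms `a t ^ k exp (l t)` for the coefficients `a` of a polynomial. -/
def polyTerms (l : AlgCode) (p : PolyCode) : Terms :=
  p.foldr (fun a s => ([(1, [a])], 0, [(1, [l])]) :: s.map fun m => (m.1, m.2.1 + 1, m.2.2)) []

/-- The expression given by a code of a polynomial-exponential function. -/
def codeTerms (c : PEFCode) : Terms := c.flatMap fun d => polyTerms d.2 d.1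

theorem primrec_codeTerms : Primrec codeTerms := by
  unfold codeTerms polyTerms; fun_prop

theorem eval₂_map_succ (g : Terms) (s t : ℂ) :
    Terms.eval₂ (g.map fun m => (m.1, m.2.1 + 1, m.2.2)) s t = s * g.eval₂ s t := by
  induction g with
  | nil => simp [Terms.eval₂]
  | cons m g ih =>
    rw [List.map_cons, Terms.eval₂_cons, ih, Terms.eval₂_cons]
    simp only [termVal, pow_succ]
    ring

theorem val_atom (c : AlgCode) : ZPoly.val [(1, [c])] = c.val := by simp [ZPoly.val, monoVal]

theorem eval_polyTerms {l : AlgCode} {p : PolyCode} {μ : AlgNum} {q : List AlgNum}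
    (hl : l.Represents μ) (hp : List.Forall₂ AlgCode.Represents p q) (t : ℂ) :
    (polyTerms l p).eval t = aeval t (polyOfCoeffs q) * Complex.exp ((μ : ℂ) * t) := by
  induction hp with
  | nil => simp [polyTerms, Terms.eval, Terms.eval₂, polyOfCoeffs_nil]
  | @cons a b p q hab hpq ih =>
    have h : polyTerms l (a :: p) = ([(1, [a])], 0, [(1, [l])]) ::
      (polyTerms l p).map fun m => (m.1, m.2.1 + 1, m.2.2) := rfl
    rw [h, Terms.eval, Terms.eval₂_cons, eval₂_map_succ, ← Terms.eval, ih, polyOfCoeffs_cons]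
    simp only [termVal, val_atom, hl.val_eq, hab.val_eq, map_add, map_mul, aeval_C, aeval_X,
      pow_zero, mul_one, add_mul, mul_assoc]
    rfl

theorem valid_polyTerms {l : AlgCode} {p : PolyCode} (hl : l.Valid) (hp : ∀ a ∈ p, a.Valid) :
    (polyTerms l p).Valid := by
  induction p with
  | nil => intro c hc; simp [polyTerms, Terms.atoms] at hc
  | cons a p ih =>
    have h : polyTerms l (a :: p) = ([(1, [a])], 0, [(1, [l])]) ::
      (polyTerms l p).map fun m => (m.1, m.2.1 + 1, m.2.2) := rfl
    have h2 : ∀ g : Terms, Terms.atoms (g.map fun m => (m.1, m.2.1 + 1, m.2.2)) = g.atoms := by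
      intro g; simp [Terms.atoms, List.flatMap_map]
    intro c hc
    rw [h, Terms.atoms_cons, h2] at hc
    simp only [ZPoly.atoms, List.flatMap_cons, List.flatMap_nil, List.append_nil, List.mem_append,
      List.mem_singleton] at hc
    rcases hc with (rfl | rfl) | hc
    · exact hp _ (by simp)
    · exact hl
    · exact ih (fun b hb => hp b (by simp [hb])) c hc

theorem valid_and_eval_codeTerms {c : PEFCode} {f : PEF} (h : c.Represents f) :
    (codeTerms c).Valid ∧ ∀ t : ℝ, (codeTerms c).eval t = f.eval t := by
  unfold PEFCode.Represents at h
  induction h with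
  | nil =>
    refine ⟨fun c hc => by simp [codeTerms, Terms.atoms] at hc, fun t => ?_⟩
    simp [codeTerms, Terms.eval, Terms.eval₂, PEF.eval]
  | @cons d p c f hdp hcf ih =>
    obtain ⟨⟨q, hq, hpq⟩, hl⟩ := hdp
    have h1 : codeTerms (d :: c) = polyTerms d.2 d.1 ++ codeTerms c := by simp [codeTerms]
    rw [h1]
    refine ⟨(valid_polyTerms ⟨_, hl⟩ ?_).append ih.1, fun t => ?_⟩
    · intro a ha
      obtain ⟨i, hi, rfl⟩ := List.mem_iff_getElem.1 ha
      exact ⟨_, (List.forall₂_iff_get.1 hq).2 i hi ((List.forall₂_iff_get.1 hq).1 ▸ hi)⟩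
    · rw [Terms.eval_append, ih.2, eval_polyTerms hl hq, ← hpq]
      simp [PEF.eval]

end Input

end PEFIsolation

namespace PEFIsolation

/-! ### Soundness of the certificates -/

section Soundness

open Set Filter Topology

/-- The function is real on the real line. -/
def Terms.RealValued (g : Terms) : Prop := ∀ t : ℝ, (g.eval (t : ℂ)).im = 0

/-- The real function that it induces. -/
noncomputable def Terms.real (g : Terms) (t : ℝ) : ℝ := (g.eval (t : ℂ)).re

theorem Terms.RealValued.ofReal_real {g : Terms} (h : g.RealValued) (t : ℝ) :
    ((g.real t : ℝ) : ℂ) = g.eval t := by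
  apply Complex.ext
  · simp [Terms.real]
  · simp [h t]

theorem Terms.RealValued.real_eq_zero_iff {g : Terms} (h : g.RealValued) {t : ℝ} :
    g.real t = 0 ↔ g.eval t = 0 := by
  rw [← h.ofReal_real t, Complex.ofReal_eq_zero]

theorem hasDerivAt_real (g : Terms) (t : ℝ) : HasDerivAt g.real ((tDeriv g).real t) t :=
  (hasDerivAt_eval g (t : ℂ)).real_of_complex

theorem continuous_real (g : Terms) : Continuous g.real :=
  continuous_iff_continuousAt.2 fun t => (hasDerivAt_real g t).continuousAt

theorem Terms.RealValued.tDeriv {g : Terms} (h : g.RealValued) :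
    (PEFIsolation.tDeriv g).RealValued := by
  intro t
  have h1 : HasDerivAt (fun y : ℝ => (g.eval (y : ℂ)).im) ((PEFIsolation.tDeriv g).eval t).im t :=
    Complex.imCLM.hasFDerivAt.comp_hasDerivAt t (hasDerivAt_eval g (t : ℂ)).comp_ofReal
  have h2 : (fun y : ℝ => (g.eval (y : ℂ)).im) = fun _ => 0 := funext h
  rw [h2] at h1
  exact h1.unique (hasDerivAt_const t 0)

/-- A nonzero entire function has finitely many zeros in a compact real interval. -/
theorem finite_zeros_of_differentiable {g : ℂ → ℂ} (hd : Differentiable ℂ g)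
    (hg : ∃ z, g z ≠ 0) (a b : ℝ) : {t : ℝ | t ∈ Icc a b ∧ g t = 0}.Finite := by
  by_contra hinf
  obtain ⟨x, -, hx⟩ := Set.Infinite.exists_accPt_of_subset_isCompact hinf isCompact_Icc
    (fun t ht => ht.1)
  rw [accPt_iff_frequently_nhdsNE] at hx
  have ht : Tendsto (fun t : ℝ => (t : ℂ)) (𝓝[≠] x) (𝓝[≠] (x : ℂ)) :=
    tendsto_nhdsWithin_of_tendsto_nhds_of_eventually_within _
      (Complex.continuous_ofReal.continuousAt.tendsto.mono_left nhdsWithin_le_nhds)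
      (by filter_upwards [self_mem_nhdsWithin] with t ht h
          exact ht (Complex.ofReal_injective h))
  have hfreq : ∃ᶠ z in 𝓝[≠] (x : ℂ), g z = 0 :=
    ht.frequently (hx.mono fun t ht => ht.2)
  obtain ⟨z, hz⟩ := hg
  have han : AnalyticOnNhd ℂ g univ := fun z _ => hd.analyticAt z
  exact hz (han.eqOn_zero_of_preconnected_of_frequently_eq_zero isPreconnected_univ
    (mem_univ (x : ℂ)) hfreq (mem_univ z))

theorem finite_zeros {g : Terms} (hg : ∃ z, g.eval z ≠ 0) (a b : ℝ) :
    {t : ℝ | t ∈ Icc a b ∧ g.eval t = 0}.Finite :=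
  finite_zeros_of_differentiable (differentiable_eval g) hg a b

theorem PEF.finite_zeros {f : PEF} (hf : ∃ t, f.eval t ≠ 0) {T : Set ℝ}
    (hT : Bornology.IsBounded T) : {t ∈ T | f.eval t = 0}.Finite := by
  let g : ℂ → ℂ := fun z => (f.map fun p => aeval z p.1 * Complex.exp ((p.2 : ℂ) * z)).sum
  have hd : Differentiable ℂ g := by
    have h : ∀ l : PEF, Differentiable ℂ fun z : ℂ =>
        (l.map fun p => aeval z p.1 * Complex.exp ((p.2 : ℂ) * z)).sum := by
      intro l
      induction l with
      | nil => simp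
      | cons p l ih =>
        simp only [List.map_cons, List.sum_cons]
        exact (p.1.differentiable_aeval.mul (differentiable_id.const_mul _).cexp).add ih
    exact h f
  obtain ⟨R, hR⟩ := hT.subset_closedBall 0
  obtain ⟨t, ht⟩ := hf
  refine (finite_zeros_of_differentiable hd ⟨(t : ℂ), ht⟩ (0 - R) (0 + R)).subset ?_
  rintro s ⟨hs, hs0⟩
  rw [← Real.closedBall_eq_Icc]
  exact ⟨hR hs, hs0⟩

theorem RatZero.eval_eq_zero {g : Terms} {p : RatCode} (h : RatZero g p) :
    g.eval ((p.value : ℝ) : ℂ) = 0 := by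
  rcases h with ⟨h0, h⟩ | h
  · rw [val_tZero] at h
    have : p.value = 0 := by simp [RatCode.value, h0]
    rw [this]
    simpa using h
  · have := h ((p.value : ℝ) : ℂ)
    rw [eval_tFreeze, mul_eq_zero] at this
    rcases this with h1 | h1
    · exact absurd (eq_zero_of_pow_eq_zero h1) (by exact_mod_cast Nat.succ_ne_zero p.2)
    · simpa [Terms.eval] using h1

/-- By Rolle's theorem, a function whose derivative of order `w.1` has no zero has no more zeros than
the one of order `w.1`. -/
theorem OrderAt.eq_of_eval_eq_zero {f : Terms} (hf : f.RealValued) {a b : RatCode}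
    {w : ℕ × RatCode} (h : OrderAt f a b w) {t : ℝ} (h1 : (a.value : ℝ) ≤ t)
    (h2 : t ≤ (b.value : ℝ)) (h0 : f.eval t = 0) : 0 < w.1 ∧ t = w.2.value := by
  obtain ⟨M, p⟩ := w
  obtain ⟨⟨⟨hp1, hp2⟩, hne⟩, hz⟩ := h
  have hp1' : (a.value : ℝ) ≤ p.value := by exact_mod_cast hp1
  have hp2' : (p.value : ℝ) ≤ b.value := by exact_mod_cast hp2
  replace hz : ∀ j < M, (tDeriv^[j] f).eval ((p.value : ℝ) : ℂ) = 0 := fun j hj =>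
    (hz j (List.mem_range.2 hj)).eval_eq_zero
  replace hne : NonzeroOn (tDeriv^[M] f) a b := hne
  simp only
  clear hp1 hp2
  induction M generalizing f t with
  | zero => exact absurd h0 (hne t h1 h2)
  | succ M ih =>
    refine ⟨Nat.succ_pos M, ?_⟩
    by_contra hne'
    have hzp : f.real p.value = 0 := hf.real_eq_zero_iff.2 (hz 0 (Nat.succ_pos M))
    have hzt : f.real t = 0 := hf.real_eq_zero_iff.2 h0
    have key : ∀ x y : ℝ, x < y → f.real x = 0 → f.real y = 0 →
        ∃ c ∈ Ioo x y, (tDeriv f).eval c = 0 := by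
      intro x y hxy hx hy
      obtain ⟨c, hc, hc0⟩ := exists_hasDerivAt_eq_zero (f := f.real) hxy
        (continuous_real f).continuousOn (by rw [hx, hy]) fun c _ => hasDerivAt_real f c
      exact ⟨c, hc, hf.tDeriv.real_eq_zero_iff.1 hc0⟩
    have hz' : ∀ j < M, (tDeriv^[j] (tDeriv f)).eval ((p.value : ℝ) : ℂ) = 0 := fun j hj => by
      rw [← Function.iterate_succ_apply]; exact hz (j + 1) (by omega)
    rcases lt_or_gt_of_ne hne' with hlt | hlt
    · obtain ⟨c, hc, hc0⟩ := key _ _ hlt hzt hzp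
      have := (ih hf.tDeriv (h1.trans hc.1.le) (hc.2.le.trans hp2') hc0 hz' hne).2
      exact absurd this hc.2.ne
    · obtain ⟨c, hc, hc0⟩ := key _ _ hlt hzp hzt
      have := (ih hf.tDeriv (hp1'.trans hc.1.le) (hc.2.le.trans h2) hc0 hz' hne).2
      exact absurd this hc.1.ne'

/-- Between two zeros, the maximum of `f ^ 2` is a zero of `f'` but not of `f`. -/
theorem DerivCert.eq_of_eval_eq_zero {f : Terms} (hf : f.RealValued) (hf0 : ∃ z, f.eval z ≠ 0)
    {a b : RatCode} {w : Terms × Terms} (h : DerivCert f a b w) {s t : ℝ}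
    (h1 : (a.value : ℝ) ≤ s) (h2 : t ≤ (b.value : ℝ)) (hst : s < t) (hs : f.eval s = 0)
    (ht : f.eval t = 0) : False := by
  obtain ⟨-, ⟨hid, hne⟩, -⟩ := h
  obtain ⟨c, hc, hmax⟩ := isCompact_Icc.exists_isMaxOn (nonempty_Icc.2 hst.le)
    ((continuous_real f).pow 2).continuousOn
  have hcne : f.real c ≠ 0 := by
    intro h0
    refine Icc_infinite hst ((finite_zeros hf0 s t).subset fun x hx => ⟨hx, ?_⟩)
    have h2 : f.real x ^ 2 ≤ f.real c ^ 2 := hmax hx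
    rw [h0, zero_pow two_ne_zero] at h2
    exact hf.real_eq_zero_iff.1 (pow_eq_zero_iff two_ne_zero |>.1 (le_antisymm h2 (sq_nonneg _)))
  have hcs : c ≠ s := fun h => hcne (h ▸ hf.real_eq_zero_iff.2 hs)
  have hct : c ≠ t := fun h => hcne (h ▸ hf.real_eq_zero_iff.2 ht)
  have hIoo : c ∈ Ioo s t := ⟨lt_of_le_of_ne hc.1 hcs.symm, lt_of_le_of_ne hc.2 hct⟩
  have hloc : IsLocalMax (fun x => f.real x ^ 2) c :=
    hmax.isLocalMax (Icc_mem_nhds hIoo.1 hIoo.2)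
  have hder := hloc.hasDerivAt_eq_zero ((hasDerivAt_real f c).pow 2)
  have hder0 : (tDeriv f).real c = 0 := by simpa [hcne] using hder
  have hid' := hid c
  rw [Terms.eval_append, eval_tScale, eval_tMul, eval_tMul,
    hf.tDeriv.real_eq_zero_iff.1 hder0] at hid'
  simp only [zero_mul, mul_zero, add_zero, mul_eq_zero] at hid'
  rcases hid' with h | h
  · exact hcne (hf.real_eq_zero_iff.2 h)
  · exact hne c (h1.trans hc.1) (hc.2.trans h2) h

theorem OneRoot.exists_unique {f : Terms} (hf : f.RealValued) (hf0 : ∃ z, f.eval z ≠ 0)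
    {a b : RatCode} (hab : a.value < b.value) (h : OneRoot f a b) :
    ∃ c : ℝ, c ∈ Ioo (a.value : ℝ) b.value ∧ f.eval c = 0 ∧
      ∀ t ∈ Icc (a.value : ℝ) b.value, f.eval t = 0 → t = c := by
  rcases h with ⟨w, ⟨hw, hw1, hw2⟩, h⟩ | ⟨w, h⟩
  · refine ⟨w.2.value, ⟨by exact_mod_cast hw1, by exact_mod_cast hw2⟩, ?_, ?_⟩
    · exact (h.2 0 (List.mem_range.2 hw)).eval_eq_zero
    · exact fun t ht h0 => (h.eq_of_eval_eq_zero hf ht.1 ht.2 h0).2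
  · have hab' : (a.value : ℝ) < b.value := by exact_mod_cast hab
    obtain ⟨-, ⟨hid, hne⟩, ha, hb⟩ := id h
    rw [eval_tScale, eval_tMul, ← hf.ofReal_real, ← hf.tDeriv.ofReal_real] at ha
    rw [eval_tMul, ← hf.ofReal_real, ← hf.tDeriv.ofReal_real] at hb
    have ha' : f.real a.value * (tDeriv f).real a.value < 0 := by
      simpa using ha
    have hb' : 0 < f.real b.value * (tDeriv f).real b.value := by
      simpa using hb
    obtain ⟨c, hc, hc0⟩ := intermediate_value_Ioo hab'.le
      (f := fun t => f.real t * (tDeriv f).real t)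
      ((continuous_real f).mul (continuous_real _)).continuousOn ⟨ha', hb'⟩
    have hroot : f.eval c = 0 := by
      rcases mul_eq_zero.1 hc0 with h0 | h0
      · exact hf.real_eq_zero_iff.1 h0
      · have hid' := hid c
        rw [Terms.eval_append, eval_tScale, eval_tMul, eval_tMul,
          hf.tDeriv.real_eq_zero_iff.1 h0] at hid'
        simp only [zero_mul, mul_zero, add_zero, mul_eq_zero] at hid'
        exact hid'.resolve_right (hne c hc.1.le hc.2.le)
    refine ⟨c, hc, hroot, fun t ht h0 => ?_⟩
    rcases lt_trichotomy t c with hlt | heq | hlt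
    · exact (h.eq_of_eval_eq_zero hf hf0 ht.1 hc.2.le hlt h0 hroot).elim
    · exact heq
    · exact (h.eq_of_eval_eq_zero hf hf0 hc.1.le ht.2 hlt hroot h0).elim

theorem NoRoot.eq_or_eq {x : Terms × RatCode × RatCode} (hf : x.1.RealValued) {a b : RatCode}
    (h : NoRoot x a b) {t : ℝ} (ht : t ∈ Icc (a.value : ℝ) b.value) (h0 : x.1.eval t = 0) :
    t = x.2.1.value ∨ t = x.2.2.value := by
  obtain ⟨w, hw, h⟩ := h
  obtain ⟨h1, h2⟩ := h.eq_of_eval_eq_zero hf ht.1 ht.2 h0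
  rcases hw with hw | hw | hw
  · omega
  · exact Or.inl (by rw [h2, hw])
  · exact Or.inr (by rw [h2, hw])

/-- Consecutive intervals cover, are ordered, and stay between the endpoints. -/
theorem consecutive_intervals (M : Subdivision) (l r : RatCode)
    (h : M.map (fun m => m.1.1) ++ [r] = l :: M.map (fun m => m.1.2))
    (hlt : ∀ m ∈ M, m.1.1.value < m.1.2.value) :
    l.value ≤ r.value ∧ (∀ m ∈ M, l.value ≤ m.1.1.value ∧ m.1.2.value ≤ r.value) ∧
      M.Pairwise (fun m n => m.1.2.value ≤ n.1.1.value) ∧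
      ∀ t : ℝ, (l.value : ℝ) ≤ t → t < r.value → ∃ m ∈ M, t ∈ Icc (m.1.1.value : ℝ) m.1.2.value := by
  induction M generalizing l with
  | nil =>
    simp only [List.map_nil, List.nil_append, List.cons.injEq, and_true] at h
    subst h
    exact ⟨le_rfl, by simp, List.Pairwise.nil, fun t h1 h2 => absurd h1 (not_le.2 h2)⟩
  | cons m M ih =>
    simp only [List.map_cons, List.cons_append, List.cons.injEq] at h
    obtain ⟨rfl, h⟩ := h
    obtain ⟨i1, i2, i3, i4⟩ := ih m.1.2 h fun n hn => hlt n (by simp [hn])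
    have hm := hlt m (by simp)
    refine ⟨hm.le.trans i1, ?_, ?_, ?_⟩
    · intro n hn
      rcases List.mem_cons.1 hn with rfl | hn
      · exact ⟨le_rfl, i1⟩
      · exact ⟨hm.le.trans (i2 n hn).1, (i2 n hn).2⟩
    · exact List.pairwise_cons.2 ⟨fun n hn => (i2 n hn).1, i3⟩
    · intro t h1 h2
      rcases le_total t m.1.2.value with h3 | h3
      · exact ⟨m, by simp, h1, h3⟩
      · obtain ⟨n, hn, hn'⟩ := i4 t h3 h2
        exact ⟨n, by simp [hn], hn'⟩

theorem mem_output {M : Subdivision} {J : RatCode × RatCode} :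
    J ∈ M.output ↔ (J, true) ∈ M := by
  simp only [Subdivision.output, List.mem_flatMap]
  constructor
  · rintro ⟨⟨K, b⟩, hm, hJ⟩
    cases b
    · simp at hJ
    · simp only [cond_true, List.mem_singleton] at hJ
      rwa [hJ]
  · exact fun h => ⟨_, h, by simp⟩

/-- A certified list is a root isolation, for any choice of the endpoints to be included that are not
roots. -/
theorem CertifiedResult.isRootIsolation {f : Terms} (hf : f.RealValued)
    (hf0 : ∃ z, f.eval z ≠ 0) {T : IntervalCode} {L : List (RatCode × RatCode)}
    (h : CertifiedResult (f, T.1.1, T.2.1) L)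
    (hend : ∀ t ∈ T.toSet, t = T.left ∨ t = T.right → f.eval t ≠ 0) :
    IsRootIsolation (fun t => f.eval t) T.toSet (decodeIntervals L) := by
  rcases h with ⟨hle, rfl⟩ | ⟨M, rfl, hchain, hM⟩
  · have hle' : T.right ≤ T.left := by
      unfold IntervalCode.right IntervalCode.left; exact_mod_cast hle
    have hempty : decodeIntervals [] = ∅ := by
      ext; simp [decodeIntervals]
    rw [hempty]
    refine ⟨by simp, by simp, by simp, fun t ht h0 => (hend t ht ?_ h0).elim⟩
    rcases ht.1 with h1 | h1
    · rcases ht.2 with h2 | h2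
      · exact absurd (h1.trans h2) (not_lt.2 hle')
      · exact Or.inr h2.2
    · exact Or.inl h1.2
  · obtain ⟨-, hin, hpair, hcov⟩ := consecutive_intervals M T.1.1 T.2.1 hchain
      fun m hm => (hM m hm).1
    have hone : ∀ J : RatCode × RatCode, (J, true) ∈ M → J.1.value < J.2.value ∧ OneRoot f J.1 J.2 := by
      intro J hJ
      obtain ⟨h1, h2⟩ := hM _ hJ
      rcases h2 with h2 | h2
      · exact ⟨h1, h2.2⟩
      · exact absurd h2.1 (by simp)
    refine ⟨?_, ?_, ?_, ?_⟩
    · have key : ∀ m ∈ M, ∀ n ∈ M, ((m.1.1.value, m.1.2.value) : ℚ × ℚ) ≠ (n.1.1.value, n.1.2.value) →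
          Disjoint (Ioo (m.1.1.value : ℝ) m.1.2.value) (Ioo (n.1.1.value : ℝ) n.1.2.value) := by
        intro m hm n hn
        let R : ((RatCode × RatCode) × Bool) → ((RatCode × RatCode) × Bool) → Prop := fun m n =>
          ((m.1.1.value, m.1.2.value) : ℚ × ℚ) ≠ (n.1.1.value, n.1.2.value) →
          Disjoint (Ioo (m.1.1.value : ℝ) m.1.2.value) (Ioo (n.1.1.value : ℝ) n.1.2.value)
        have : Std.Symm R := ⟨fun m n h hne => (h hne.symm).symm⟩
        refine List.Pairwise.forall_of_forall (R := R) (fun m _ hne => absurd rfl hne)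
          (hpair.imp fun {m n} hmn _ => ?_) hm hn
        rw [Set.disjoint_left]
        intro t h1 h2
        have : (m.1.2.value : ℝ) ≤ n.1.1.value := by exact_mod_cast hmn
        linarith [h1.2, h2.1]
      rintro _ ⟨J, hJ, rfl⟩ _ ⟨K, hK, rfl⟩ hne
      exact key _ (mem_output.1 hJ) _ (mem_output.1 hK) hne
    · rintro _ ⟨J, hJ, rfl⟩ t ht
      obtain ⟨h1, h2⟩ := hin _ (mem_output.1 hJ)
      have h1' : T.left ≤ J.1.value := by unfold IntervalCode.left; exact_mod_cast h1
      have h2' : (J.2.value : ℝ) ≤ T.right := by unfold IntervalCode.right; exact_mod_cast h2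
      exact ⟨Or.inl (h1'.trans_lt ht.1), Or.inl (ht.2.trans_le h2')⟩
    · rintro _ ⟨J, hJ, rfl⟩
      obtain ⟨h1, h2⟩ := hone J (mem_output.1 hJ)
      obtain ⟨c, hc, hc0, huniq⟩ := h2.exists_unique hf hf0 h1
      exact ⟨c, ⟨hc, hc0⟩, fun t ht => huniq t (Ioo_subset_Icc_self ht.1) ht.2⟩
    · intro t ht h0
      have hl : t ≠ T.left := fun h => hend t ht (Or.inl h) h0
      have hr : t ≠ T.right := fun h => hend t ht (Or.inr h) h0
      have h1 : T.left < t := ht.1.resolve_right fun h => hl h.2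
      have h2 : t < T.right := ht.2.resolve_right fun h => hr h.2
      obtain ⟨m, hm, hmt⟩ := hcov t h1.le h2
      obtain ⟨hlt, hc⟩ := hM m hm
      rcases hc with ⟨hflag, hc⟩ | ⟨-, hc⟩
      · obtain ⟨c, hc, hc0, huniq⟩ := hc.exists_unique hf hf0 hlt
        refine ⟨_, ⟨m.1, mem_output.2 ?_, rfl⟩, ?_⟩
        · rwa [← hflag]
        · rw [huniq t hmt h0]; exact hc
      · rcases hc.eq_or_eq hf hmt h0 with h | h
        · exact absurd h hl
        · exact absurd h hr

end Soundness

end PEFIsolation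

namespace PEFIsolation

/-! ### Algebraic independence from Schanuel's conjecture -/

section Schanuel

open Set Cardinal

/-- If the elements of a field are algebraic over finitely many numbers, then these contain an
algebraically independent subfamily that is at least as large as the transcendence degree. -/
theorem exists_algebraicIndepOn_of_le_trdeg {σ : Type} [Finite σ] (x : σ → ℂ)
    {F : IntermediateField ℚ ℂ}
    (hF : ∀ y ∈ F, IsAlgebraic (Algebra.adjoin ℚ (range x)) y) {n : ℕ}
    (hn : (n : Cardinal) ≤ Algebra.trdeg ℚ F) :
    ∃ s : Set σ, AlgebraicIndepOn ℚ x s ∧ n ≤ s.ncard := by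
  let M := AlgebraicIndependent.matroid ℚ ℂ
  obtain ⟨u, hu⟩ := M.exists_isBasis (range x) (subset_univ _)
  obtain ⟨s, -, hs⟩ := SurjOn.exists_bijOn_subset (f := x) (s := univ) (t := u)
    (by rw [SurjOn, image_univ]; exact hu.subset)
  have hind : AlgebraicIndepOn ℚ id u := hu.indep
  refine ⟨s, ?_, ?_⟩
  · have := hind.comp (fun i : s => (⟨x i, hs.mapsTo i.2⟩ : u)) fun i j hij =>
      Subtype.ext (hs.injOn i.2 j.2 (congrArg Subtype.val hij))
    exact this
  · obtain ⟨B, hB⟩ := exists_isTranscendenceBasis ℚ F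
    have hB1 : M.Indep ((fun y : F => (y : ℂ)) '' B) := by
      have h1 : AlgebraicIndependent ℚ fun b : B => F.val (b : F) :=
        hB.1.map' (f := F.val) F.val.injective
      exact h1.to_subtype_range' (by ext; simp)
    have hB2 : (fun y : F => (y : ℂ)) '' B ⊆ M.closure (range x) := by
      rw [AlgebraicIndependent.matroid_closure_eq]
      rintro _ ⟨y, -, rfl⟩
      exact hF y y.2
    have h2 := hB1.encard_le_eRk_of_subset hB2
    rw [M.eRk_closure_eq, ← hu.encard_eq_eRk,
      (Subtype.val_injective.injOn : InjOn (fun y : F => (y : ℂ)) B).encard_image] at h2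
    have h3 : (n : ℕ∞) ≤ B.encard := by
      rw [← hB.cardinalMk_eq_trdeg] at hn
      have := Cardinal.toENat.monotone' hn
      simpa using this
    have h4 : u.encard = s.encard := by rw [← hs.image_eq, hs.injOn.encard_image]
    have h5 := (h3.trans h2).trans_eq h4
    rw [← (toFinite s).cast_ncard_eq] at h5
    exact_mod_cast h5

theorem SchanuelConjecture.exists_algebraicIndependent (hS : SchanuelConjecture) {n : ℕ}
    {μ : Fin n → ℂ} (hμ : LinearIndependent ℚ μ) (halg : ∀ i, IsAlgebraic ℚ (μ i)) {t : ℂ}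
    (ht : t ≠ 0) :
    ∃ i : Option (Fin n), AlgebraicIndependent ℚ fun j : {j // j ≠ i} =>
      (j : Option (Fin n)).elim t fun k => Complex.exp (μ k * t) := by
  set x : Option (Fin n) → ℂ := fun j => j.elim t fun k => Complex.exp (μ k * t) with hx
  have hlin : LinearIndependent ℚ fun k => μ k * t := by
    have := hμ.map' ((LinearMap.mulRight ℚ t)) (by
      rw [LinearMap.ker_eq_bot]
      exact fun a b h => mul_right_cancel₀ ht h)
    exact this
  have hsub : ∀ j, IsAlgebraic (Algebra.adjoin ℚ (range x)) (x j) := fun j =>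
    isAlgebraic_algebraMap (⟨x j, Algebra.subset_adjoin ⟨j, rfl⟩⟩ : Algebra.adjoin ℚ (range x))
  obtain ⟨s, hs, hcard⟩ := exists_algebraicIndepOn_of_le_trdeg x (n := n)
    (F := IntermediateField.adjoin ℚ
      (range (fun k => μ k * t) ∪ range fun k => Complex.exp (μ k * t)))
    (fun y hy => by
      induction hy using IntermediateField.adjoin_induction with
      | mem y hy =>
        rcases hy with ⟨k, rfl⟩ | ⟨k, rfl⟩
        · exact ((halg k).extendScalars (algebraMap ℚ _).injective).mul (hsub none)
        · exact hsub (some k)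
      | algebraMap q =>
        exact (isAlgebraic_algebraMap (A := ℂ) q).extendScalars
          (algebraMap ℚ (Algebra.adjoin ℚ (range x))).injective
      | add y z _ _ hy hz => exact hy.add hz
      | inv y _ hy => exact hy.inv
      | mul y z _ _ hy hz => exact hy.mul hz) (hS n _ hlin)
  have hcompl : sᶜ.ncard ≤ 1 := by
    have := ncard_add_ncard_compl s
    rw [Nat.card_eq_fintype_card, Fintype.card_option, Fintype.card_fin] at this
    omega
  obtain ⟨i, hi⟩ : ∃ i, ∀ j, j ≠ i → j ∈ s := by
    rcases sᶜ.eq_empty_or_nonempty with h | ⟨i, hi⟩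
    · exact ⟨none, fun j _ => by rw [compl_empty_iff.1 h]; trivial⟩
    · refine ⟨i, fun j hj => ?_⟩
      by_contra hjs
      exact hj ((ncard_le_one (toFinite _)).1 hcompl j hjs i hi)
  refine ⟨i, ?_⟩
  exact hs.comp (fun j : {j // j ≠ i} => (⟨j, hi j j.2⟩ : s)) fun j k hjk =>
    Subtype.ext (congrArg (fun y : s => (y : Option (Fin n))) hjk)

end Schanuel

/-! ### Prime polynomials at generic points of hypersurfaces -/

section Gauss

/-- By Gauss's lemma, a prime polynomial generates the ideal of the polynomials that vanish at a
zero of it, if the coefficients are embedded into a field. -/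
theorem prime_dvd_of_eval₂_eq_zero {R L : Type} [CommRing R] [IsDomain R]
    [UniqueFactorizationMonoid R] [Field L] {ι : R →+* L} (hι : Function.Injective ι) {x : L}
    {q a : R[X]} (hq : Prime q) (hqx : q.eval₂ ι x = 0) (hax : a.eval₂ ι x = 0) : q ∣ a := by
  let _ : NormalizedGCDMonoid R :=
    Classical.choice (inferInstance : Nonempty (NormalizedGCDMonoid R))
  have hdeg : q.natDegree ≠ 0 := by
    intro h
    rw [eq_C_of_natDegree_eq_zero h, eval₂_C] at hqx
    have h0 := (map_eq_zero_iff ι hι).1 hqx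
    apply hq.ne_zero
    rw [eq_C_of_natDegree_eq_zero h, h0, C_0]
  have hprim : q.IsPrimitive := hq.irreducible.isPrimitive hdeg
  let F := FractionRing R
  let j : F →+* L := IsFractionRing.lift hι
  have hj : j.comp (algebraMap R F) = ι := by
    ext r; exact IsFractionRing.lift_algebraMap hι r
  have hirr : Irreducible (q.map (algebraMap R F)) :=
    hprim.irreducible_iff_irreducible_map_fraction_map.1 hq.irreducible
  rcases (EuclideanDomain.dvd_or_coprime _ (a.map (algebraMap R F)) hirr) with h | h
  · exact hprim.dvd_of_fraction_map_dvd_fraction_map h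
  · obtain ⟨b, c, hbc⟩ := h
    have := congrArg (eval₂ j x) hbc
    rw [eval₂_add, eval₂_mul, eval₂_mul, eval₂_map, eval₂_map, hj, hqx, hax, eval₂_one] at this
    simp at this

/-- If all coordinates of a point except one are algebraically independent, then a prime polynomial
that vanishes at the point divides all others that do. -/
theorem prime_dvd_of_aeval_eq_zero {K σ : Type} [Field K] [Algebra K ℂ] {x : σ → ℂ} {i : σ}
    (hx : AlgebraicIndependent K fun j : {j // j ≠ i} => x j) {q a : MvPolynomial σ K}
    (hq : Prime q) (hqx : MvPolynomial.aeval x q = 0) (hax : MvPolynomial.aeval x a = 0) :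
    q ∣ a := by
  classical
  let e1 : MvPolynomial σ K ≃ₐ[K] MvPolynomial (Option {j // j ≠ i}) K :=
    MvPolynomial.renameEquiv K (Equiv.optionSubtypeNe i).symm
  let e : MvPolynomial σ K ≃ₐ[K] (MvPolynomial {j // j ≠ i} K)[X] :=
    e1.trans (MvPolynomial.optionEquivLeft K _)
  let ι : MvPolynomial {j // j ≠ i} K →ₐ[K] ℂ := MvPolynomial.aeval fun j => x j
  have key : ∀ p, (e p).eval₂ ι.toRingHom (x i) = MvPolynomial.aeval x p := by
    intro p
    induction p using MvPolynomial.induction_on with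
    | C c => simp [e, e1, ι]
    | add p q hp hq => rw [map_add, eval₂_add, hp, hq, map_add]
    | mul_X p k hp =>
      rw [map_mul, eval₂_mul, hp, map_mul, MvPolynomial.aeval_X]
      congr 1
      by_cases hk : k = i
      · subst hk
        simp [e, e1]
      · simp [e, e1, ι, Equiv.optionSubtypeNe_symm_of_ne hk]
  have h := prime_dvd_of_eval₂_eq_zero (ι := ι.toRingHom) (x := x i) hx (q := e q) (a := e a)
    ((MulEquiv.prime_iff e).2 hq) (by rw [key, hqx]) (by rw [key, hax])
  exact (map_dvd_iff e).1 h

end Gauss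

end PEFIsolation

namespace PEFIsolation

/-! ### Polynomials in the variable and in exponentials -/

section Representation

/-- The numbers that are integer polynomials in the values of the given codes. -/
noncomputable def zSubring (A : List AlgCode) : Subring ℂ where
  carrier := {z | ∃ E : ZPoly, (∀ c ∈ E.atoms, c ∈ A) ∧ E.val = z}
  one_mem' := ⟨zInt 1, by simp [atoms_zInt], by simp [val_zInt]⟩
  zero_mem' := ⟨[], by simp [ZPoly.atoms], ZPoly.val_nil⟩
  mul_mem' := by
    rintro _ _ ⟨E, hE, rfl⟩ ⟨F, hF, rfl⟩
    exact ⟨zMul E F, fun c hc => (mem_atoms_zMul hc).elim (hE c) (hF c), val_zMul E F⟩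
  add_mem' := by
    rintro _ _ ⟨E, hE, rfl⟩ ⟨F, hF, rfl⟩
    refine ⟨E ++ F, fun c hc => ?_, ZPoly.val_append E F⟩
    rw [ZPoly.atoms_append, List.mem_append] at hc
    exact hc.elim (hE c) (hF c)
  neg_mem' := by
    rintro _ ⟨E, hE, rfl⟩
    refine ⟨zMul (zInt (-1)) E, fun c hc => ?_, by simp [val_zMul, val_zInt]⟩
    rcases mem_atoms_zMul hc with hc | hc
    · simp [atoms_zInt] at hc
    · exact hE c hc

/-- The functions given by expressions in the given codes. -/
noncomputable def tSubring (A : List AlgCode) : Subring (ℂ → ℂ) where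
  carrier := {g | ∃ h : Terms, (∀ c ∈ h.atoms, c ∈ A) ∧ h.eval = g}
  one_mem' := ⟨[(zInt 1, 0, [])], by simp [Terms.atoms, ZPoly.atoms, zInt], by
    ext t; simp [Terms.eval, Terms.eval₂, termVal, val_zInt, ZPoly.val_nil]⟩
  zero_mem' := ⟨[], by simp [Terms.atoms], by ext t; simp [Terms.eval, Terms.eval₂]⟩
  mul_mem' := by
    rintro _ _ ⟨E, hE, rfl⟩ ⟨F, hF, rfl⟩
    exact ⟨tMul E F, fun c hc => (atoms_tMul hc).elim (hE c) (hF c), funext (eval_tMul E F)⟩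
  add_mem' := by
    rintro _ _ ⟨E, hE, rfl⟩ ⟨F, hF, rfl⟩
    refine ⟨E ++ F, fun c hc => ?_, funext (Terms.eval_append E F)⟩
    rw [Terms.atoms_append, List.mem_append] at hc
    exact hc.elim (hE c) (hF c)
  neg_mem' := by
    rintro _ ⟨E, hE, rfl⟩
    exact ⟨tScale (-1) E, fun c hc => hE c (atoms_tScale hc), by ext t; simp [eval_tScale]⟩

theorem const_mem_tSubring {A : List AlgCode} {z : ℂ} (hz : z ∈ zSubring A) :
    (fun _ => z) ∈ tSubring A := by
  obtain ⟨E, hE, rfl⟩ := hz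
  refine ⟨[(E, 0, [])], by simpa [Terms.atoms, ZPoly.atoms] using hE, ?_⟩
  ext t; simp [Terms.eval, Terms.eval₂, termVal, ZPoly.val_nil]

theorem id_mem_tSubring (A : List AlgCode) : (fun t => t) ∈ tSubring A := by
  refine ⟨[(zInt 1, 1, [])], by simp [Terms.atoms, ZPoly.atoms, zInt], ?_⟩
  ext t; simp [Terms.eval, Terms.eval₂, termVal, ZPoly.val_nil, val_zInt]

theorem exp_mem_tSubring {A : List AlgCode} {z : ℂ} (hz : z ∈ zSubring A) :
    (fun t => Complex.exp (z * t)) ∈ tSubring A := by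
  obtain ⟨E, hE, rfl⟩ := hz
  refine ⟨[(zInt 1, 0, E)], by simpa [Terms.atoms, atoms_zInt] using hE, ?_⟩
  ext t; simp [Terms.eval, Terms.eval₂, termVal, val_zInt]

/-- The number field generated by the values of the given codes. -/
noncomputable def codeField (A : List AlgCode) : IntermediateField ℚ ℂ :=
  IntermediateField.adjoin ℚ {x | ∃ c ∈ A, AlgCode.val c = x}

theorem isAlgebraic_codeField {A : List AlgCode} (hA : ∀ c ∈ A, c.Valid) :
    Algebra.IsAlgebraic ℚ (codeField A) :=
  IntermediateField.isAlgebraic_adjoin (by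
    rintro x ⟨c, hc, rfl⟩
    exact (hA c hc).isAlgebraic.isIntegral)

theorem mem_codeField {A : List AlgCode} {z : ℂ} (hz : z ∈ zSubring A) : z ∈ codeField A := by
  obtain ⟨E, hE, rfl⟩ := hz
  have hatom : ∀ c ∈ A, c.val ∈ codeField A := fun c hc =>
    IntermediateField.subset_adjoin ℚ _ ⟨c, hc, rfl⟩
  refine list_sum_mem fun x hx => ?_
  obtain ⟨m, hm, rfl⟩ := List.mem_map.1 hx
  refine mul_mem (intCast_mem _ _) (list_prod_mem fun y hy => ?_)
  obtain ⟨c, hc, rfl⟩ := List.mem_map.1 hy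
  exact hatom c (hE c (List.mem_flatMap.2 ⟨m, hm, hc⟩))

/-- Every element of the field is a quotient of an integer polynomial in the codes by a positive
integer, since inverses of algebraic numbers are polynomials in them. -/
theorem exists_natCast_mul_mem_zSubring {A : List AlgCode} (hA : ∀ c ∈ A, c.Valid) {z : ℂ}
    (hz : z ∈ codeField A) : ∃ k : ℕ, k ≠ 0 ∧ (k : ℂ) * z ∈ zSubring A := by
  have hz' : z ∈ Algebra.adjoin ℚ {x | ∃ c ∈ A, AlgCode.val c = x} := by
    rw [← IntermediateField.adjoin_toSubalgebra_of_isAlgebraic]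
    · exact hz
    · rintro x ⟨c, hc, rfl⟩
      exact (hA c hc).isAlgebraic
  induction hz' using Algebra.adjoin_induction with
  | mem x hx =>
    obtain ⟨c, hc, rfl⟩ := hx
    exact ⟨1, one_ne_zero, [(1, [c])], by simpa [ZPoly.atoms] using hc, by simp [val_atom]⟩
  | algebraMap q =>
    refine ⟨q.den, q.den_nz, ?_⟩
    have : (q.den : ℂ) * algebraMap ℚ ℂ q = ((q.num : ℤ) : ℂ) := by
      rw [eq_ratCast]
      exact_mod_cast Rat.den_mul_eq_num q
    rw [this]
    exact intCast_mem _ _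
  | add x y hx hy ihx ihy =>
    obtain ⟨k, hk, hkx⟩ := ihx (IntermediateField.algebra_adjoin_le_adjoin ℚ _ hx)
    obtain ⟨l, hl, hly⟩ := ihy (IntermediateField.algebra_adjoin_le_adjoin ℚ _ hy)
    refine ⟨k * l, mul_ne_zero hk hl, ?_⟩
    have : ((k * l : ℕ) : ℂ) * (x + y) = l * (k * x) + k * (l * y) := by push_cast; ring
    rw [this]
    exact add_mem (mul_mem (natCast_mem _ _) hkx) (mul_mem (natCast_mem _ _) hly)
  | mul x y hx hy ihx ihy =>
    obtain ⟨k, hk, hkx⟩ := ihx (IntermediateField.algebra_adjoin_le_adjoin ℚ _ hx)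
    obtain ⟨l, hl, hly⟩ := ihy (IntermediateField.algebra_adjoin_le_adjoin ℚ _ hy)
    refine ⟨k * l, mul_ne_zero hk hl, ?_⟩
    have : ((k * l : ℕ) : ℂ) * (x * y) = (k * x) * (l * y) := by push_cast; ring
    rw [this]
    exact mul_mem hkx hly

variable {n : ℕ}

/-- The point `(s, exp (μ₁ t), …, exp (μₙ t))`. -/
noncomputable def expPoint (μ : Fin n → ℂ) (s t : ℂ) (j : Option (Fin n)) : ℂ :=
  j.elim s fun k => Complex.exp (μ k * t)

/-- The function `t ↦ p (t, exp (μ₁ t), …, exp (μₙ t))` given by a polynomial `p`. -/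
noncomputable def expEval {K : IntermediateField ℚ ℂ} (μ : Fin n → ℂ)
    (p : MvPolynomial (Option (Fin n)) K) (t : ℂ) : ℂ :=
  MvPolynomial.aeval (expPoint μ t t) p

theorem exists_natCast_mul_expEval_mem_tSubring {A : List AlgCode} (hA : ∀ c ∈ A, c.Valid)
    {μ : Fin n → ℂ} (hμ : ∀ i, μ i ∈ zSubring A) (p : MvPolynomial (Option (Fin n)) (codeField A)) :
    ∃ k : ℕ, k ≠ 0 ∧ (fun t => (k : ℂ) * expEval μ p t) ∈ tSubring A := by
  have hnat : ∀ k : ℕ, (fun _ => (k : ℂ)) ∈ tSubring A := fun k =>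
    const_mem_tSubring (natCast_mem _ _)
  induction p using MvPolynomial.induction_on with
  | C c =>
    obtain ⟨k, hk, hkc⟩ := exists_natCast_mul_mem_zSubring hA c.2
    refine ⟨k, hk, ?_⟩
    have : (fun t => (k : ℂ) * expEval μ (MvPolynomial.C c) t) = fun _ => (k : ℂ) * (c : ℂ) := by
      ext t; simp [expEval]
    rw [this]
    exact const_mem_tSubring hkc
  | add p q hp hq =>
    obtain ⟨k, hk, hkp⟩ := hp
    obtain ⟨l, hl, hlq⟩ := hq
    refine ⟨k * l, mul_ne_zero hk hl, ?_⟩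
    have : (fun t => ((k * l : ℕ) : ℂ) * expEval μ (p + q) t)
        = (fun _ => (l : ℂ)) * (fun t => (k : ℂ) * expEval μ p t)
          + (fun _ => (k : ℂ)) * fun t => (l : ℂ) * expEval μ q t := by
      ext t
      simp only [expEval, map_add, Pi.add_apply, Pi.mul_apply]
      push_cast; ring
    rw [this]
    exact add_mem (mul_mem (hnat l) hkp) (mul_mem (hnat k) hlq)
  | mul_X p j hp =>
    obtain ⟨k, hk, hkp⟩ := hp
    refine ⟨k, hk, ?_⟩
    have : (fun t => (k : ℂ) * expEval μ (p * MvPolynomial.X j) t)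
        = (fun t => (k : ℂ) * expEval μ p t) * fun t => expPoint μ t t j := by
      ext t
      simp only [expEval, map_mul, Pi.mul_apply, MvPolynomial.aeval_X]
      ring
    rw [this]
    refine mul_mem hkp ?_
    cases j with
    | none => exact id_mem_tSubring A
    | some i => exact exp_mem_tSubring (hμ i)

/-- The finitely many exponents have a basis with integer coordinates. -/
theorem exists_integral_basis (Λ : Set ℂ) (hΛ : Λ.Finite) :
    ∃ (n : ℕ) (μ : Fin n → ℂ), LinearIndependent ℚ μ ∧ (∀ i, μ i ∈ Submodule.span ℤ Λ) ∧
      ∀ l ∈ Λ, ∃ m : Fin n → ℤ, l = ∑ i, (m i : ℂ) * μ i := by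
  have : Module.Finite ℤ (Submodule.span ℤ Λ) := Module.Finite.span_of_finite ℤ hΛ
  have : Module.Free ℤ (Submodule.span ℤ Λ) := Module.free_of_finite_type_torsion_free'
  let b := Module.finBasis ℤ (Submodule.span ℤ Λ)
  refine ⟨_, fun i => (b i : ℂ), ?_, fun i => (b i).2, fun l hl => ?_⟩
  · rw [← LinearIndependent.iff_fractionRing ℤ ℚ]
    exact b.linearIndependent.map' (Submodule.subtype _) (Submodule.ker_subtype _)
  · refine ⟨fun i => b.repr ⟨l, Submodule.subset_span hl⟩ i, ?_⟩
    have h := congrArg (Submodule.subtype (Submodule.span ℤ Λ))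
      (b.sum_repr ⟨l, Submodule.subset_span hl⟩)
    rw [map_sum] at h
    refine h.symm.trans (Finset.sum_congr rfl fun i _ => ?_)
    rw [map_smul, zsmul_eq_mul]
    rfl

/-- The product of an expression with an exponential function is a polynomial in exponentials; the
factor makes all exponents positive combinations of the basis. -/
theorem exists_expPoint_representation {A : List AlgCode} {μ : Fin n → ℂ} (g : Terms)
    (hg : ∀ c ∈ g.atoms, c ∈ A)
    (hμ : ∀ m ∈ g, ∃ e : Fin n → ℤ, m.2.2.val = ∑ i, (e i : ℂ) * μ i) :
    ∃ k₀ : ℕ, ∀ k ≥ k₀, ∃ p : MvPolynomial (Option (Fin n)) (codeField A), ∀ s t : ℂ,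
      Complex.exp (((k : ℂ) * ∑ i, μ i) * t) * g.eval₂ s t
        = MvPolynomial.aeval (expPoint μ s t) p := by
  induction g with
  | nil => exact ⟨0, fun k _ => ⟨0, fun s t => by simp [Terms.eval₂]⟩⟩
  | cons m g ih =>
    obtain ⟨k₁, hk₁⟩ := ih (fun c hc => hg c (by
      rw [Terms.atoms_cons]; exact List.mem_append_right _ hc)) fun x hx => hμ x (by simp [hx])
    obtain ⟨e, he⟩ := hμ m (by simp)
    refine ⟨k₁ + ∑ i, (e i).natAbs, fun k hk => ?_⟩
    obtain ⟨p, hp⟩ := hk₁ k (by omega)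
    have hc : m.1.val ∈ codeField A := mem_codeField ⟨m.1, fun c hc => hg c (by
      rw [Terms.atoms_cons]; exact List.mem_append_left _ (List.mem_append_left _ hc)), rfl⟩
    refine ⟨MvPolynomial.C ⟨_, hc⟩ * MvPolynomial.X none ^ m.2.1 *
      ∏ i, MvPolynomial.X (some i) ^ ((k : ℤ) + e i).toNat + p, fun s t => ?_⟩
    have hexp : Complex.exp (((k : ℂ) * ∑ i, μ i) * t) * Complex.exp (m.2.2.val * t)
        = ∏ i, Complex.exp (μ i * t) ^ ((k : ℤ) + e i).toNat := by
      rw [← Complex.exp_add]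
      simp_rw [← Complex.exp_nat_mul]
      rw [← Complex.exp_sum, he, ← add_mul, Finset.mul_sum, ← Finset.sum_add_distrib,
        Finset.sum_mul]
      congr 1
      refine Finset.sum_congr rfl fun i _ => ?_
      have h1 : (e i).natAbs ≤ ∑ i, (e i).natAbs :=
        Finset.single_le_sum (f := fun i => (e i).natAbs) (fun _ _ => Nat.zero_le _)
          (Finset.mem_univ i)
      have h2 : (((((k : ℤ) + e i).toNat : ℕ) : ℤ) : ℂ) = (((k : ℤ) + e i : ℤ) : ℂ) := by
        congr 1; omega
      push_cast at h2
      rw [h2]; ring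
    rw [Terms.eval₂_cons, mul_add, hp, map_add, map_mul, map_mul, map_pow, map_prod]
    simp only [map_pow, MvPolynomial.aeval_X, MvPolynomial.aeval_C]
    simp only [expPoint, Option.elim_none, Option.elim_some]
    rw [← hexp, termVal]
    congr 1
    have : (algebraMap (codeField A) ℂ) ⟨m.1.val, hc⟩ = m.1.val := rfl
    rw [this]; ring

/-- The derivation of the polynomial ring that corresponds to differentiation. -/
noncomputable def expDerivation {K : IntermediateField ℚ ℂ} (μ : Fin n → K) :
    Derivation K (MvPolynomial (Option (Fin n)) K) (MvPolynomial (Option (Fin n)) K) :=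
  MvPolynomial.mkDerivation K fun j =>
    j.elim 1 fun i => MvPolynomial.C (μ i) * MvPolynomial.X (some i)

theorem hasDerivAt_expEval {K : IntermediateField ℚ ℂ} (μ : Fin n → K)
    (p : MvPolynomial (Option (Fin n)) K) (t : ℂ) :
    HasDerivAt (expEval (fun i => (μ i : ℂ)) p)
      (expEval (fun i => (μ i : ℂ)) (expDerivation μ p) t) t := by
  induction p using MvPolynomial.induction_on with
  | C c =>
    have h1 : expEval (fun i => (μ i : ℂ)) (MvPolynomial.C c) = fun _ => (c : ℂ) := by
      ext t; simp [expEval]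
    have h2 : expDerivation μ (MvPolynomial.C c) = 0 := MvPolynomial.derivation_C _ c
    rw [h1, h2]
    simpa [expEval] using hasDerivAt_const t (c : ℂ)
  | add p q hp hq =>
    have h1 : expEval (fun i => (μ i : ℂ)) (p + q)
        = expEval (fun i => (μ i : ℂ)) p + expEval (fun i => (μ i : ℂ)) q := by
      ext t; simp [expEval]
    rw [h1, map_add]
    simpa [expEval] using hp.add hq
  | mul_X p j hp =>
    have h1 : expEval (fun i => (μ i : ℂ)) (p * MvPolynomial.X j)
        = expEval (fun i => (μ i : ℂ)) p * fun t => expPoint (fun i => (μ i : ℂ)) t t j := by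
      ext t; simp [expEval]
    have h2 : HasDerivAt (fun t => expPoint (fun i => (μ i : ℂ)) t t j)
        (expEval (fun i => (μ i : ℂ)) (expDerivation μ (MvPolynomial.X j)) t) t := by
      rw [expDerivation, MvPolynomial.mkDerivation_X]
      cases j with
      | none =>
        refine (show HasDerivAt _ _ t from hasDerivAt_id t).congr_deriv ?_
        simp [expEval]
      | some i =>
        have := ((hasDerivAt_id t).const_mul (μ i : ℂ)).cexp
        refine (show HasDerivAt _ _ t from this).congr_deriv ?_
        simp [expEval, expPoint, mul_comm]
    rw [h1, Derivation.leibniz]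
    refine (hp.mul h2).congr_deriv ?_
    simp only [expEval, map_add, smul_eq_mul, map_mul, MvPolynomial.aeval_X]
    ring

end Representation

end PEFIsolation

namespace PEFIsolation

/-! ### Identities and zeros from Schanuel's conjecture -/

section Identities

variable {n : ℕ}

theorem iteratedDeriv_expEval {K : IntermediateField ℚ ℂ} (μ : Fin n → K)
    (p : MvPolynomial (Option (Fin n)) K) (j : ℕ) :
    iteratedDeriv j (expEval (fun i => (μ i : ℂ)) p)
      = expEval (fun i => (μ i : ℂ)) ((expDerivation μ)^[j] p) := by
  induction j generalizing p with
  | zero => simp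
  | succ j ih =>
    have : deriv (expEval (fun i => (μ i : ℂ)) p)
        = expEval (fun i => (μ i : ℂ)) (expDerivation μ p) :=
      funext fun t => (hasDerivAt_expEval μ p t).deriv
    rw [iteratedDeriv_succ', this, ih, Function.iterate_succ_apply]

/-- If `p` divides its derivative then it divides all of its higher derivatives, so that the function
given by `p` vanishes identically as soon as it has a zero. -/
theorem expEval_eq_zero_of_dvd {K : IntermediateField ℚ ℂ} {μ : Fin n → K}
    {p : MvPolynomial (Option (Fin n)) K} (hp : p ∣ expDerivation μ p) {t₀ : ℂ}
    (h0 : expEval (fun i => (μ i : ℂ)) p t₀ = 0) (t : ℂ) :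
    expEval (fun i => (μ i : ℂ)) p t = 0 := by
  have hdvd : ∀ j, p ∣ (expDerivation μ)^[j] p := by
    intro j
    induction j with
    | zero => exact dvd_rfl
    | succ j ih =>
      obtain ⟨r, hr⟩ := ih
      rw [Function.iterate_succ_apply', hr, Derivation.leibniz]
      exact dvd_add (Dvd.intro _ rfl) (hp.mul_left _)
  have hdiff : Differentiable ℂ (expEval (fun i => (μ i : ℂ)) p) := fun t =>
    (hasDerivAt_expEval μ p t).differentiableAt
  rw [← Complex.taylorSeries_eq_of_entire' t₀ t hdiff]
  have h2 : ∀ j, iteratedDeriv j (expEval (fun i => (μ i : ℂ)) p) t₀ = 0 := by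
    intro j
    obtain ⟨r, hr⟩ := hdvd j
    rw [iteratedDeriv_expEval, hr, expEval, map_mul]
    rw [expEval] at h0
    rw [h0, zero_mul]
  simp [h2]

/-- Write `P = q ^ m * h` with a prime `q` that vanishes at the point. As `q` divides neither its
derivative nor `h`, the identity `P * (m * q' * h + q * h') = P' * (q * h)` is as required. -/
theorem exists_polynomial_identity {K : IntermediateField ℚ ℂ} {μ : Fin n → K} {t₀ : ℂ}
    {i : Option (Fin n)}
    (hi : AlgebraicIndependent K fun j : {j // j ≠ i} => expPoint (fun k => (μ k : ℂ)) t₀ t₀ j)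
    {P : MvPolynomial (Option (Fin n)) K} (hP : ∃ t, expEval (fun k => (μ k : ℂ)) P t ≠ 0)
    (hP0 : expEval (fun k => (μ k : ℂ)) P t₀ = 0) :
    ∃ U V, P * U = expDerivation μ P * V ∧ expEval (fun k => (μ k : ℂ)) U t₀ ≠ 0 ∧
      expEval (fun k => (μ k : ℂ)) V t₀ = 0 := by
  obtain ⟨t, ht⟩ := hP
  have hPne : P ≠ 0 := by
    rintro rfl
    exact ht (by simp [expEval])
  obtain ⟨q, hq, hqP, hq0⟩ : ∃ q, Prime q ∧ q ∣ P ∧ expEval (fun k => (μ k : ℂ)) q t₀ = 0 := by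
    obtain ⟨fs, hfs, hprod⟩ := UniqueFactorizationMonoid.exists_prime_factors P hPne
    obtain ⟨w, hw⟩ := hprod
    rw [← hw, expEval, map_mul, mul_eq_zero] at hP0
    have hunit : MvPolynomial.aeval (expPoint (fun k => (μ k : ℂ)) t₀ t₀)
        (w : MvPolynomial (Option (Fin n)) K) ≠ 0 := (w.isUnit.map _).ne_zero
    have h1 := hP0.resolve_right hunit
    rw [map_multiset_prod, Multiset.prod_eq_zero_iff, Multiset.mem_map] at h1
    obtain ⟨q, hq, hq0⟩ := h1
    exact ⟨q, hfs q hq, hw ▸ (Multiset.dvd_prod hq).mul_right _, hq0⟩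
  have hfin : FiniteMultiplicity q P := FiniteMultiplicity.of_prime_left hq hPne
  obtain ⟨h, hPh, hqh⟩ := hfin.exists_eq_pow_mul_and_not_dvd
  generalize multiplicity q P = m at hPh
  have hm : m ≠ 0 := by
    intro hm
    rw [hm, pow_zero, one_mul] at hPh
    exact hqh (hPh ▸ hqP)
  have hh0 : expEval (fun k => (μ k : ℂ)) h t₀ ≠ 0 := fun h0 =>
    hqh (prime_dvd_of_aeval_eq_zero hi hq hq0 h0)
  have hDq0 : expEval (fun k => (μ k : ℂ)) (expDerivation μ q) t₀ ≠ 0 := by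
    intro h0
    have h1 := expEval_eq_zero_of_dvd (prime_dvd_of_aeval_eq_zero hi hq hq0 h0) hq0 t
    apply ht
    obtain ⟨r, rfl⟩ := hqP
    rw [expEval, map_mul]
    rw [expEval] at h1
    rw [h1, zero_mul]
  obtain ⟨l, rfl⟩ : ∃ l, m = l + 1 := ⟨m - 1, by omega⟩
  refine ⟨(l + 1 : ℕ) * expDerivation μ q * h + q * expDerivation μ h, q * h, ?_, ?_, ?_⟩
  · have hD : expDerivation μ P = ((l + 1 : ℕ) * q ^ l * expDerivation μ q) * h
        + q ^ (l + 1) * expDerivation μ h := by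
      rw [hPh, Derivation.leibniz, Derivation.leibniz_pow]
      simp only [smul_eq_mul, nsmul_eq_mul, Nat.add_sub_cancel]
      ring
    rw [hD, hPh]
    ring
  · simp only [expEval, map_add, map_mul, map_natCast] at hq0 hh0 hDq0 ⊢
    rw [hq0, zero_mul, add_zero]
    exact mul_ne_zero (mul_ne_zero (by exact_mod_cast Nat.succ_ne_zero l) hDq0) hh0
  · simp only [expEval, map_mul] at hq0 ⊢
    rw [hq0, zero_mul]

/-- An expression is, up to an exponential factor, a polynomial in the variable and in exponentials
of linearly independent numbers. -/
theorem exists_representation (f : Terms) :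
    ∃ (n : ℕ) (μ : Fin n → codeField f.atoms), LinearIndependent ℚ (fun i => (μ i : ℂ)) ∧
      (∀ i, (μ i : ℂ) ∈ zSubring f.atoms) ∧
      ∃ (κ : codeField f.atoms) (P : MvPolynomial (Option (Fin n)) (codeField f.atoms)),
        ∀ s t : ℂ, Complex.exp (κ * t) * f.eval₂ s t
          = MvPolynomial.aeval (expPoint (fun i => (μ i : ℂ)) s t) P := by
  obtain ⟨n, μ, hlin, hspan, hcoord⟩ := exists_integral_basis {l | ∃ m ∈ f, l = m.2.2.val} (by
    have : {l | ∃ m ∈ f, l = m.2.2.val} = (fun m : ZPoly × ℕ × ZPoly => m.2.2.val) '' {m | m ∈ f} := by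
      ext l; simp [eq_comm]
    rw [this]
    exact (List.finite_toSet f).image _)
  have hμ : ∀ i, μ i ∈ zSubring f.atoms := by
    intro i
    have h1 : Submodule.span ℤ {l | ∃ m ∈ f, l = m.2.2.val}
        ≤ (zSubring f.atoms).toAddSubgroup.toIntSubmodule := by
      refine Submodule.span_le.2 ?_
      rintro _ ⟨m, hm, rfl⟩
      exact ⟨m.2.2, fun c hc => List.mem_flatMap.2 ⟨m, hm, List.mem_append_right _ hc⟩, rfl⟩
    exact h1 (hspan i)
  obtain ⟨k, hk⟩ := exists_expPoint_representation (A := f.atoms) (μ := μ) f (fun _ hc => hc)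
    fun m hm => hcoord _ ⟨m, hm, rfl⟩
  obtain ⟨P, hP⟩ := hk k le_rfl
  refine ⟨n, fun i => ⟨μ i, mem_codeField (hμ i)⟩, hlin, hμ,
    k * ∑ i, ⟨μ i, mem_codeField (hμ i)⟩, P, fun s t => ?_⟩
  rw [← hP]
  congr 3
  push_cast
  rfl

theorem exists_algebraicIndependent_expPoint (hS : SchanuelConjecture) {A : List AlgCode}
    (hA : ∀ c ∈ A, c.Valid) {μ : Fin n → codeField A}
    (hμ : LinearIndependent ℚ (fun i => (μ i : ℂ))) {t : ℂ} (ht : t ≠ 0) :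
    ∃ i : Option (Fin n), AlgebraicIndependent (codeField A) fun j : {j // j ≠ i} =>
      expPoint (fun k => (μ k : ℂ)) t t j := by
  have := isAlgebraic_codeField hA
  obtain ⟨i, hi⟩ := hS.exists_algebraicIndependent hμ
    (fun i => (Algebra.IsAlgebraic.isAlgebraic (μ i)).algebraMap) ht
  exact ⟨i, hi.extendScalars _⟩

/-- At a zero `t₀ ≠ 0` there is an identity `f u = f' v` with `u` not vanishing at `t₀`. -/
theorem exists_derivative_identity (hS : SchanuelConjecture) {f : Terms} (hf : f.Valid)
    (hf0 : ∃ z, f.eval z ≠ 0) {t₀ : ℂ} (ht₀ : t₀ ≠ 0) (h0 : f.eval t₀ = 0) :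
    ∃ u v : Terms, (∀ c ∈ u.atoms ++ v.atoms, c ∈ f.atoms) ∧
      (∀ t, Terms.eval (tMul f u ++ tScale (-1) (tMul (tDeriv f) v)) t = 0) ∧
      u.eval t₀ ≠ 0 := by
  obtain ⟨n, μ, hlin, hμ, κ, P, hP⟩ := exists_representation f
  obtain ⟨i, hi⟩ := exists_algebraicIndependent_expPoint hS hf hlin ht₀
  have hPf : ∀ t, expEval (fun k => (μ k : ℂ)) P t = Complex.exp (κ * t) * f.eval t := fun t =>
    (hP t t).symm
  obtain ⟨z, hz⟩ := hf0
  obtain ⟨U, V, hUV, hU, hV⟩ := exists_polynomial_identity (P := P) hi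
    ⟨z, by rw [hPf]; exact mul_ne_zero (Complex.exp_ne_zero _) hz⟩ (by rw [hPf, h0, mul_zero])
  have hDP : ∀ t, expEval (fun k => (μ k : ℂ)) (expDerivation μ P) t
      = Complex.exp (κ * t) * (κ * f.eval t + (tDeriv f).eval t) := by
    intro t
    refine (hasDerivAt_expEval μ P t).unique ?_
    have h1 := (((hasDerivAt_id t).const_mul (κ : ℂ)).cexp.mul (hasDerivAt_eval f t))
    have h2 : expEval (fun k => (μ k : ℂ)) P = fun t => Complex.exp (κ * t) * f.eval t := funext hPf
    rw [h2]
    refine (show HasDerivAt (fun t => Complex.exp (κ * t) * f.eval t) _ t from h1).congr_deriv ?_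
    simp only [id]
    ring
  have hid : ∀ t, f.eval t * expEval (fun k => (μ k : ℂ)) (U - MvPolynomial.C κ * V) t
      = (tDeriv f).eval t * expEval (fun k => (μ k : ℂ)) V t := by
    intro t
    have h1 := congrArg (fun p => expEval (fun k => (μ k : ℂ)) p t) hUV
    simp only [expEval, map_mul] at h1
    have h2 := hPf t
    have h3 := hDP t
    simp only [expEval] at h2 h3 ⊢
    rw [h2, h3] at h1
    rw [map_sub, map_mul, MvPolynomial.aeval_C]
    refine mul_left_cancel₀ (Complex.exp_ne_zero (κ * t)) ?_
    have h4 : algebraMap (codeField f.atoms) ℂ κ = κ := rfl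
    rw [h4]
    linear_combination h1
  obtain ⟨k, hk, u, hu, hku⟩ := exists_natCast_mul_expEval_mem_tSubring hf hμ
    (U - MvPolynomial.C κ * V)
  obtain ⟨l, hl, v, hv, hlv⟩ := exists_natCast_mul_expEval_mem_tSubring hf hμ V
  refine ⟨tScale l u, tScale k v, ?_, fun t => ?_, ?_⟩
  · intro c hc
    rcases List.mem_append.1 hc with hc | hc
    · exact hu c (atoms_tScale hc)
    · exact hv c (atoms_tScale hc)
  · rw [Terms.eval_append, eval_tScale, eval_tMul, eval_tMul, eval_tScale, eval_tScale,
      congrFun hku t, congrFun hlv t]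
    push_cast
    linear_combination (l : ℂ) * k * hid t
  · rw [eval_tScale, congrFun hku t₀]
    refine mul_ne_zero (by exact_mod_cast hl) (mul_ne_zero (by exact_mod_cast hk) ?_)
    simp only [expEval, map_sub, map_mul] at hU hV ⊢
    rwa [hV, mul_zero, sub_zero]

/-- A zero at a rational number is detected by freezing the polynomial coefficients, since the
exponentials are algebraically independent there. -/
theorem ratZero_of_eval_eq_zero (hS : SchanuelConjecture) {f : Terms} (hf : f.Valid) {p : RatCode}
    (h0 : f.eval ((p.value : ℝ) : ℂ) = 0) : RatZero f p := by
  by_cases hp : p.1 = 0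
  · refine Or.inl ⟨hp, ?_⟩
    rw [val_tZero]
    simpa [RatCode.value, hp] using h0
  refine Or.inr fun t => ?_
  have hpos : (0 : ℚ) < (p.2 : ℚ) + 1 := by positivity
  have hpv : p.value ≠ 0 := by
    rw [RatCode.value]
    exact div_ne_zero (by exact_mod_cast hp) hpos.ne'
  obtain ⟨n, μ, hlin, hμ, κ, P, hP⟩ := exists_representation f
  have hpC : (((p.value : ℝ) : ℂ)) ≠ 0 := by exact_mod_cast hpv
  obtain ⟨i, hi⟩ := exists_algebraicIndependent_expPoint hS hf hlin hpC
  have hin : i = none := by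
    by_contra hne
    have h1 := hi.transcendental ⟨none, fun h => hne h.symm⟩
    refine h1 ?_
    have h2 : IsAlgebraic (codeField f.atoms)
        (algebraMap (codeField f.atoms) ℂ (p.value : codeField f.atoms)) :=
      isAlgebraic_algebraMap _
    simpa [expPoint] using h2
  subst hin
  have hind : AlgebraicIndependent (codeField f.atoms) fun k : Fin n =>
      Complex.exp (μ k * ((p.value : ℝ) : ℂ)) :=
    hi.comp (fun k : Fin n => (⟨some k, by simp⟩ : {j : Option (Fin n) // j ≠ none}))
      fun j k hjk => by simpa using hjk
  set Q : MvPolynomial (Fin n) (codeField f.atoms) := MvPolynomial.aeval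
    (fun j : Option (Fin n) => j.elim (MvPolynomial.C (p.value : codeField f.atoms))
      MvPolynomial.X) P with hQ
  have hQe : ∀ t : ℂ, MvPolynomial.aeval (fun k => Complex.exp (μ k * t)) Q
      = Complex.exp (κ * t) * f.eval₂ (p.value : ℂ) t := by
    intro t
    rw [hP, hQ, ← AlgHom.comp_apply]
    congr 1
    ext j
    rw [AlgHom.comp_apply, MvPolynomial.aeval_X, MvPolynomial.aeval_X]
    cases j with
    | none => simp [expPoint]
    | some k => simp [expPoint]
  have hQ0 : Q = 0 := by
    have h1 := hQe ((p.value : ℝ) : ℂ)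
    have h2 : f.eval₂ (p.value : ℂ) ((p.value : ℝ) : ℂ) = 0 := by simpa [Terms.eval] using h0
    rw [h2, mul_zero] at h1
    exact (injective_iff_map_eq_zero _).1 hind Q h1
  have h3 := hQe t
  rw [hQ0, map_zero] at h3
  rw [eval_tFreeze, (mul_eq_zero.1 h3.symm).resolve_left (Complex.exp_ne_zero _), mul_zero]

end Identities

end PEFIsolation

namespace PEFIsolation

/-! ### Existence of certificates -/

section Completeness

open Set Filter Topology

theorem RatCode.exists_value_eq (q : ℚ) : ∃ c : RatCode, c.value = q := by
  refine ⟨(q.num, q.den - 1), ?_⟩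
  have h : ((q.den - 1 : ℕ) : ℚ) + 1 = q.den := by
    have := q.pos
    exact_mod_cast Nat.sub_add_cancel this
  rw [RatCode.value, h]
  exact q.num_div_den

/-- A zero has a finite order. -/
theorem exists_order {f : Terms} (hf0 : ∃ z, f.eval z ≠ 0) (x : ℂ) :
    ∃ m : ℕ, (∀ j < m, (tDeriv^[j] f).eval x = 0) ∧ (tDeriv^[m] f).eval x ≠ 0 := by
  classical
  have h : ∃ m, (tDeriv^[m] f).eval x ≠ 0 := by
    by_contra! h
    obtain ⟨z, hz⟩ := hf0
    apply hz
    rw [← Complex.taylorSeries_eq_of_entire' x z (differentiable_eval f)]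
    simp [iteratedDeriv_eval, h]
  exact ⟨Nat.find h, fun j hj => not_not.1 (Nat.find_min h hj), Nat.find_spec h⟩

theorem eventually_eq_of_eval_eq_zero {f : Terms} (hf0 : ∃ z, f.eval z ≠ 0) (x : ℝ) :
    ∀ᶠ t in 𝓝 x, f.eval ((t : ℝ) : ℂ) = 0 → t = x := by
  have h1 := ((finite_zeros hf0 (x - 1) (x + 1)).subset
    (sdiff_subset (t := {x}))).isClosed.isOpen_compl.mem_nhds (x := x) (by simp)
  filter_upwards [h1, Icc_mem_nhds (show x - 1 < x by linarith) (show x < x + 1 by linarith)]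
    with t ht1 ht2 ht0
  by_contra hne
  exact ht1 ⟨⟨ht2, ht0⟩, hne⟩

theorem eventually_ne_zero {g : Terms} {x : ℝ} (h : g.eval x ≠ 0) :
    ∀ᶠ t in 𝓝 x, g.eval ((t : ℝ) : ℂ) ≠ 0 :=
  ((continuous_eval g).comp Complex.continuous_ofReal).continuousAt.eventually_ne h

theorem noRoot_of_nonzeroOn {f : Terms} (l r : RatCode) {a b : RatCode}
    (hab : a.value ≤ b.value) (h : NonzeroOn f a b) : NoRoot (f, l, r) a b :=
  ⟨(0, a), Or.inl rfl, ⟨⟨le_rfl, hab⟩, h⟩, by simp⟩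

/-- The sign of `f f'` on both sides of an isolated zero of `f` and `f f'`, by the mean value
theorem for `f ^ 2`. -/
theorem real_mul_deriv_sign {f : Terms} {x a b : ℝ} (hax : a < x) (hxb : x < b)
    (hx : f.real x = 0)
    (hne : ∀ t ∈ Icc a b, t ≠ x → f.real t * (tDeriv f).real t ≠ 0) :
    f.real a * (tDeriv f).real a < 0 ∧ 0 < f.real b * (tDeriv f).real b := by
  have hcont : Continuous fun t => f.real t * (tDeriv f).real t :=
    (continuous_real f).mul (continuous_real _)
  have hder : ∀ t, HasDerivAt (fun t => f.real t ^ 2) (2 * (f.real t * (tDeriv f).real t)) t := by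
    intro t
    refine ((hasDerivAt_real f t).pow 2).congr_deriv ?_
    simp; ring
  have hcsq : Continuous fun t => f.real t ^ 2 := (continuous_real f).pow 2
  have hsq : ∀ t ∈ Icc a b, t ≠ x → 0 < f.real t ^ 2 := fun t ht htx =>
    pow_two_pos_of_ne_zero (left_ne_zero_of_mul (hne t ht htx))
  constructor
  · obtain ⟨c, hc, hc'⟩ := exists_hasDerivAt_eq_slope _ _ hax hcsq.continuousOn fun t _ => hder t
    have hcneg : f.real c * (tDeriv f).real c < 0 := by
      have h1 : (f.real x ^ 2 - f.real a ^ 2) / (x - a) < 0 := by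
        refine div_neg_of_neg_of_pos ?_ (by linarith)
        have := hsq a ⟨le_rfl, (hax.trans hxb).le⟩ hax.ne
        rw [hx]; linarith
      linarith
    refine lt_of_le_of_ne (not_lt.1 fun hpos => ?_) (hne a ⟨le_rfl, (hax.trans hxb).le⟩ hax.ne)
    obtain ⟨d, hd, hd0⟩ := intermediate_value_Ioo' hc.1.le hcont.continuousOn ⟨hcneg, hpos⟩
    exact hne d ⟨hd.1.le, (hd.2.trans (hc.2.trans hxb)).le⟩ (hd.2.trans hc.2).ne hd0
  · obtain ⟨c, hc, hc'⟩ := exists_hasDerivAt_eq_slope _ _ hxb hcsq.continuousOn fun t _ => hder t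
    have hcpos : 0 < f.real c * (tDeriv f).real c := by
      have h1 : 0 < (f.real b ^ 2 - f.real x ^ 2) / (b - x) := by
        refine div_pos ?_ (by linarith)
        have := hsq b ⟨(hax.trans hxb).le, le_rfl⟩ hxb.ne'
        rw [hx]; linarith
      linarith
    refine lt_of_le_of_ne (not_lt.1 fun hneg => ?_) (hne b ⟨(hax.trans hxb).le, le_rfl⟩ hxb.ne').symm
    obtain ⟨d, hd, hd0⟩ := intermediate_value_Ioo' hc.2.le hcont.continuousOn ⟨hneg, hcpos⟩
    exact hne d ⟨(hax.trans (hc.1.trans hd.1)).le, hd.2.le⟩ (hc.1.trans hd.1).ne' hd0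

/-- An endpoint of the pieces of a subdivision is an endpoint of the whole interval or not a root. -/
def Admissible (f : Terms) (l r a : RatCode) : Prop :=
  a = l ∨ a = r ∨ f.eval ((a.value : ℝ) : ℂ) ≠ 0

/-- Every sufficiently small piece near a given point can be certified. -/
theorem exists_local_certificate (hS : SchanuelConjecture) {f : Terms} (hf : f.Valid)
    (hreal : f.RealValued) (hf0 : ∃ z, f.eval z ≠ 0) (l r : RatCode) (x : ℝ) :
    ∃ δ > 0, ∀ a b : RatCode, Admissible f l r a → Admissible f l r b → a.value < b.value →
      x - δ < a.value → (b.value : ℝ) < x + δ → OneRoot f a b ∨ NoRoot (f, l, r) a b := by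
  have hball : ∀ {p : ℝ → Prop}, (∀ᶠ t in 𝓝 x, p t) →
      ∃ δ > 0, ∀ t, x - δ < t → t < x + δ → p t := by
    intro p hp
    obtain ⟨δ, hδ, h⟩ := Metric.eventually_nhds_iff.1 hp
    exact ⟨δ, hδ, fun t h1 h2 => h (by rw [Real.dist_eq, abs_lt]; constructor <;> linarith)⟩
  by_cases hx0 : f.eval x = 0
  swap
  · obtain ⟨δ, hδ, h⟩ := hball (eventually_ne_zero hx0)
    exact ⟨δ, hδ, fun a b _ _ hab ha hb => Or.inr (noRoot_of_nonzeroOn l r hab.le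
      fun t h1 h2 => h t (ha.trans_le h1) (h2.trans_lt hb))⟩
  have houtside : ∀ {δ : ℝ} {a b : RatCode}, (∀ t, x - δ < t → t < x + δ → f.eval ((t : ℝ) : ℂ) = 0 → t = x) →
      a.value < b.value → x - δ < a.value → (b.value : ℝ) < x + δ →
      ¬((a.value : ℝ) ≤ x ∧ x ≤ b.value) → NoRoot (f, l, r) a b := by
    intro δ a b h hab ha hb hx
    refine noRoot_of_nonzeroOn l r hab.le fun t h1 h2 h0 => hx ?_
    have := h t (ha.trans_le h1) (h2.trans_lt hb) h0
    subst this
    exact ⟨h1, h2⟩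
  have hstrict : x ≠ l.value → x ≠ r.value → ∀ {a : RatCode}, Admissible f l r a →
      (a.value : ℝ) ≠ x := by
    rintro hl hr a (rfl | rfl | ha) rfl
    · exact hl rfl
    · exact hr rfl
    · exact ha hx0
  by_cases hrat : x = l.value ∨ x = r.value ∨ x = 0
  · obtain ⟨p, hpx, hp⟩ : ∃ p : RatCode, (p.value : ℝ) = x ∧
        ((p = l ∨ p = r) ∨ (x ≠ l.value ∧ x ≠ r.value)) := by
      by_cases hl : x = l.value
      · exact ⟨l, hl.symm, Or.inl (Or.inl rfl)⟩
      by_cases hr : x = r.value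
      · exact ⟨r, hr.symm, Or.inl (Or.inr rfl)⟩
      obtain ⟨p, hp⟩ := RatCode.exists_value_eq 0
      refine ⟨p, ?_, Or.inr ⟨hl, hr⟩⟩
      rw [hp, (hrat.resolve_left hl).resolve_left hr]
      simp
    obtain ⟨m, hm, hm0⟩ := exists_order hf0 x
    have hmpos : 0 < m := by
      rcases Nat.eq_zero_or_pos m with rfl | h
      · exact absurd hx0 hm0
      · exact h
    obtain ⟨δ, hδ, h⟩ := hball ((eventually_eq_of_eval_eq_zero hf0 x).and (eventually_ne_zero hm0))
    refine ⟨δ, hδ, fun a b haA hbA hab ha hb => ?_⟩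
    by_cases hmem : (a.value : ℝ) ≤ x ∧ x ≤ b.value
    swap
    · exact Or.inr (houtside (fun t h1 h2 => (h t h1 h2).1) hab ha hb hmem)
    have hord : OrderAt f a b (m, p) := by
      refine ⟨⟨⟨?_, ?_⟩, fun t h1 h2 => (h t (ha.trans_le h1) (h2.trans_lt hb)).2⟩, fun j hj => ?_⟩
      · have := hmem.1; rw [← hpx] at this; exact_mod_cast this
      · have := hmem.2; rw [← hpx] at this; exact_mod_cast this
      · refine ratZero_of_eval_eq_zero hS (hf.iterate_tDeriv j) ?_
        have := hm j (List.mem_range.1 hj)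
        rwa [← hpx] at this
    rcases hp with hp | ⟨hl, hr⟩
    · exact Or.inr ⟨(m, p), Or.inr hp, hord⟩
    · have h1 := lt_of_le_of_ne hmem.1 (hstrict hl hr haA)
      have h2 := lt_of_le_of_ne hmem.2 (hstrict hl hr hbA).symm
      rw [← hpx] at h1 h2
      exact Or.inl (Or.inl ⟨(m, p), ⟨hmpos, by exact_mod_cast h1, by exact_mod_cast h2⟩, hord⟩)
  · push Not at hrat
    obtain ⟨hl, hr, hx⟩ := hrat
    obtain ⟨u, v, hatoms, hid, hu⟩ := exists_derivative_identity hS hf hf0 (t₀ := (x : ℂ))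
      (by exact_mod_cast hx) hx0
    obtain ⟨δ, hδ, h⟩ := hball ((eventually_eq_of_eval_eq_zero hf0 x).and (eventually_ne_zero hu))
    refine ⟨δ, hδ, fun a b haA hbA hab ha hb => ?_⟩
    by_cases hmem : (a.value : ℝ) ≤ x ∧ x ≤ b.value
    swap
    · exact Or.inr (houtside (fun t h1 h2 => (h t h1 h2).1) hab ha hb hmem)
    have h1 := lt_of_le_of_ne hmem.1 (hstrict hl hr haA)
    have h2 := lt_of_le_of_ne hmem.2 (hstrict hl hr hbA).symm
    obtain ⟨hsa, hsb⟩ := real_mul_deriv_sign (f := f) h1 h2 (hreal.real_eq_zero_iff.2 hx0)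
      fun t ht htx h0 => by
        obtain ⟨h3, h4⟩ := h t (ha.trans_le ht.1) (ht.2.trans_lt hb)
        rcases mul_eq_zero.1 h0 with h0 | h0
        · exact htx (h3 (hreal.real_eq_zero_iff.1 h0))
        · have hid' := hid t
          rw [Terms.eval_append, eval_tScale, eval_tMul, eval_tMul,
            hreal.tDeriv.real_eq_zero_iff.1 h0] at hid'
          simp only [zero_mul, mul_zero, add_zero, mul_eq_zero] at hid'
          exact htx (h3 (hid'.resolve_right h4))
    refine Or.inl (Or.inr ⟨(u, v), hatoms, ⟨hid, fun t h1 h2 =>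
      (h t (ha.trans_le h1) (h2.trans_lt hb)).2⟩, ?_, ?_⟩)
    · rw [eval_tScale, eval_tMul, ← hreal.ofReal_real, ← hreal.tDeriv.ofReal_real]
      simpa using hsa
    · rw [eval_tMul, ← hreal.ofReal_real, ← hreal.tDeriv.ofReal_real]
      simpa using hsb

/-- A compact interval has a certified subdivision, by a Lebesgue number of the cover by the
neighbourhoods with local certificates. -/
theorem exists_certified (hS : SchanuelConjecture) {f : Terms} (hf : f.Valid)
    (hreal : f.RealValued) (hf0 : ∃ z, f.eval z ≠ 0) {l r : RatCode} (hlr : l.value < r.value) :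
    ∃ M : Subdivision, M.Certified (f, l, r) := by
  choose δ hδ hloc using exists_local_certificate hS hf hreal hf0 l r
  obtain ⟨ε, hε, hleb⟩ := lebesgue_number_lemma_of_metric (c := fun x => Metric.ball x (δ x))
    (isCompact_Icc (a := (l.value : ℝ)) (b := r.value)) (fun x => Metric.isOpen_ball)
    (fun x _ => mem_iUnion.2 ⟨x, Metric.mem_ball_self (hδ x)⟩)
  have hpiece : ∀ a b : RatCode, Admissible f l r a → Admissible f l r b → a.value < b.value →
      l.value ≤ a.value → b.value ≤ r.value → (b.value : ℝ) < a.value + ε →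
      OneRoot f a b ∨ NoRoot (f, l, r) a b := by
    intro a b ha hb hab hla hbr hbε
    have hab' : (a.value : ℝ) < b.value := by exact_mod_cast hab
    obtain ⟨x, hx⟩ := hleb a.value ⟨by exact_mod_cast hla, by exact_mod_cast hab.le.trans hbr⟩
    have h1 := hx (Metric.mem_ball_self hε)
    have h2 := hx (show (b.value : ℝ) ∈ Metric.ball (a.value : ℝ) ε by
      rw [Metric.mem_ball, Real.dist_eq, abs_lt]; constructor <;> linarith)
    rw [Metric.mem_ball, Real.dist_eq, abs_lt] at h1 h2
    exact hloc x a b ha hb hab (by linarith [h1.1]) (by linarith [h2.2])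
  -- The pieces have length at least `ε / 2`, except the last one.
  have key : ∀ (N : ℕ) (a : RatCode), Admissible f l r a → l.value ≤ a.value → a.value < r.value →
      (r.value : ℝ) - a.value < N * (ε / 2) → ∃ M : Subdivision,
        M.map (fun m => m.1.1) ++ [r] = a :: M.map (fun m => m.1.2) ∧
        ∀ m ∈ M, m.1.1.value < m.1.2.value ∧
          ((m.2 = true ∧ OneRoot f m.1.1 m.1.2) ∨ (m.2 = false ∧ NoRoot (f, l, r) m.1.1 m.1.2)) := by
    have hflag : ∀ a b : RatCode, a.value < b.value → OneRoot f a b ∨ NoRoot (f, l, r) a b →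
        ∃ s : Bool, a.value < b.value ∧
          ((s = true ∧ OneRoot f a b) ∨ (s = false ∧ NoRoot (f, l, r) a b)) := by
      rintro a b hab (h | h)
      · exact ⟨true, hab, Or.inl ⟨rfl, h⟩⟩
      · exact ⟨false, hab, Or.inr ⟨rfl, h⟩⟩
    intro N
    induction N with
    | zero =>
      intro a _ _ har h
      have : (a.value : ℝ) < r.value := by exact_mod_cast har
      simp only [Nat.cast_zero, zero_mul] at h
      linarith
    | succ N ih =>
      intro a ha hla har h
      rcases lt_or_ge (r.value : ℝ) (a.value + ε) with hshort | hlong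
      · obtain ⟨s, hs⟩ := hflag a r har
          (hpiece a r ha (Or.inr (Or.inl rfl)) har hla le_rfl hshort)
        exact ⟨[((a, r), s)], by simp, by simpa using hs⟩
      · obtain ⟨y, hy, hy0⟩ : ∃ y ∈ Ioo ((a.value : ℝ) + ε / 2) (a.value + ε),
            y ∉ {t : ℝ | t ∈ Icc (a.value : ℝ) (a.value + ε) ∧ f.eval t = 0} := by
          by_contra! hcon
          exact Ioo_infinite (show (a.value : ℝ) + ε / 2 < a.value + ε by linarith)
            ((finite_zeros hf0 (a.value : ℝ) (a.value + ε)).subset hcon)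
        have hopen : IsOpen (Ioo ((a.value : ℝ) + ε / 2) (a.value + ε) ∩
            {t : ℝ | t ∈ Icc (a.value : ℝ) (a.value + ε) ∧ f.eval t = 0}ᶜ) :=
          isOpen_Ioo.inter (finite_zeros hf0 _ _).isClosed.isOpen_compl
        obtain ⟨q, hq1, hq2⟩ := (Rat.denseRange_cast (𝕜 := ℝ)).exists_mem_open hopen ⟨y, hy, hy0⟩
        obtain ⟨b, rfl⟩ := RatCode.exists_value_eq q
        have hab' : (a.value : ℝ) < b.value := by linarith [hq1.1]
        have hbr' : (b.value : ℝ) < r.value := by linarith [hq1.2]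
        have hab : a.value < b.value := by exact_mod_cast hab'
        have hbr : b.value < r.value := by exact_mod_cast hbr'
        have hb : Admissible f l r b := Or.inr (Or.inr fun h0 =>
          hq2 ⟨⟨hab'.le, hq1.2.le⟩, h0⟩)
        obtain ⟨M, hM1, hM2⟩ := ih b hb (hla.trans hab.le) hbr (by
          push_cast at h
          linarith [hq1.1])
        obtain ⟨s, hs⟩ := hflag a b hab (hpiece a b ha hb hab hla hbr.le hq1.2)
        refine ⟨((a, b), s) :: M, ?_, ?_⟩
        · rw [List.map_cons, List.map_cons, List.cons_append, hM1]
        · intro m hm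
          rcases List.mem_cons.1 hm with rfl | hm
          · exact hs
          · exact hM2 m hm
  obtain ⟨N, hN⟩ := exists_nat_gt (((r.value : ℝ) - l.value) / (ε / 2))
  obtain ⟨M, hM⟩ := key N l (Or.inl rfl) le_rfl hlr (by
    rwa [div_lt_iff₀ (by linarith)] at hN)
  exact ⟨M, hM⟩

theorem exists_certifiedResult (hS : SchanuelConjecture) {f : Terms} (hf : f.Valid)
    (hreal : f.RealValued) (hf0 : ∃ z, f.eval z ≠ 0) (l r : RatCode) :
    ∃ L, CertifiedResult (f, l, r) L := by
  rcases lt_or_ge l.value r.value with h | h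
  · obtain ⟨M, hM⟩ := exists_certified hS hf hreal hf0 h
    exact ⟨M.output, Or.inr ⟨M, rfl, hM⟩⟩
  · exact ⟨[], Or.inl ⟨h, rfl⟩⟩

end Completeness

end PEFIsolation

namespace PEFIsolation

/-! ### The algorithm -/

/-- The search for a certified result, started with the expression given by a code. -/
theorem exists_partrec_certifiedResult :
    ∃ F : PEFCode × IntervalCode →. List (RatCode × RatCode), Partrec F ∧
      ∀ c T, (codeTerms c).Valid → (∃ L, CertifiedResult (codeTerms c, T.1.1, T.2.1) L) →
        ∃ L ∈ F (c, T), CertifiedResult (codeTerms c, T.1.1, T.2.1) L := by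
  have hprim : Primrec fun x : (PEFCode × IntervalCode) × List (RatCode × RatCode) =>
      ((codeTerms x.1.1, x.1.2.1.1, x.1.2.2.1), x.2) :=
    primrec_prodMk (primrec_prodMk (primrec_codeTerms.comp (by fun_prop)) (by fun_prop))
      (by fun_prop)
  have hsearch := semiDec_certifiedResult.comp (S' := fun x => (codeTerms x.1.1).Valid) hprim
    fun _ hx => hx
  obtain ⟨F, hF, h⟩ := SemiDec.exists_partrec
    (S := fun y : PEFCode × IntervalCode => (codeTerms y.1).Valid)
    (R := fun x => CertifiedResult (codeTerms x.1.1, x.1.2.1.1, x.1.2.2.1) x.2) hsearch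
  exact ⟨F, hF, fun c T hc => h (c, T) hc⟩

end PEFIsolation

theorem mainTheorem2 :
    ∃ isolatePEF : PEFIsolation.PEFCode × PEFIsolation.IntervalCode →.
        List (PEFIsolation.RatCode × PEFIsolation.RatCode),
      Partrec isolatePEF ∧
      (PEFIsolation.SchanuelConjecture →
        ∀ f : PEFIsolation.PEF, f.IsReal → (∃ t : ℝ, f.eval t ≠ 0) →
          (∀ T : Set ℝ, Bornology.IsBounded T → {t ∈ T | f.eval t = 0}.Finite) ∧
          ∀ c : PEFIsolation.PEFCode, c.Represents f → ∀ T : PEFIsolation.IntervalCode,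
            ∃ L ∈ isolatePEF (c, T),
              (∀ t ∈ T.toSet, t = T.left ∨ t = T.right → f.eval t ≠ 0) →
                PEFIsolation.IsRootIsolation f.eval T.toSet
                  (PEFIsolation.decodeIntervals L)) := by
  obtain ⟨F, hF, hspec⟩ := PEFIsolation.exists_partrec_certifiedResult
  refine ⟨F, hF, fun hS f hreal hf0 => ⟨fun T hT => PEFIsolation.PEF.finite_zeros hf0 hT,
    fun c hc T => ?_⟩⟩
  obtain ⟨hvalid, heval⟩ := PEFIsolation.valid_and_eval_codeTerms hc
  have hreal' : (PEFIsolation.codeTerms c).RealValued := fun t => by rw [heval]; exact hreal t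
  have hf0' : ∃ z, (PEFIsolation.codeTerms c).eval z ≠ 0 := by
    obtain ⟨t, ht⟩ := hf0
    exact ⟨t, by rwa [heval]⟩
  obtain ⟨L, hL, hcert⟩ := hspec c T hvalid
    (PEFIsolation.exists_certifiedResult hS hvalid hreal' hf0' _ _)
  refine ⟨L, hL, fun hend => ?_⟩
  have h := hcert.isRootIsolation hreal' hf0' fun t ht h => by
    rw [heval]; exact hend t ht h
  have hfun : (fun t : ℝ => (PEFIsolation.codeTerms c).eval t) = f.eval := funext heval
  rwa [hfun] at h
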